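/- Let $\mathbf N$ be the class of all finite nilpotent semigroups, that is, of the finite semigroups that have a zero element and in which this zero element is the only idempotent. Let $\mathrm{CSM}(\mathbf N)$ (Cayley semigroup membership for $\mathbf N$) be the following decision problem: given the Cayley table of a semigroup $S \in \mathbf N$ (with elements written in binary), a subset $X \subseteq S$ and an element $t \in S$, decide whether $t$ belongs to the subsemigroup of $S$ generated by $X$. Then $\mathrm{CSM}(\mathbf N)$ is $\mathsf{NL}$-complete under $\mathsf{AC}^0$ many-one reductions: 1. the set of encodings of triples $(S, X, t)$ with $S \in \mathbf N$ and $t \in \langle X\rangle$ is in $\mathsf{NL}$, i.e. it is decided by a nondeterministic Turing machine that uses $O(\log n)$ space on inputs of length $n$; 2. for every language $L \subseteq \{0,1\}^*$ in $\mathsf{NL}$ there is a function $f\colon \{0,1\}^* \to \{0,1\}^*$, computable by a family of Boolean circuits (one multi-output circuit for each input length) of unbounded fan-in, constant depth and polynomial size, such that for every $w \in \{0,1\}^*$ the string $f(w)$ encodes a triple $(S, X, t)$ with $S \in \mathbf N$, and $w \in L$ if and only if $t \in \langle X \rangle$. Here NOT gates are allowed and are not counted for depth and size. -/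

import Mathlib

namespace Cayley

/-! ### Nondeterministic logarithmic space -/

/-- What a head on the read-only input tape can see: an end marker or an input bit. -/
inductive InputSymbol where
  | leftEnd
  | bit (b : Bool)
  | rightEnd

/-- Head movements. -/
inductive Move where
  | left
  | stay
  | right

/-- The cell reached from cell `p` of a one-way infinite tape; a head on cell `0` that is told
to move left stays on cell `0`. -/
def Move.apply : Move → ℕ → ℕ
  | .left, p => p - 1
  | .stay, p => p
  | .right, p => p + 1

/-- A nondeterministic Turing machine over the input alphabet `Bool` with a read-only two-way
input tape with end markers and `tapes` one-way infinite read-write work tapes.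
`next q a g` is the set of actions that are possible in state `q` when the input head sees `a`
and the work heads see `g`; an action is a new state, a move of the input head and, for each
work tape, a symbol to write and a move. -/
structure NTM where
  /-- number of work tapes -/
  tapes : ℕ
  /-- states -/
  State : Type
  /-- work alphabet -/
  Symbol : Type
  finite_state : Finite State
  finite_symbol : Finite Symbol
  blank : Symbol
  start : State
  accepting : Set State
  next : State → InputSymbol → (Fin tapes → Symbol) →
    Set (State × Move × (Fin tapes → Symbol × Move))

namespace NTM

variable (M : NTM)

/-- A configuration: state, position of the input head, positions of the work heads,
contents of the work tapes. -/
structure Config where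
  state : M.State
  inputHead : ℕ
  workHead : Fin M.tapes → ℕ
  work : Fin M.tapes → ℕ → M.Symbol

/-- The content of cell `p` of the input tape for the input `x`: cell `0` holds the left end
marker, the cells `1, …, |x|` hold `x`, and cell `|x| + 1` holds the right end marker. -/
def inputAt (x : List Bool) : ℕ → InputSymbol
  | 0 => .leftEnd
  | p + 1 => match x[p]? with
    | some b => .bit b
    | none => .rightEnd

/-- The initial configuration: blank work tapes, all heads on cell `0`. -/
def init : M.Config where
  state := M.start
  inputHead := 0
  workHead := fun _ => 0
  work := fun _ _ => M.blank

/-- The configuration that results from an action. The input head never passes the right end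
marker. -/
def perform (x : List Bool) (c : M.Config)
    (a : M.State × Move × (Fin M.tapes → M.Symbol × Move)) : M.Config where
  state := a.1
  inputHead := min (x.length + 1) (a.2.1.apply c.inputHead)
  workHead := fun i => (a.2.2 i).2.apply (c.workHead i)
  work := fun i => Function.update (c.work i) (c.workHead i) (a.2.2 i).1

/-- One computation step on input `x`. -/
def Step (x : List Bool) (c d : M.Config) : Prop :=
  ∃ a ∈ M.next c.state (inputAt x c.inputHead) (fun i => c.work i (c.workHead i)),
    d = M.perform x c a

/-- The configurations that occur in some computation on input `x`. -/
def Reachable (x : List Bool) (c : M.Config) : Prop :=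
  Relation.ReflTransGen (M.Step x) M.init c

/-- Some computation on input `x` reaches an accepting state. -/
def Accepts (x : List Bool) : Prop :=
  ∃ c, M.Reachable x c ∧ c.state ∈ M.accepting

/-- Every computation on every input `x` only visits the first `O(log |x|)` cells of each work
tape. -/
def RunsInLogSpace : Prop :=
  ∃ k : ℕ, ∀ (x : List Bool) (c : M.Config), M.Reachable x c →
    ∀ i, c.workHead i ≤ k * (Nat.log 2 x.length + 1)

end NTM

/-- The class NL of the languages decided by nondeterministic Turing machines in logarithmic
space. -/
def NL : Set (Language Bool) :=
  {L | ∃ M : NTM, M.RunsInLogSpace ∧ ∀ x : List Bool, x ∈ L ↔ M.Accepts x}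

/-! ### Boolean circuits of unbounded fan-in and AC⁰-computable functions -/

/-- A gate of a circuit with `n` inputs whose set of gates is `G`, given with its predecessors.
AND and OR gates have unbounded fan-in. -/
inductive Gate (n : ℕ) (G : Type) where
  | input (i : Fin n)
  | not (g : G)
  | and (s : Set G)
  | or (s : Set G)

namespace Gate

variable {n : ℕ} {G : Type}

/-- The gates that feed into a gate. -/
def preds : Gate n G → Set G
  | .input _ => ∅
  | .not g => {g}
  | .and s => s
  | .or s => s

/-- The AND and OR gates are those that count for size and depth. -/
def Counted : Gate n G → Prop
  | .input _ => False
  | .not _ => False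
  | .and _ => True
  | .or _ => True

/-- The truth value of a gate in terms of the circuit input and of the values of its
predecessors. -/
def value (x : Fin n → Bool) : (γ : Gate n G) → ((g : G) → g ∈ γ.preds → Prop) → Prop
  | .input i, _ => x i = true
  | .not g, v => ¬ v g rfl
  | .and s, v => ∀ g, ∀ h : g ∈ s, v g h
  | .or s, v => ∃ g, ∃ h : g ∈ s, v g h

end Gate

/-- A Boolean circuit with `n` inputs and `m` outputs: a finite directed acyclic graph of gates
with designated output gates. (A relation on a finite set is acyclic iff it is well-founded.) -/
structure Circuit (n m : ℕ) where
  G : Type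
  finite : Finite G
  gate : G → Gate n G
  acyclic : WellFounded fun g h : G => g ∈ (gate h).preds
  out : Fin m → G

namespace Circuit

variable {n m : ℕ} (C : Circuit n m)

/-- The truth value of a gate on input `x`. -/
def value (x : Fin n → Bool) : C.G → Prop :=
  C.acyclic.fix fun g v => (C.gate g).value x v

theorem value_eq (x : Fin n → Bool) (g : C.G) :
    C.value x g = (C.gate g).value x fun h _ => C.value x h :=
  C.acyclic.fix_eq _ g

open Classical in
/-- The output string on input `x`. -/
noncomputable def output (x : Fin n → Bool) : List Bool :=
  List.ofFn fun j => decide (C.value x (C.out j))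

/-- The size of a circuit: its number of gates, where NOT gates (and input nodes) are free. -/
noncomputable def size : ℕ := Set.ncard {g : C.G | (C.gate g).Counted}

/-- `C.DepthLE d g`: every path that ends in `g` has at most `d` AND and OR gates. -/
inductive DepthLE : ℕ → C.G → Prop
  | free (d : ℕ) (g : C.G) : ¬ (C.gate g).Counted →
      (∀ h ∈ (C.gate g).preds, DepthLE d h) → DepthLE d g
  | counted (d : ℕ) (g : C.G) : (C.gate g).Counted →
      (∀ h ∈ (C.gate g).preds, DepthLE d h) → DepthLE (d + 1) g

end Circuit

/-- A function on binary strings is AC⁰-computable if it is computed by a family of circuits, one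
for each input length, of bounded depth, polynomial size and polynomial output length. -/
def AC0Computable (f : List Bool → List Bool) : Prop :=
  ∃ (d : ℕ) (p : Polynomial ℕ), ∀ n : ℕ, ∃ (m : ℕ) (C : Circuit n m),
    m ≤ p.eval n ∧ C.size ≤ p.eval n ∧ (∀ g, C.DepthLE d g) ∧
    ∀ x : Fin n → Bool, f (List.ofFn x) = C.output x

/-! ### Decision problems and completeness -/

/-- A decision problem over a set of (binary encodings of) valid inputs. -/
structure DecisionProblem where
  inputs : Set (List Bool)
  yes : Language Bool
  yes_valid : ∀ x, x ∈ yes → x ∈ inputs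

/-- `L` is reducible to `P` by an AC⁰ many-one reduction; the reduction produces valid inputs
only. -/
def AC0Reducible (L : Language Bool) (P : DecisionProblem) : Prop :=
  ∃ f : List Bool → List Bool, AC0Computable f ∧
    (∀ x, f x ∈ P.inputs) ∧ ∀ x, x ∈ L ↔ f x ∈ P.yes

/-- `P` is NL-complete under AC⁰ many-one reductions. Strings that are not valid inputs have to be
rejected by the machine that decides `P`. -/
def NLComplete (P : DecisionProblem) : Prop :=
  P.yes ∈ NL ∧ ∀ L ∈ NL, AC0Reducible L P

/-! ### Cayley semigroup membership -/

/-- The only idempotent of the semigroup is a zero element. -/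
def IsNilpotentSemigroup (S : Type) [Semigroup S] : Prop :=
  ∃ z : S, (∀ x : S, z * x = z ∧ x * z = z) ∧ ∀ e : S, IsIdempotentElem e → e = z

/-- A semigroup `{0, …, n - 1}` given by its Cayley table, a subset and an element. -/
structure CSMInstance where
  n : ℕ
  table : Fin n → Fin n → Fin n
  assoc : ∀ a b c, table (table a b) c = table a (table b c)
  X : Finset (Fin n)
  t : Fin n

namespace CSMInstance

/-- The semigroup with the given Cayley table (a type of its own, to keep its multiplication apart
from the multiplication modulo `n`). -/
def Carrier (I : CSMInstance) : Type := Fin I.n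

instance (I : CSMInstance) : Semigroup I.Carrier where
  mul := I.table
  mul_assoc := I.assoc

/-- `t` is in the subsemigroup generated by `X`. -/
def IsYes (I : CSMInstance) : Prop :=
  (show I.Carrier from I.t) ∈ Subsemigroup.closure {x : I.Carrier | (show Fin I.n from x) ∈ I.X}

/-- An element of `{0, …, n - 1}` in binary, least significant bit first, as a block of as many
bits as the binary representation of `n` has. -/
def encodeElem (n : ℕ) (a : Fin n) : List Bool :=
  List.ofFn fun j : Fin (Nat.size n) => Nat.testBit a j

/-- The binary encoding of an instance: the order `n` in unary with a terminating `0`, the rows of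
the Cayley table one after the other with entries in binary, the characteristic vector of `X`,
and `t` in binary. -/
def encode (I : CSMInstance) : List Bool :=
  List.replicate I.n true ++ [false] ++
  (List.finRange I.n).flatMap (fun a =>
    (List.finRange I.n).flatMap fun b => encodeElem I.n (I.table a b)) ++
  List.ofFn (fun a : Fin I.n => decide (a ∈ I.X)) ++
  encodeElem I.n I.t

end CSMInstance

/-- The Cayley semigroup membership problem for a class `V` of semigroups. -/
def CSM (V : (S : Type) → [Semigroup S] → Prop) : DecisionProblem where
  inputs := {w | ∃ I : CSMInstance, V I.Carrier ∧ w = I.encode}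
  yes := {w | ∃ I : CSMInstance, V I.Carrier ∧ I.IsYes ∧ w = I.encode}
  yes_valid := fun _ ⟨I, hV, _, hw⟩ => ⟨I, hV, hw⟩

end Cayley

/-! Membership in NL. A nondeterministic program is a regular language over an alphabet of single
tape actions. Concatenation, union and Kleene star are sequential composition, choice and iteration,
so a relation between register contents that is built from these (`Impl`) is realised by one finite
automaton, and this automaton becomes the control of a Turing machine. The machine first counts the
length of its input in binary. This leaves `Nat.size x.length` work cells, and the registers are
parallel tracks on them (`machine_accepts`, `machine_runsInLogSpace`, `mem_NL_of_impl`).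

The tests (`Def`) contain addition and input access and are closed under conjunction, disjunction,
bounded quantifiers (`Def.ex`, `Def.forall_lt`) and reachability in definable graphs on pairs of
numbers (`Def.reach`). Reachability yields multiplication and binary digits, which is enough to
check the syntax of an encoding, associativity and nilpotency. No complementation is needed:
inequality is a disjunction of two strict inequalities, and a bounded universal quantifier is a
loop. Generation is itself reachability, since every product of generators arises by multiplying by
one generator at a time from the right (`mem_closure_iff_reflTransGen`).

Hardness. For a machine in logarithmic space, the graph of small configurations on inputs of length
`n` has polynomially many vertices. Arrange `T + 1` copies of it in layers, `T` being the number of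
vertices. The nonzero elements of the semigroup are pairs of layered vertices, with `(a, b)(b, d) =
(a, d)` if the layers increase strictly and zero otherwise. Strictness rules out nonzero
idempotents. The generators are the edges between consecutive layers, together with an absorbing
extra vertex that is entered from accepting configurations, so that walks of all lengths can be
prolonged to the last layer (`Span.target_mem_closure`).

The Cayley table and the target depend on `n` alone. Only the set of generators depends on the
input, and an edge depends on at most one input bit, the one under the input head
(`NTM.isLiteral_step`). Hence each output bit of the reduction is a constant or a literal, which is
far below the power of AC⁰ (`ac0Computable_of_literals`). -/

namespace Language

/-! ### Closure properties of regular languages -/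

variable {α : Type*}

/-- The union of a set of languages. -/
def union (P : Set (Language α)) : Language α := {y | ∃ N ∈ P, y ∈ N}

/-- The prefix `w` either ends inside the first factor, or it contains the whole first factor and a
prefix `v` of the second. -/
theorem leftQuotient_mul (L M : Language α) (w : List α) :
    (L * M).leftQuotient w =
      L.leftQuotient w * M + union {N | ∃ u v, u ++ v = w ∧ u ∈ L ∧ N = M.leftQuotient v} := by
  ext y
  rw [mem_leftQuotient, mem_mul, mem_add, mem_mul]
  constructor
  · rintro ⟨a, ha, b, hb, h⟩
    rcases List.append_eq_append_iff.1 h with ⟨c, rfl, rfl⟩ | ⟨c, rfl, rfl⟩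
    · exact Or.inr ⟨_, ⟨a, c, rfl, ha, rfl⟩, hb⟩
    · exact Or.inl ⟨c, ha, b, hb, rfl⟩
  · rintro (⟨a, ha, b, hb, rfl⟩ | ⟨_, ⟨u, v, rfl, hu, rfl⟩, hv⟩)
    · exact ⟨w ++ a, ha, b, hb, by simp⟩
    · exact ⟨u, hu, v ++ y, hv, by simp⟩

/-- Myhill–Nerode: by `leftQuotient_mul`, a quotient of the product is determined by one quotient of
`L` and a set of quotients of `M`, and there are finitely many of each. -/
theorem IsRegular.mul {L M : Language α} (hL : L.IsRegular) (hM : M.IsRegular) :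
    (L * M).IsRegular := by
  apply IsRegular.of_finite_range_leftQuotient
  refine ((hL.finite_range_leftQuotient.prod hM.finite_range_leftQuotient.powerset).image
    fun p => p.1 * M + union p.2).subset ?_
  rintro _ ⟨w, rfl⟩
  refine ⟨(L.leftQuotient w, {N | ∃ u v, u ++ v = w ∧ u ∈ L ∧ N = M.leftQuotient v}),
    ⟨⟨w, rfl⟩, ?_⟩, (leftQuotient_mul _ _ _).symm⟩
  rintro _ ⟨u, v, -, -, rfl⟩
  exact ⟨v, rfl⟩

theorem append_mem_kstar {L : Language α} {u v : List α} (hu : u ∈ KStar.kstar L)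
    (hv : v ∈ KStar.kstar L) : u ++ v ∈ KStar.kstar L := by
  obtain ⟨U, rfl, hU⟩ := mem_kstar.1 hu
  obtain ⟨V, rfl, hV⟩ := mem_kstar.1 hv
  refine mem_kstar.2 ⟨U ++ V, by simp, fun y hy => ?_⟩
  rcases List.mem_append.1 hy with h | h
  exacts [hU y h, hV y h]

theorem mem_kstar_of_mem {L : Language α} {u : List α} (hu : u ∈ L) : u ∈ KStar.kstar L :=
  mem_kstar.2 ⟨[u], by simp, by simpa using hu⟩

/-- The end of `w` falls into, or at the end of, some factor: `u` collects the factors before it and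
`v` is the part of that factor which belongs to `w`. A nonempty `w` guarantees that such a factor
exists. -/
theorem exists_split_of_flatten {L : Language α} (U : List (List α)) (hU : ∀ u ∈ U, u ∈ L)
    (w y : List α) (hw : w ≠ []) (h : U.flatten = w ++ y) :
    ∃ u v, u ++ v = w ∧ u ∈ KStar.kstar L ∧ y ∈ L.leftQuotient v * KStar.kstar L := by
  induction U generalizing w with
  | nil => simp at h; exact absurd h.1 hw
  | cons a U ih =>
    rw [List.flatten_cons] at h
    have ha : a ∈ L := hU a (by simp)
    have hU' : ∀ u ∈ U, u ∈ L := fun u hu => hU u (by simp [hu])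
    rcases List.append_eq_append_iff.1 h with ⟨c, rfl, h2⟩ | ⟨c, rfl, rfl⟩
    · by_cases hc : c = []
      · subst hc
        refine ⟨[], a, by simp, nil_mem_kstar _, ?_⟩
        refine mem_mul.2 ⟨[], by simpa [mem_leftQuotient] using ha, y, ?_, by simp⟩
        simp at h2
        exact h2 ▸ join_mem_kstar hU'
      · obtain ⟨u, v, rfl, hu, hy⟩ := ih hU' c hc h2
        exact ⟨a ++ u, v, by simp, append_mem_kstar (mem_kstar_of_mem ha) hu, hy⟩
    · exact ⟨[], w, by simp, nil_mem_kstar _, mem_mul.2 ⟨c, ha, _, join_mem_kstar hU', rfl⟩⟩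

theorem leftQuotient_kstar (L : Language α) (w : List α) (hw : w ≠ []) :
    (KStar.kstar L).leftQuotient w = {y | ∃ u v, u ++ v = w ∧ u ∈ KStar.kstar L ∧
      y ∈ L.leftQuotient v * KStar.kstar L} := by
  ext y
  constructor
  · intro h
    obtain ⟨U, h, hU⟩ := mem_kstar.1 ((mem_leftQuotient _ _).1 h)
    exact exists_split_of_flatten U hU w y hw h.symm
  · rintro ⟨u, v, rfl, hu, hy⟩
    obtain ⟨a, ha, b, hb, rfl⟩ := mem_mul.1 hy
    rw [mem_leftQuotient, List.append_assoc, ← List.append_assoc v]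
    exact append_mem_kstar hu (append_mem_kstar (mem_kstar_of_mem ha) hb)

/-- Myhill–Nerode again: a quotient by a nonempty word is determined by a set of quotients of `L`.
The quotient by the empty word is inserted by hand, because the formula for nonempty words may miss
the empty word. -/
theorem IsRegular.kstar {L : Language α} (hL : L.IsRegular) : (KStar.kstar L).IsRegular := by
  apply IsRegular.of_finite_range_leftQuotient
  refine ((hL.finite_range_leftQuotient.powerset.image
    fun p => ({y | ∃ N ∈ p, y ∈ N * KStar.kstar L} : Language α)).insert
      (KStar.kstar L)).subset ?_
  rintro _ ⟨w, rfl⟩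
  by_cases hw : w = []
  · subst hw
    exact Or.inl rfl
  refine Or.inr ⟨{N | ∃ u v, u ++ v = w ∧ u ∈ KStar.kstar L ∧ N = L.leftQuotient v}, ?_, ?_⟩
  · rintro _ ⟨u, v, -, -, rfl⟩
    exact ⟨v, rfl⟩
  · rw [leftQuotient_kstar _ _ hw]
    ext y
    constructor
    · rintro ⟨_, ⟨u, v, h, hu, rfl⟩, hy⟩
      exact ⟨u, v, h, hu, hy⟩
    · rintro ⟨u, v, h, hu, hy⟩
      exact ⟨_, ⟨u, v, h, hu, rfl⟩, hy⟩

/-- The language of the words of length one with letters from `A`. -/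
def letters (A : Set α) : Language α := {w | ∃ a ∈ A, w = [a]}

theorem isRegular_letters (A : Set α) : (letters A).IsRegular := by
  apply IsRegular.of_finite_range_leftQuotient
  refine (Set.toFinite {letters A, 1, 0}).subset ?_
  rintro _ ⟨w, rfl⟩
  rcases w with _ | ⟨a, _ | ⟨b, w⟩⟩
  · exact Or.inl rfl
  · by_cases ha : a ∈ A
    · refine Or.inr (Or.inl ?_)
      ext y
      rw [mem_leftQuotient, mem_one]
      constructor
      · rintro ⟨b, -, h⟩
        simpa using (List.cons.inj h).2
      · rintro rfl
        exact ⟨a, ha, rfl⟩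
    · refine Or.inr (Or.inr ?_)
      ext y
      rw [mem_leftQuotient]
      refine iff_of_false ?_ (notMem_zero y)
      rintro ⟨b, hb, h⟩
      exact ha ((List.cons.inj h).1 ▸ hb)
  · refine Or.inr (Or.inr ?_)
    ext y
    rw [mem_leftQuotient]
    refine iff_of_false ?_ (notMem_zero y)
    rintro ⟨c, -, h⟩
    simp at h

end Language

namespace Cayley

open Language

/-! ### Single actions of a machine with a multi-track work tape -/

/-- A column of a tape with `K` tracks. -/
abbrev Column (K : ℕ) := Fin K → Bool

/-- The contents of a cell of the work tape. -/
inductive Cell (K : ℕ) where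
  | marker
  | blank
  | col (c : Column K)

/-- Single actions of the machine. -/
inductive Letter (K : ℕ) where
  | enter
  | rewrite (u v : Column K)
  | exit
  | back (u : Column K)
  | head (m : Move)
  | see (a : InputSymbol)

namespace Letter

variable {K : ℕ}

/-- The content of the work cell that is required for an action. -/
def read : Letter K → Cell K
  | enter => .marker
  | rewrite u _ => .col u
  | exit => .blank
  | back u => .col u
  | head _ => .marker
  | see _ => .marker

/-- The content of the work cell after an action. -/
def write : Letter K → Cell K
  | enter => .marker
  | rewrite _ v => .col v
  | exit => .blank
  | back u => .col u
  | head _ => .marker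
  | see _ => .marker

/-- The move of the work head. -/
def move : Letter K → Move
  | enter => .right
  | rewrite _ _ => .right
  | exit => .left
  | back _ => .left
  | head _ => .stay
  | see _ => .stay

/-- The move of the input head. -/
def inMove : Letter K → Move
  | head m => m
  | _ => .stay

/-- The condition on the input symbol. -/
def Sees : Letter K → InputSymbol → Prop
  | see a, b => b = a
  | _, _ => True

end Letter

/-- Position of the input head, position of the work head, and contents of the work tape. -/
@[ext]
structure Core (K : ℕ) where
  pos : ℕ
  head : ℕ
  tape : ℕ → Cell K

variable {K : ℕ}

/-- The effect of an action. -/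
def Letter.perform (x : List Bool) (l : Letter K) (c : Core K) : Core K where
  pos := min (x.length + 1) (l.inMove.apply c.pos)
  head := l.move.apply c.head
  tape := Function.update c.tape c.head l.write

/-- The action is possible. -/
def Letter.Enabled (x : List Bool) (l : Letter K) (c : Core K) : Prop :=
  l.Sees (NTM.inputAt x c.pos) ∧ c.tape c.head = l.read

/-- The word of actions leads from one configuration to another one. -/
def Exec (x : List Bool) : List (Letter K) → Core K → Core K → Prop
  | [], c, d => d = c
  | l :: w, c, d => l.Enabled x c ∧ Exec x w (l.perform x c) d

theorem exec_append {x : List Bool} {v w : List (Letter K)} {c e : Core K} :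
    Exec x (v ++ w) c e ↔ ∃ d, Exec x v c d ∧ Exec x w d e := by
  induction v generalizing c with
  | nil => simp [Exec]
  | cons l v ih => simp [Exec, ih, and_assoc]

/-- Some word of the language leads from one configuration to another one. -/
def Runs (L : Language (Letter K)) (x : List Bool) (c d : Core K) : Prop :=
  ∃ w ∈ L, Exec x w c d

theorem runs_mul {L M : Language (Letter K)} {x : List Bool} {c e : Core K} :
    Runs (L * M) x c e ↔ ∃ d, Runs L x c d ∧ Runs M x d e := by
  constructor
  · rintro ⟨_, ⟨u, hu, v, hv, rfl⟩, h⟩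
    obtain ⟨d, h1, h2⟩ := exec_append.1 h
    exact ⟨d, ⟨u, hu, h1⟩, v, hv, h2⟩
  · rintro ⟨d, ⟨u, hu, h1⟩, v, hv, h2⟩
    exact ⟨u ++ v, append_mem_mul hu hv, exec_append.2 ⟨d, h1, h2⟩⟩

theorem runs_add {L M : Language (Letter K)} {x : List Bool} {c d : Core K} :
    Runs (L + M) x c d ↔ Runs L x c d ∨ Runs M x c d := by
  simp [Runs, mem_add, or_and_right, exists_or]

theorem runs_kstar {L : Language (Letter K)} {x : List Bool} {c d : Core K} :
    Runs (KStar.kstar L) x c d ↔ Relation.ReflTransGen (Runs L x) c d := by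
  constructor
  · rintro ⟨_, ⟨U, rfl, hU⟩, h⟩
    induction U generalizing c with
    | nil => exact h ▸ .refl
    | cons u U ih =>
      obtain ⟨e, h1, h2⟩ := exec_append.1 h
      exact .head ⟨u, hU u (by simp), h1⟩ (ih (fun y hy => hU y (by simp [hy])) h2)
  · intro h
    induction h using Relation.ReflTransGen.head_induction_on with
    | refl => exact ⟨[], nil_mem_kstar _, rfl⟩
    | head h1 _ ih =>
      obtain ⟨u, hu, h1⟩ := h1
      obtain ⟨v, hv, h2⟩ := ih
      exact ⟨u ++ v, append_mem_kstar (mem_kstar_of_mem hu) hv, exec_append.2 ⟨_, h1, h2⟩⟩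

theorem runs_letters {A : Set (Letter K)} {x : List Bool} {c d : Core K} :
    Runs (letters A) x c d ↔ ∃ l ∈ A, l.Enabled x c ∧ d = l.perform x c := by
  constructor
  · rintro ⟨_, ⟨l, hl, rfl⟩, h⟩
    exact ⟨l, hl, h⟩
  · rintro ⟨l, hl, h⟩
    exact ⟨_, ⟨l, hl, rfl⟩, h⟩

/-! ### The contents of the work tape -/

/-- The tape with a marker in cell `0`, followed by the given columns. -/
def tapeOf (m : List (Column K)) : ℕ → Cell K
  | 0 => .marker
  | j + 1 => match m[j]? with
    | some c => .col c
    | none => .blank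

theorem tapeOf_middle (pre : List (Column K)) (u : Column K) (post : List (Column K)) :
    tapeOf (pre ++ u :: post) (pre.length + 1) = .col u := by
  simp [tapeOf]

theorem tapeOf_length (m : List (Column K)) : tapeOf m (m.length + 1) = .blank := by
  simp [tapeOf]

theorem tapeOf_eq_marker {m : List (Column K)} {h : ℕ} : tapeOf m h = .marker ↔ h = 0 := by
  cases h with
  | zero => simp [tapeOf]
  | succ h => simp only [tapeOf]; split <;> simp

theorem tapeOf_eq_col {m : List (Column K)} {h : ℕ} {u : Column K} (hh : tapeOf m h = .col u) :
    ∃ pre post, m = pre ++ u :: post ∧ h = pre.length + 1 := by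
  cases h with
  | zero => simp [tapeOf] at hh
  | succ h =>
    simp only [tapeOf] at hh
    split at hh
    · rename_i c hc
      cases hh
      obtain ⟨hl, rfl⟩ := List.getElem?_eq_some_iff.1 hc
      refine ⟨m.take h, m.drop (h + 1), ?_, by simp; omega⟩
      simp
    · cases hh

theorem update_tapeOf_middle (pre : List (Column K)) (u v : Column K) (post : List (Column K)) :
    Function.update (tapeOf (pre ++ u :: post)) (pre.length + 1) (.col v) =
      tapeOf (pre ++ v :: post) := by
  funext j
  by_cases hj : j = pre.length + 1
  · subst hj
    simp [tapeOf]
  · rw [Function.update_of_ne hj]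
    cases j with
    | zero => rfl
    | succ j =>
      simp only [tapeOf]
      have : (pre ++ u :: post)[j]? = (pre ++ v :: post)[j]? := by
        rcases Nat.lt_trichotomy j pre.length with h | h | h
        · rw [List.getElem?_append_left h, List.getElem?_append_left h]
        · omega
        · rw [List.getElem?_append_right h.le, List.getElem?_append_right h.le]
          obtain ⟨k, hk⟩ : ∃ k, j - pre.length = k + 1 := ⟨j - pre.length - 1, by omega⟩
          simp [hk]
      rw [this]

/-- What an action can do to a tape that consists of a marker and columns. -/
theorem Letter.perform_tapeOf {x : List Bool} {l : Letter K} {p h : ℕ} {m : List (Column K)}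
    (hl : l.Enabled x ⟨p, h, tapeOf m⟩) (hh : h ≤ m.length + 1) :
    ∃ m' : List (Column K), m'.length = m.length ∧
      (l.perform x ⟨p, h, tapeOf m⟩).tape = tapeOf m' ∧
      (l.perform x ⟨p, h, tapeOf m⟩).head ≤ m.length + 1 := by
  obtain ⟨-, hr⟩ := hl
  have hsame : l.write = l.read → (l.perform x ⟨p, h, tapeOf m⟩).tape = tapeOf m := by
    intro e
    simp only [Letter.perform, e, ← hr, Function.update_eq_self]
  cases l with
  | rewrite u v =>
    obtain ⟨pre, post, rfl, rfl⟩ := tapeOf_eq_col hr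
    refine ⟨pre ++ v :: post, by simp, update_tapeOf_middle _ _ _ _, ?_⟩
    simp [Letter.perform, Letter.move, Move.apply]
  | enter =>
    have := tapeOf_eq_marker.1 hr
    exact ⟨m, rfl, hsame rfl, by simp_all [Letter.perform, Letter.move, Move.apply]⟩
  | exit => exact ⟨m, rfl, hsame rfl, by simp [Letter.perform, Letter.move, Move.apply]; omega⟩
  | back u => exact ⟨m, rfl, hsame rfl, by simp [Letter.perform, Letter.move, Move.apply]; omega⟩
  | head a => exact ⟨m, rfl, hsame rfl, by simpa [Letter.perform, Letter.move, Move.apply]⟩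
  | see a => exact ⟨m, rfl, hsame rfl, by simpa [Letter.perform, Letter.move, Move.apply]⟩

/-! ### Scanning the work tape -/

/-- A finite automaton that reads the columns of the tape from left to right and rewrites them. -/
structure Scanner (K : ℕ) where
  State : Type
  finite : Finite State
  start : State
  accept : Set State
  step : State → Column K → Column K → Option State

namespace Scanner

variable (A : Scanner K)

/-- The scanner can rewrite the first list of columns to the second one. -/
def RunFrom : A.State → List (Column K) → List (Column K) → Prop
  | q, [], [] => q ∈ A.accept
  | q, u :: us, v :: vs => ∃ q', A.step q u v = some q' ∧ RunFrom q' us vs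
  | _, [], _ :: _ => False
  | _, _ :: _, [] => False

theorem RunFrom.length_eq {A : Scanner K} {q : A.State} {us vs : List (Column K)}
    (h : A.RunFrom q us vs) : vs.length = us.length := by
  induction us generalizing q vs with
  | nil => cases vs with
    | nil => rfl
    | cons v vs => simp [RunFrom] at h
  | cons u us ih => cases vs with
    | nil => simp [RunFrom] at h
    | cons v vs =>
      obtain ⟨q', -, h⟩ := h
      simp [ih h]

/-- The automaton that accepts the words of rewriting actions allowed by the scanner. -/
def toDFA : DFA (Letter K) (Option A.State) where
  step q l := match q, l with
    | some q, .rewrite u v => A.step q u v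
    | _, _ => none
  start := some A.start
  accept := {q | ∃ r ∈ A.accept, q = some r}

theorem acceptsFrom_none (w : List (Letter K)) : w ∉ A.toDFA.acceptsFrom none := by
  have : A.toDFA.evalFrom none w = none := by
    induction w with
    | nil => rfl
    | cons l w ih => exact ih
  rw [DFA.mem_acceptsFrom, this]
  rintro ⟨r, -, h⟩
  cases h

/-- A `rewrite` action is enabled only if it names the column under the head, so a run of the
automaton has to follow the tape. Requiring a blank under the final head position excludes runs that
stop before the last column. The induction starts in the middle of the tape, with `pre` already
rewritten. -/
theorem runs_acceptsFrom (x : List Bool) (p : ℕ) (hp : p ≤ x.length + 1) (q : A.State)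
    (pre us : List (Column K)) (d : Core K) :
    (Runs (A.toDFA.acceptsFrom (some q)) x ⟨p, pre.length + 1, tapeOf (pre ++ us)⟩ d ∧
      d.tape d.head = .blank) ↔
    ∃ vs, A.RunFrom q us vs ∧ d = ⟨p, (pre ++ us).length + 1, tapeOf (pre ++ vs)⟩ := by
  induction us generalizing q pre with
  | nil =>
    constructor
    · rintro ⟨⟨w, hw, h⟩, hd⟩
      cases w with
      | nil =>
        obtain ⟨r, hr, h'⟩ := hw
        cases h'
        exact ⟨[], hr, by simpa [Exec] using h⟩
      | cons l w =>
        have h1 := h.1.2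
        simp only [List.append_nil, tapeOf_length] at h1
        cases l <;> simp [Letter.read] at h1
        exact absurd hw (A.acceptsFrom_none w)
    · rintro ⟨vs, hvs, rfl⟩
      cases vs with
      | nil =>
        refine ⟨⟨[], ⟨q, hvs, rfl⟩, by simp [Exec]⟩, by simpa using tapeOf_length pre⟩
      | cons v vs => simp [RunFrom] at hvs
  | cons u us ih =>
    have key : ∀ v : Column K, Letter.perform x (.rewrite u v)
        ⟨p, pre.length + 1, tapeOf (pre ++ u :: us)⟩ =
        ⟨p, (pre ++ [v]).length + 1, tapeOf ((pre ++ [v]) ++ us)⟩ := by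
      intro v
      ext1
      · simp [Letter.perform, Letter.inMove, Move.apply, hp]
      · simp [Letter.perform, Letter.move, Move.apply]
      · simpa [Letter.perform, Letter.write] using update_tapeOf_middle pre u v us
    constructor
    · rintro ⟨⟨w, hw, h⟩, hd⟩
      cases w with
      | nil =>
        rw [Exec] at h
        rw [h] at hd
        simp [tapeOf] at hd
      | cons l w =>
        obtain ⟨⟨-, h1⟩, h⟩ := h
        simp only [tapeOf_middle] at h1
        cases l <;> simp [Letter.read] at h1
        case back u' => exact absurd hw (A.acceptsFrom_none w)
        case rewrite u' v =>
          subst h1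
          rw [key] at h
          have hw' : w ∈ A.toDFA.acceptsFrom (A.step q u v) := hw
          cases hq : A.step q u v with
          | none => rw [hq] at hw'; exact absurd hw' (A.acceptsFrom_none w)
          | some q' =>
            rw [hq] at hw'
            obtain ⟨vs, hvs, rfl⟩ := (ih q' (pre ++ [v])).1 ⟨⟨w, hw', h⟩, hd⟩
            exact ⟨v :: vs, ⟨q', hq, hvs⟩, by simp⟩
    · rintro ⟨vs, hvs, rfl⟩
      cases vs with
      | nil => simp [RunFrom] at hvs
      | cons v vs =>
        obtain ⟨q', hq, hvs⟩ := hvs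
        obtain ⟨⟨w, hw, h⟩, hd⟩ := (ih q' (pre ++ [v])).2 ⟨vs, hvs, by simp⟩
        refine ⟨⟨.rewrite u v :: w, ?_, ?_, ?_⟩, by simpa using hd⟩
        · change w ∈ A.toDFA.acceptsFrom (A.step q u v)
          rwa [hq]
        · exact ⟨trivial, tapeOf_middle _ _ _⟩
        · rw [key]
          simpa using h

end Scanner

/-- The input head is on `m.1`, the work head is on cell `0`, and the work tape contains `m.2`. -/
def home (m : ℕ × List (Column K)) : Core K := ⟨m.1, 0, tapeOf m.2⟩

/-- The star may stop anywhere, but the final `head .stay` is enabled only on the marker, which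
forces the head to have arrived at cell `0`. -/
theorem runs_back {x : List Bool} {p h : ℕ} {m : List (Column K)} {d : Core K}
    (hp : p ≤ x.length + 1) (hh : h ≤ m.length) :
    Runs (KStar.kstar (letters (Set.range Letter.back)) * letters {.head .stay}) x
      ⟨p, h, tapeOf m⟩ d ↔ d = home (p, m) := by
  have hstep : ∀ h d, Runs (letters (Set.range Letter.back)) x ⟨p, h, tapeOf m⟩ d →
      d = ⟨p, h - 1, tapeOf m⟩ := by
    intro h d hd
    obtain ⟨_, ⟨u, rfl⟩, h1, rfl⟩ := runs_letters.1 hd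
    ext1
    · simp [Letter.perform, Letter.inMove, Move.apply, hp]
    · simp [Letter.perform, Letter.move, Move.apply]
    · have := h1.2
      simp only [Letter.read] at this
      simp [Letter.perform, Letter.write, ← this]
  have hstay : ∀ h d, Runs (letters {.head .stay}) x ⟨p, h, tapeOf m⟩ d ↔
      h = 0 ∧ d = home (p, m) := by
    intro h d
    rw [runs_letters]
    simp only [Set.mem_singleton_iff, exists_eq_left, Letter.Enabled, Letter.Sees, Letter.read,
      true_and, tapeOf_eq_marker]
    refine and_congr_right ?_
    rintro rfl
    have : Letter.perform x (.head .stay) ⟨p, 0, tapeOf m⟩ = home (p, m) := by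
      ext1
      · simp [Letter.perform, Letter.inMove, Move.apply, hp, home]
      · simp [Letter.perform, Letter.move, Move.apply, home]
      · have : tapeOf m 0 = .marker := rfl
        simp [Letter.perform, Letter.write, ← this, home]
    rw [this]
  rw [runs_mul]
  constructor
  · rintro ⟨e, h1, h2⟩
    rw [runs_kstar] at h1
    have : ∃ h', e = ⟨p, h', tapeOf m⟩ := by
      clear h2 hh
      induction h1 with
      | refl => exact ⟨h, rfl⟩
      | tail _ hb ih =>
        obtain ⟨h', rfl⟩ := ih
        exact ⟨_, hstep _ _ hb⟩
    obtain ⟨h', rfl⟩ := this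
    exact ((hstay _ _).1 h2).2
  · rintro rfl
    refine ⟨⟨p, 0, tapeOf m⟩, ?_, (hstay _ _).2 ⟨rfl, rfl⟩⟩
    rw [runs_kstar]
    induction h with
    | zero => exact .refl
    | succ h ih =>
      refine .head ?_ (ih (by omega))
      refine runs_letters.2 ⟨_, ⟨m[h], rfl⟩, ⟨trivial, ?_⟩, ?_⟩
      · have : h < m.length := by omega
        simp [tapeOf, Letter.read, this]
      · have h1 : h < m.length := by omega
        have h2 : tapeOf m (h + 1) = .col m[h] := by simp [tapeOf, h1]
        ext1
        · simp [Letter.perform, Letter.inMove, Move.apply, hp]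
        · simp [Letter.perform, Letter.move, Move.apply]
        · simp [Letter.perform, Letter.write, ← h2]

/-- The words of actions that let a scanner rewrite the tape and bring the head back. -/
def Scanner.lang (A : Scanner K) : Language (Letter K) :=
  letters {.enter} * (A.toDFA.accepts * (letters {.exit} *
    (KStar.kstar (letters (Set.range Letter.back)) * letters {.head .stay})))

theorem Scanner.isRegular_lang (A : Scanner K) : A.lang.IsRegular := by
  have := A.finite
  have : A.toDFA.accepts.IsRegular := ⟨_, Fintype.ofFinite _, _, rfl⟩
  exact (isRegular_letters _).mul (this.mul ((isRegular_letters _).mul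
    ((isRegular_letters _).kstar.mul (isRegular_letters _))))

theorem Scanner.runs_lang (A : Scanner K) {x : List Bool} {p : ℕ} (hp : p ≤ x.length + 1)
    {m : List (Column K)} {d : Core K} :
    Runs A.lang x (home (p, m)) d ↔ ∃ m', A.RunFrom A.start m m' ∧ d = home (p, m') := by
  have h0 : tapeOf m 0 = .marker := rfl
  have henter : ∀ d, Runs (letters {.enter}) x (home (p, m)) d ↔ d = ⟨p, 1, tapeOf m⟩ := by
    intro d
    rw [runs_letters]
    have : Letter.perform x .enter (home (p, m)) = ⟨p, 1, tapeOf m⟩ := by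
      ext1
      · simp [Letter.perform, Letter.inMove, Move.apply, hp, home]
      · simp [Letter.perform, Letter.move, Move.apply, home]
      · simp [Letter.perform, Letter.write, ← h0, home]
    simp only [Set.mem_singleton_iff, exists_eq_left, this]
    simp [Letter.Enabled, Letter.Sees, Letter.read, home, h0]
  have hexit : ∀ (m : List (Column K)) d e, (d : Core K) = ⟨p, m.length + 1, tapeOf m⟩ →
      (Runs (letters {.exit}) x d e ↔ e = ⟨p, m.length, tapeOf m⟩) := by
    rintro m d e rfl
    rw [runs_letters]
    have h1 := tapeOf_length m
    have : Letter.perform x .exit ⟨p, m.length + 1, tapeOf m⟩ = ⟨p, m.length, tapeOf m⟩ := by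
      ext1
      · simp [Letter.perform, Letter.inMove, Move.apply, hp]
      · simp [Letter.perform, Letter.move, Move.apply]
      · simp [Letter.perform, Letter.write, ← h1]
    simp [this, Letter.Enabled, Letter.Sees, Letter.read, h1]
  have hscan := A.runs_acceptsFrom x p hp A.start [] m
  simp only [List.length_nil, List.nil_append, zero_add] at hscan
  rw [Scanner.lang, runs_mul]
  simp only [henter, exists_eq_left]
  rw [runs_mul]
  constructor
  · rintro ⟨e, h1, h2⟩
    obtain ⟨f, h2, h3⟩ := runs_mul.1 h2
    -- The letter `exit` is enabled only on a blank; this is what rules out incomplete scans.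
    have he : e.tape e.head = .blank := by
      obtain ⟨_, rfl, h, -⟩ := runs_letters.1 h2
      exact h.2
    obtain ⟨vs, hvs, rfl⟩ := (hscan e).1 ⟨h1, he⟩
    have hl := hvs.length_eq
    rw [← hl] at h2
    rw [hexit vs _ _ rfl] at h2
    subst h2
    exact ⟨vs, hvs, (runs_back hp le_rfl).1 h3⟩
  · rintro ⟨m', hm, rfl⟩
    have hl := hm.length_eq
    refine ⟨_, ((hscan _).2 ⟨m', hm, rfl⟩).1, runs_mul.2 ⟨_, ?_, (runs_back hp le_rfl).2 rfl⟩⟩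
    exact (hexit m' _ _ (by rw [hl])).2 rfl

end Cayley

namespace Cayley

open Language

/-! ### Numbers on the tracks of the tape -/

/-- The number with the given binary digits, least significant digit first. -/
def digitsValue : List Bool → ℕ
  | [] => 0
  | b :: l => b.toNat + 2 * digitsValue l

theorem digitsValue_lt (l : List Bool) : digitsValue l < 2 ^ l.length := by
  induction l with
  | nil => simp [digitsValue]
  | cons b l ih =>
    have := Bool.toNat_le b
    simp only [digitsValue, List.length_cons, pow_succ]
    omega

variable {K : ℕ}

/-- The number on track `i`. -/
def track (i : Fin K) (m : List (Column K)) : ℕ := digitsValue (m.map (· i))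

theorem track_cons (i : Fin K) (u : Column K) (m : List (Column K)) :
    track i (u :: m) = (u i).toNat + 2 * track i m := rfl

theorem track_lt (i : Fin K) (m : List (Column K)) : track i m < 2 ^ m.length := by
  simpa [track] using digitsValue_lt (m.map (· i))

/-- The scanner that replaces the number on track `i` by an arbitrary number. -/
def guessScanner (i : Fin K) : Scanner K where
  State := Unit
  finite := inferInstance
  start := ()
  accept := Set.univ
  step _ u v := if ∀ j, j ≠ i → v j = u j then some () else none

theorem guessScanner_sound {i : Fin K} {us vs : List (Column K)}
    (h : (guessScanner i).RunFrom () us vs) (j : Fin K) (hj : j ≠ i) :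
    track j vs = track j us := by
  induction us generalizing vs with
  | nil => cases vs with
    | nil => rfl
    | cons v vs => simp [Scanner.RunFrom] at h
  | cons u us ih => cases vs with
    | nil => simp [Scanner.RunFrom] at h
    | cons v vs =>
      obtain ⟨⟨⟩, h1, h⟩ := h
      have h1 : ∀ j, j ≠ i → v j = u j := by
        by_contra hc
        simp [guessScanner, hc] at h1
      rw [track_cons, track_cons, ih h, h1 j hj]

theorem guessScanner_complete (i : Fin K) (us : List (Column K)) (a : ℕ)
    (ha : a < 2 ^ us.length) :
    ∃ vs, (guessScanner i).RunFrom () us vs ∧ track i vs = a := by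
  induction us generalizing a with
  | nil =>
    refine ⟨[], Set.mem_univ _, ?_⟩
    simp at ha
    simp [ha, track, digitsValue]
  | cons u us ih =>
    obtain ⟨vs, h, hv⟩ := ih (a / 2) (by rw [List.length_cons, pow_succ] at ha; omega)
    refine ⟨Function.update u i (decide (a % 2 = 1)) :: vs, ⟨(), ?_, h⟩, ?_⟩
    · simp only [guessScanner]
      rw [if_pos]
      intro j hj
      simp [hj]
    · rw [track_cons, hv, Function.update_self]
      rcases Nat.mod_two_eq_zero_or_one a with h | h <;> simp [h] <;> omega

/-- The bit of a column on an optional track. -/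
def optBit (j : Option (Fin K)) (u : Column K) : Bool := j.elim false u

/-- The number on an optional track. -/
def optTrack (j : Option (Fin K)) (m : List (Column K)) : ℕ := j.elim 0 fun j => track j m

theorem optTrack_cons (j : Option (Fin K)) (u : Column K) (m : List (Column K)) :
    optTrack j (u :: m) = (optBit j u).toNat + 2 * optTrack j m := by
  cases j <;> rfl

/-- The scanner that checks that the number on track `l` is the sum of the numbers on the tracks
`i` and `j` and of the carry `c`. -/
def addScanner (c : Bool) (i : Fin K) (j : Option (Fin K)) (l : Fin K) : Scanner K where
  State := Bool
  finite := inferInstance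
  start := c
  accept := {false}
  step q u v :=
    if v = u ∧ (u l).toNat = ((u i).toNat + (optBit j u).toNat + q.toNat) % 2 then
      some (decide (2 ≤ (u i).toNat + (optBit j u).toNat + q.toNat)) else none

/-- The state is the carry, so the induction on the digits runs over all incoming carries `q`. Only
carry `0` is accepted at the end, so the equation holds in `ℕ` and not just modulo a power of two.
-/
theorem addScanner_run {c : Bool} {i : Fin K} {j : Option (Fin K)} {l : Fin K} {q : Bool}
    {us vs : List (Column K)} :
    (addScanner c i j l).RunFrom q us vs ↔
      vs = us ∧ track l us = track i us + optTrack j us + q.toNat := by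
  induction us generalizing q vs with
  | nil => cases vs with
    | nil =>
      change q ∈ ({false} : Set Bool) ↔ _
      cases q <;> cases j <;> simp [track, optTrack, digitsValue]
    | cons v vs => simp [Scanner.RunFrom]
  | cons u us ih => cases vs with
    | nil => simp [Scanner.RunFrom]
    | cons v vs =>
      simp only [Scanner.RunFrom]
      have : ∀ q' : Bool, (addScanner c i j l).step q u v = some q' ↔
          (v = u ∧ (u l).toNat = ((u i).toNat + (optBit j u).toNat + q.toNat) % 2) ∧
            (2 ≤ (u i).toNat + (optBit j u).toNat + q.toNat ↔ q' = true) := by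
        intro q'
        simp only [addScanner]
        split
        · rename_i h
          simp only [Option.some.injEq, h, and_self, true_and]
          cases q' <;> simp
        · rename_i h
          simp [h]
      have key : ∀ q' : Bool, ((addScanner c i j l).step q u v = some q' ∧
          (addScanner c i j l).RunFrom q' us vs) ↔
          ((v = u ∧ (u l).toNat = ((u i).toNat + (optBit j u).toNat + q.toNat) % 2) ∧
            (2 ≤ (u i).toNat + (optBit j u).toNat + q.toNat ↔ q' = true)) ∧
          vs = us ∧ track l us = track i us + optTrack j us + q'.toNat := by
        intro q'
        rw [this q', ih (q := q')]
      refine (exists_congr key).trans ?_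
      rw [Bool.exists_bool]
      simp only [track_cons, optTrack_cons, List.cons.injEq]
      have h1 := Bool.toNat_le (u l)
      have h2 := Bool.toNat_le (u i)
      have h3 := Bool.toNat_le (optBit j u)
      have h4 := Bool.toNat_le q
      by_cases hv : v = u <;> by_cases hvs : vs = us <;> simp [hv, hvs]
      omega

/-! ### Relations between states that are implemented by regular languages of actions -/

/-- The bound for the numbers on the tracks when the input is `x`. -/
def bound (x : List Bool) : ℕ := 2 ^ Nat.size x.length

theorem length_lt_bound (x : List Bool) : x.length < bound x := Nat.lt_size_self _

/-- A state: the position of the input head and the values of `k` registers. -/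
abbrev Store (k : ℕ) := ℕ × (Fin k → ℕ)

/-- The values in the state are in the permitted range. -/
def Store.Ok {k : ℕ} (x : List Bool) (s : Store k) : Prop :=
  s.1 ≤ x.length + 1 ∧ ∀ i, s.2 i < bound x

/-- The tape has the right length, and the input head is in the right range. -/
def MemOk (x : List Bool) (m : ℕ × List (Column K)) : Prop :=
  m.1 ≤ x.length + 1 ∧ m.2.length = Nat.size x.length

/-- The state that is represented by a tape. -/
def view {k : ℕ} (hk : k ≤ K) (m : ℕ × List (Column K)) : Store k :=
  (m.1, fun i => track (Fin.castLE hk i) m.2)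

theorem MemOk.view_ok {x : List Bool} {m : ℕ × List (Column K)} (hm : MemOk x m) {k : ℕ}
    (hk : k ≤ K) : (view hk m).Ok x :=
  ⟨hm.1, fun i => by
    have := track_lt (Fin.castLE hk i) m.2
    rwa [hm.2] at this⟩

/-- The language implements the relation. -/
def Implements {k : ℕ} (hk : k ≤ K) (L : Language (Letter K))
    (T : List Bool → Store k → Store k → Prop) : Prop :=
  ∀ (x : List Bool) (m : ℕ × List (Column K)), MemOk x m →
    (∀ d, Runs L x (home m) d →
      ∃ m', MemOk x m' ∧ d = home m' ∧ T x (view hk m) (view hk m')) ∧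
    ∀ s', s'.Ok x → T x (view hk m) s' →
      ∃ m', MemOk x m' ∧ view hk m' = s' ∧ Runs L x (home m) (home m')

/-- The relation is implemented by a regular language of actions whenever there are enough
tracks. -/
def Impl {k : ℕ} (T : List Bool → Store k → Store k → Prop) : Prop :=
  ∃ K₀, ∀ K, K₀ ≤ K → ∀ hk : k ≤ K, ∃ L : Language (Letter K), L.IsRegular ∧ Implements hk L T

variable {k : ℕ} {T U : List Bool → Store k → Store k → Prop}

theorem Impl.congr (hT : Impl T)
    (h : ∀ x s s', s.Ok x → s'.Ok x → (T x s s' ↔ U x s s')) : Impl U := by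
  obtain ⟨K₀, H⟩ := hT
  refine ⟨K₀, fun K hK hk => ?_⟩
  obtain ⟨L, hL, HL⟩ := H K hK hk
  refine ⟨L, hL, fun x m hm => ⟨fun d hd => ?_, fun s' hs' h' => ?_⟩⟩
  · obtain ⟨m', hm', rfl, ht⟩ := (HL x m hm).1 d hd
    exact ⟨m', hm', rfl, (h _ _ _ (hm.view_ok hk) (hm'.view_ok hk)).1 ht⟩
  · exact (HL x m hm).2 s' hs' ((h _ _ _ (hm.view_ok hk) hs').2 h')

/-- The intermediate store is required to be in range because only such stores are represented by
tapes. -/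
theorem Impl.comp (hT : Impl T) (hU : Impl U) :
    Impl fun x s s' => ∃ r : Store k, r.Ok x ∧ T x s r ∧ U x r s' := by
  obtain ⟨K₁, H₁⟩ := hT
  obtain ⟨K₂, H₂⟩ := hU
  refine ⟨max K₁ K₂, fun K hK hk => ?_⟩
  obtain ⟨L₁, hL₁, HL₁⟩ := H₁ K (le_trans (le_max_left _ _) hK) hk
  obtain ⟨L₂, hL₂, HL₂⟩ := H₂ K (le_trans (le_max_right _ _) hK) hk
  refine ⟨L₁ * L₂, hL₁.mul hL₂, fun x m hm => ⟨fun d hd => ?_, ?_⟩⟩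
  · obtain ⟨e, h1, h2⟩ := runs_mul.1 hd
    obtain ⟨m₁, hm₁, rfl, ht⟩ := (HL₁ x m hm).1 e h1
    obtain ⟨m₂, hm₂, rfl, hu⟩ := (HL₂ x m₁ hm₁).1 d h2
    exact ⟨m₂, hm₂, rfl, _, hm₁.view_ok hk, ht, hu⟩
  · rintro s' hs' ⟨r, hr, ht, hu⟩
    obtain ⟨m₁, hm₁, rfl, h1⟩ := (HL₁ x m hm).2 r hr ht
    obtain ⟨m₂, hm₂, rfl, h2⟩ := (HL₂ x m₁ hm₁).2 s' hs' hu
    exact ⟨m₂, hm₂, rfl, runs_mul.2 ⟨_, h1, h2⟩⟩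

theorem Impl.or (hT : Impl T) (hU : Impl U) : Impl fun x s s' => T x s s' ∨ U x s s' := by
  obtain ⟨K₁, H₁⟩ := hT
  obtain ⟨K₂, H₂⟩ := hU
  refine ⟨max K₁ K₂, fun K hK hk => ?_⟩
  obtain ⟨L₁, hL₁, HL₁⟩ := H₁ K (le_trans (le_max_left _ _) hK) hk
  obtain ⟨L₂, hL₂, HL₂⟩ := H₂ K (le_trans (le_max_right _ _) hK) hk
  refine ⟨L₁ + L₂, hL₁.add hL₂, fun x m hm => ⟨fun d hd => ?_, ?_⟩⟩
  · rcases runs_add.1 hd with h | h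
    · obtain ⟨m₁, hm₁, rfl, ht⟩ := (HL₁ x m hm).1 d h
      exact ⟨m₁, hm₁, rfl, Or.inl ht⟩
    · obtain ⟨m₁, hm₁, rfl, ht⟩ := (HL₂ x m hm).1 d h
      exact ⟨m₁, hm₁, rfl, Or.inr ht⟩
  · rintro s' hs' (h | h)
    · obtain ⟨m₁, hm₁, rfl, h1⟩ := (HL₁ x m hm).2 s' hs' h
      exact ⟨m₁, hm₁, rfl, runs_add.2 (Or.inl h1)⟩
    · obtain ⟨m₁, hm₁, rfl, h1⟩ := (HL₂ x m hm).2 s' hs' h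
      exact ⟨m₁, hm₁, rfl, runs_add.2 (Or.inr h1)⟩

theorem Impl.star (hT : Impl T) :
    Impl fun x => Relation.ReflTransGen fun s s' => s'.Ok x ∧ T x s s' := by
  obtain ⟨K₁, H₁⟩ := hT
  refine ⟨K₁, fun K hK hk => ?_⟩
  obtain ⟨L, hL, HL⟩ := H₁ K hK hk
  refine ⟨KStar.kstar L, hL.kstar, fun x m hm => ⟨fun d hd => ?_, fun s' hs' h => ?_⟩⟩
  · rw [runs_kstar] at hd
    induction hd with
    | refl => exact ⟨m, hm, rfl, .refl⟩
    | tail _ h ih =>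
      obtain ⟨m₁, hm₁, rfl, ht⟩ := ih
      obtain ⟨m₂, hm₂, rfl, ht₂⟩ := (HL x m₁ hm₁).1 _ h
      exact ⟨m₂, hm₂, rfl, ht.tail ⟨hm₂.view_ok hk, ht₂⟩⟩
  · simp only [runs_kstar]
    clear hs'
    induction h with
    | refl => exact ⟨m, hm, rfl, .refl⟩
    | tail _ h ih =>
      obtain ⟨m₁, hm₁, rfl, ht⟩ := ih
      obtain ⟨m₂, hm₂, rfl, h2⟩ := (HL x m₁ hm₁).2 _ h.1 h.2
      exact ⟨m₂, hm₂, rfl, ht.tail h2⟩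

theorem Impl.scan {K₀ : ℕ} (A : ∀ K, k ≤ K → Scanner K)
    (h : ∀ K (hk : k ≤ K) (x : List Bool) (p : ℕ) (us : List (Column K)), K₀ ≤ K →
      us.length = Nat.size x.length →
      (∀ vs, (A K hk).RunFrom (A K hk).start us vs → T x (view hk (p, us)) (view hk (p, vs))) ∧
      ∀ s' : Store k, s'.Ok x → T x (view hk (p, us)) s' →
        ∃ vs, (A K hk).RunFrom (A K hk).start us vs ∧ view hk (p, vs) = s') : Impl T := by
  refine ⟨K₀, fun K hK hk => ⟨(A K hk).lang, (A K hk).isRegular_lang, ?_⟩⟩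
  rintro x ⟨p, us⟩ hm
  obtain ⟨h1, h2⟩ := h K hk x p us hK hm.2
  refine ⟨fun d hd => ?_, fun s' hs' ht => ?_⟩
  · obtain ⟨vs, hvs, rfl⟩ := ((A K hk).runs_lang hm.1).1 hd
    exact ⟨(p, vs), ⟨hm.1, hvs.length_eq.trans hm.2⟩, rfl, h1 vs hvs⟩
  · obtain ⟨vs, hvs, rfl⟩ := h2 s' hs' ht
    exact ⟨(p, vs), ⟨hm.1, hvs.length_eq.trans hm.2⟩, rfl,
      ((A K hk).runs_lang hm.1).2 ⟨vs, hvs, rfl⟩⟩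

theorem Impl.guess (i : Fin k) :
    Impl fun _ (s s' : Store k) => s'.1 = s.1 ∧ ∀ j, j ≠ i → s'.2 j = s.2 j := by
  refine Impl.scan (K₀ := 0) (fun K hk => guessScanner (Fin.castLE hk i)) ?_
  intro K hk x p us _ hus
  refine ⟨fun vs hvs => ⟨rfl, fun j hj => ?_⟩, ?_⟩
  · exact guessScanner_sound hvs _ (by simpa using hj)
  · rintro ⟨p', r⟩ hs' ⟨rfl, h⟩
    obtain ⟨vs, hvs, hi⟩ := guessScanner_complete (Fin.castLE hk i) us (r i)
      (by rw [hus]; exact hs'.2 i)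
    refine ⟨vs, hvs, Prod.ext rfl (funext fun j => ?_)⟩
    by_cases hj : j = i
    · subst hj
      exact hi
    · exact (guessScanner_sound hvs _ (by simpa using hj)).trans (h j hj).symm

theorem Impl.add (c : Bool) (i : Fin k) (j : Option (Fin k)) (l : Fin k) :
    Impl fun _ (s s' : Store k) => s' = s ∧ s.2 l = s.2 i + j.elim 0 s.2 + c.toNat := by
  refine Impl.scan (K₀ := 0)
    (fun K hk => addScanner c (Fin.castLE hk i) (j.map (Fin.castLE hk)) (Fin.castLE hk l)) ?_
  intro K hk x p us _ hus
  have hj : optTrack (j.map (Fin.castLE hk)) us = j.elim 0 (view hk (p, us)).2 := by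
    cases j <;> rfl
  refine ⟨fun vs hvs => ?_, ?_⟩
  · obtain ⟨rfl, h⟩ := addScanner_run.1 hvs
    rw [hj] at h
    exact ⟨rfl, h⟩
  · rintro s' - ⟨rfl, h⟩
    refine ⟨us, addScanner_run.2 ⟨rfl, ?_⟩, rfl⟩
    rw [hj]
    exact h

theorem home_perform {x : List Bool} {l : Letter K} {m : ℕ × List (Column K)}
    (hw : l.write = .marker) (hm : l.move = .stay) :
    l.perform x (home m) = home (min (x.length + 1) (l.inMove.apply m.1), m.2) := by
  have h0 : tapeOf m.2 0 = .marker := rfl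
  ext1
  · simp [Letter.perform, home]
  · simp [Letter.perform, home, hm, Move.apply]
  · simp [Letter.perform, home, hw, ← h0]

theorem Impl.head (a : Move) :
    Impl fun x (s s' : Store k) => s' = (min (x.length + 1) (a.apply s.1), s.2) := by
  refine ⟨0, fun K _ hk => ⟨letters {.head a}, isRegular_letters _, fun x m hm => ?_⟩⟩
  have h : ∀ d, Runs (letters {.head a}) x (home m) d ↔
      d = home (min (x.length + 1) (a.apply m.1), m.2) := by
    intro d
    rw [runs_letters]
    simp only [Set.mem_singleton_iff, exists_eq_left]
    rw [home_perform rfl rfl]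
    exact and_iff_right ⟨trivial, rfl⟩
  have hm' : MemOk x (min (x.length + 1) (a.apply m.1), m.2) := ⟨min_le_left _ _, hm.2⟩
  refine ⟨fun d hd => ⟨_, hm', (h d).1 hd, rfl⟩, ?_⟩
  rintro s' - rfl
  exact ⟨_, hm', rfl, (h _).2 rfl⟩

theorem Impl.see (a : InputSymbol) :
    Impl fun x (s s' : Store k) => s' = s ∧ NTM.inputAt x s.1 = a := by
  refine ⟨0, fun K _ hk => ⟨letters {.see a}, isRegular_letters _, fun x m hm => ?_⟩⟩
  have h : ∀ d, Runs (letters {.see a}) x (home m) d ↔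
      NTM.inputAt x m.1 = a ∧ d = home m := by
    intro d
    rw [runs_letters]
    simp only [Set.mem_singleton_iff, exists_eq_left]
    rw [home_perform rfl rfl]
    have h1 : min (x.length + 1) m.1 = m.1 := min_eq_right hm.1
    simp [Letter.inMove, Move.apply, h1, Letter.Enabled, Letter.Sees, home, tapeOf, Letter.read]
  refine ⟨fun d hd => ⟨m, hm, ((h d).1 hd).2, rfl, ((h d).1 hd).1⟩, ?_⟩
  rintro s' - ⟨rfl, ha⟩
  exact ⟨m, hm, rfl, (h _).2 ⟨ha, rfl⟩⟩

/-- Forget the last register. -/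
def Store.init {k : ℕ} (s : Store (k + 1)) : Store k := (s.1, Fin.init s.2)

/-- Add a register. -/
def Store.snoc {k : ℕ} (s : Store k) (a : ℕ) : Store (k + 1) :=
  (s.1, Fin.snoc (α := fun _ => ℕ) s.2 a)

theorem Store.init_snoc {k : ℕ} (s : Store k) (a : ℕ) : (s.snoc a).init = s := by
  simp [Store.init, Store.snoc]

theorem Store.snoc_init {k : ℕ} (s : Store (k + 1)) :
    s.init.snoc (s.2 (Fin.last k)) = s := by
  simp [Store.init, Store.snoc]

theorem Store.ok_snoc {k : ℕ} {x : List Bool} {s : Store k} (hs : s.Ok x) {a : ℕ}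
    (ha : a < bound x) : (s.snoc a).Ok x := by
  refine ⟨hs.1, fun i => ?_⟩
  refine Fin.lastCases ?_ (fun i => ?_) i
  · simpa [Store.snoc] using ha
  · simpa [Store.snoc] using hs.2 i

/-- The last register becomes scratch space. Completeness has to hold for every initial content of
it, whereas its final content may be chosen. -/
theorem Impl.forget {T : List Bool → Store (k + 1) → Store (k + 1) → Prop} (hT : Impl T)
    {U : List Bool → Store k → Store k → Prop}
    (hsound : ∀ x s s', s.Ok x → s'.Ok x → T x s s' → U x s.init s'.init)
    (hcomplete : ∀ x s s', s.Ok x → s'.Ok x → U x s.init s' →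
      ∃ s₁, s₁.Ok x ∧ s₁.init = s' ∧ T x s s₁) : Impl U := by
  obtain ⟨K₁, H₁⟩ := hT
  refine ⟨max K₁ (k + 1), fun K hK hk' => ?_⟩
  have hk : k + 1 ≤ K := le_trans (le_max_right _ _) hK
  obtain ⟨L, hL, HL⟩ := H₁ K (le_trans (le_max_left _ _) hK) hk
  refine ⟨L, hL, fun x m hm => ⟨fun d hd => ?_, fun s' hs' h => ?_⟩⟩
  · obtain ⟨m₁, hm₁, rfl, ht⟩ := (HL x m hm).1 d hd
    exact ⟨m₁, hm₁, rfl, hsound _ _ _ (hm.view_ok hk) (hm₁.view_ok hk) ht⟩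
  · obtain ⟨s₁, hs₁, rfl, ht⟩ := hcomplete _ (view hk m) s' (hm.view_ok hk) hs' h
    obtain ⟨m₁, hm₁, rfl, hr⟩ := (HL x m hm).2 s₁ hs₁ ht
    exact ⟨m₁, hm₁, rfl, hr⟩

/-- Guessing the scratch register first makes its initial content irrelevant: `a` is the guessed
value, `b` the one left behind. -/
theorem Impl.local {T : List Bool → Store (k + 1) → Store (k + 1) → Prop} (hT : Impl T) :
    Impl fun x (s s' : Store k) =>
      ∃ a < bound x, ∃ b < bound x, T x (s.snoc a) (s'.snoc b) := by
  refine ((Impl.guess (Fin.last k)).comp hT).forget ?_ ?_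
  · rintro x s s' hs hs' ⟨r, hr, ⟨h1, h2⟩, ht⟩
    refine ⟨r.2 (Fin.last k), hr.2 _, s'.2 (Fin.last k), hs'.2 _, ?_⟩
    rw [Store.snoc_init]
    convert ht
    conv_rhs => rw [← Store.snoc_init r]
    congr 1
    exact Prod.ext h1.symm (funext fun j => (h2 _ (Fin.castSucc_lt_last j).ne).symm)
  · rintro x s s' hs hs' ⟨a, ha, b, hb, ht⟩
    refine ⟨s'.snoc b, Store.ok_snoc hs' hb, Store.init_snoc _ _, s.init.snoc a,
      Store.ok_snoc (s := s.init) ⟨hs.1, fun i => hs.2 _⟩ ha, ⟨rfl, fun j hj => ?_⟩, ht⟩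
    obtain ⟨i, rfl⟩ := Fin.exists_castSucc_eq.2 hj
    simp [Store.snoc, Store.init, Fin.init]

end Cayley

namespace Cayley

open Language

/-! ### A machine that measures its input and then performs actions -/

/-- The states of the machine. -/
inductive Phase (σ : Type) where
  | start
  | test
  | carry
  | back
  | run (q : σ)

instance {σ : Type} [Finite σ] : Finite (Phase σ) := by
  refine Finite.of_surjective (fun o : Option (Option (Option (Option σ))) => match o with
    | none => Phase.start
    | some none => .test
    | some (some none) => .carry
    | some (some (some none)) => .back
    | some (some (some (some q))) => .run q) ?_
  rintro (_ | _ | _ | _ | q)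
  exacts [⟨none, rfl⟩, ⟨some none, rfl⟩, ⟨some (some none), rfl⟩, ⟨some (some (some none)), rfl⟩,
    ⟨some (some (some (some q))), rfl⟩]

instance {K : ℕ} : Finite (Cell K) := by
  refine Finite.of_surjective (fun o : Option (Option (Column K)) => match o with
    | none => Cell.marker
    | some none => .blank
    | some (some c) => .col c) ?_
  rintro (_ | _ | c)
  exacts [⟨none, rfl⟩, ⟨some none, rfl⟩, ⟨some (some c), rfl⟩]

/-- The column that has the same bit on all tracks. -/
def constCol (K : ℕ) (b : Bool) : Column K := fun _ => b

section Machine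

variable {K : ℕ} {σ : Type}

/-- The actions of the machine: it counts the input bits in binary on the work tape, and then
performs letters that are tracked by the automaton. -/
inductive Rule (D : DFA (Letter K) σ) :
    Phase σ → InputSymbol → Cell K → Phase σ → Move → Cell K → Move → Prop
  | start (a) (g) : Rule D .start a g .test .right .marker .stay
  | count (b) (g) : Rule D .test (.bit b) g .carry .right .marker .right
  | done (g) : Rule D .test .rightEnd g (.run D.start) .stay .marker .stay
  | carry (a) : Rule D .carry a (.col (constCol K true)) .carry .stay
      (.col (constCol K false)) .right
  | incr (a) : Rule D .carry a (.col (constCol K false)) .back .stay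
      (.col (constCol K true)) .left
  | extend (a) : Rule D .carry a .blank .back .stay (.col (constCol K true)) .left
  | back (a) (c) : Rule D .back a (.col c) .back .stay (.col c) .left
  | ready (a) : Rule D .back a .marker .test .stay .marker .stay
  | letter (q) (a) (l : Letter K) : l.Sees a →
      Rule D (.run q) a l.read (.run (D.step q l)) l.inMove l.write l.move

/-- The machine that measures its input and then performs the words of actions that are accepted
by the automaton. -/
def machine [Finite σ] (D : DFA (Letter K) σ) : NTM where
  tapes := 1
  State := Phase σ
  Symbol := Cell K
  finite_state := inferInstance
  finite_symbol := inferInstance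
  blank := .blank
  start := .start
  accepting := {s | ∃ q ∈ D.accept, s = .run q}
  next s a g := {t | Rule D s a (g 0) t.1 t.2.1 (t.2.2 0).1 (t.2.2 0).2}

variable (D : DFA (Letter K) σ)

variable [Finite σ]

/-- A configuration of the machine. -/
def config (s : Phase σ) (c : Core K) : (machine D).Config where
  state := s
  inputHead := c.pos
  workHead := fun _ => c.head
  work := fun _ => c.tape

theorem step_config {x : List Bool} {s : Phase σ} {c : Core K} {d : (machine D).Config} :
    (machine D).Step x (config D s c) d ↔ ∃ s' im w mv,
      Rule D s (NTM.inputAt x c.pos) (c.tape c.head) s' im w mv ∧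
      d = config D s' ⟨min (x.length + 1) (im.apply c.pos), mv.apply c.head,
        Function.update c.tape c.head w⟩ := by
  constructor
  · rintro ⟨⟨s', im, f⟩, h, rfl⟩
    refine ⟨s', im, (f (0 : Fin 1)).1, (f (0 : Fin 1)).2, h, ?_⟩
    have : ∀ i : Fin 1, i = 0 := fun i => Subsingleton.elim i 0
    simp only [NTM.perform, config]
    congr 1
    · funext i
      rw [this i]
    · funext i
      rw [this i]
      rfl
  · rintro ⟨s', im, w, mv, h, rfl⟩
    exact ⟨(s', im, fun _ => (w, mv)), h, rfl⟩

end Machine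

/-! ### Binary counting on the work tape -/

section Digits

variable {K : ℕ}

/-- A tape that has the given bits on all tracks. -/
def uniform (K : ℕ) (l : List Bool) : List (Column K) := l.map (constCol K)

/-- The list consists of the binary digits of `c`. -/
def IsDigits (c : ℕ) (l : List Bool) : Prop := digitsValue l = c ∧ 2 ^ l.length ≤ 2 * c + 1

/-- Digits are stored least significant first, so a carry travels to the right: the leading run of
ones turns into zeros and the first zero into a one. -/
theorem digitsValue_incr (j : ℕ) (r : List Bool) :
    digitsValue (List.replicate j false ++ true :: r) =
      digitsValue (List.replicate j true ++ false :: r) + 1 := by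
  induction j with
  | zero => simp [digitsValue]; omega
  | succ j ih => simp [List.replicate_succ, digitsValue, ih]; omega

theorem digitsValue_extend (j : ℕ) :
    digitsValue (List.replicate j false ++ [true]) = digitsValue (List.replicate j true) + 1 := by
  induction j with
  | zero => simp [digitsValue]
  | succ j ih => simp [List.replicate_succ, digitsValue, ih]; omega

theorem IsDigits.incr {c j : ℕ} {r : List Bool}
    (h : IsDigits c (List.replicate j true ++ false :: r)) :
    IsDigits (c + 1) (List.replicate j false ++ true :: r) := by
  refine ⟨by rw [digitsValue_incr, h.1], ?_⟩
  have := h.2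
  simp only [List.length_append, List.length_replicate, List.length_cons] at this ⊢
  omega

theorem IsDigits.extend {c j : ℕ} (h : IsDigits c (List.replicate j true)) :
    IsDigits (c + 1) (List.replicate j false ++ [true]) := by
  have h1 : digitsValue (List.replicate j true) + 1 = 2 ^ j := by
    clear h
    induction j with
    | zero => rfl
    | succ j ih => rw [pow_succ, ← ih]; simp [List.replicate_succ, digitsValue]; omega
  refine ⟨by rw [digitsValue_extend, h.1], ?_⟩
  rw [h.1] at h1
  simp only [List.length_append, List.length_replicate, List.length_singleton, pow_succ]
  omega

/-- The inequality in `IsDigits` forbids superfluous zeros at the most significant end; this keeps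
the counter within logarithmic space. -/
theorem IsDigits.length_le {c n : ℕ} {l : List Bool} (h : IsDigits c l) (hc : c ≤ n) :
    l.length ≤ Nat.size n := by
  have h1 := h.2
  have h2 := Nat.lt_size_self n
  have : 2 ^ l.length < 2 ^ (Nat.size n + 1) := by rw [pow_succ]; omega
  exact Nat.lt_succ_iff.1 ((Nat.pow_lt_pow_iff_right (by norm_num)).1 this)

theorem IsDigits.length_eq {c : ℕ} {l : List Bool} (h : IsDigits c l) :
    l.length = Nat.size c := by
  refine le_antisymm (h.length_le le_rfl) (Nat.size_le.2 ?_)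
  have := digitsValue_lt l
  rwa [h.1] at this

theorem constCol_injective (hK : 0 < K) : Function.Injective (constCol K) :=
  fun _ _ h => congrFun h ⟨0, hK⟩

theorem tapeOf_uniform_cons (j : ℕ) (b : Bool) (r : List Bool) :
    tapeOf (uniform K (List.replicate j false ++ b :: r)) (j + 1) = .col (constCol K b) := by
  simp [tapeOf, uniform]

theorem tapeOf_uniform_nil (j : ℕ) :
    tapeOf (uniform K (List.replicate j false ++ [])) (j + 1) = .blank := by
  simp [tapeOf, uniform]

theorem update_tapeOf_uniform_cons (j : ℕ) (b b' : Bool) (r : List Bool) :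
    Function.update (tapeOf (uniform K (List.replicate j false ++ b :: r))) (j + 1)
      (.col (constCol K b')) = tapeOf (uniform K (List.replicate j false ++ b' :: r)) := by
  have := update_tapeOf_middle (uniform K (List.replicate j false)) (constCol K b)
    (constCol K b') (uniform K r)
  simpa [uniform] using this

theorem update_tapeOf_uniform_nil (j : ℕ) (b' : Bool) :
    Function.update (tapeOf (uniform K (List.replicate j false ++ []))) (j + 1)
      (.col (constCol K b')) = tapeOf (uniform K (List.replicate j false ++ [b'])) := by
  funext i
  by_cases hi : i = j + 1
  · subst hi
    rw [tapeOf_uniform_cons, Function.update_self]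
  · rw [Function.update_of_ne hi]
    cases i with
    | zero => rfl
    | succ i =>
      simp only [tapeOf, uniform, List.append_nil, List.map_append, List.map_replicate]
      rcases lt_or_ge i j with h | h
      · rw [List.getElem?_append_left (by simpa using h)]
      · rw [List.getElem?_eq_none (by simpa using h), List.getElem?_eq_none (by simp; omega)]

end Digits

/-! ### Correctness and space bound of the machine -/

section Invariant

variable {K : ℕ} {σ : Type} (D : DFA (Letter K) σ)

/-- What can be said about the reachable configurations. -/
def Inv (x : List Bool) : Phase σ → Core K → Prop
  | .start, e => e = ⟨0, 0, fun _ => .blank⟩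
  | .test, e => ∃ c l, IsDigits c l ∧ c ≤ x.length ∧ e = ⟨c + 1, 0, tapeOf (uniform K l)⟩
  | .carry, e => ∃ c j r, IsDigits c (List.replicate j true ++ r) ∧ c + 1 ≤ x.length ∧
      e = ⟨c + 2, j + 1, tapeOf (uniform K (List.replicate j false ++ r))⟩
  | .back, e => ∃ c l h, IsDigits c l ∧ c ≤ x.length ∧ h ≤ l.length ∧
      e = ⟨c + 1, h, tapeOf (uniform K l)⟩
  | .run q, e => ∃ l w, IsDigits x.length l ∧ D.evalFrom D.start w = q ∧
      Exec x w (home (x.length + 1, uniform K l)) e ∧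
      ∃ p h m, p ≤ x.length + 1 ∧ h ≤ Nat.size x.length + 1 ∧ m.length = Nat.size x.length ∧
        e = ⟨p, h, tapeOf m⟩

theorem inputAt_succ {x : List Bool} {p : ℕ} {a : InputSymbol} (h : NTM.inputAt x (p + 1) = a) :
    a = .rightEnd ∧ x.length ≤ p ∨ ∃ b, a = .bit b ∧ p < x.length := by
  subst h
  simp only [NTM.inputAt]
  by_cases hp : p < x.length
  · simp [hp]
  · simp [hp]
    omega

/-- During a carry the input head has already passed the bit being counted while `c` is still the
old count, hence cell `c + 2`; the `j` ones behind the work head have become zeros. At least one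
track is needed, as otherwise the digits `0` and `1` would be the same column. -/
theorem inv_rule (hK : 0 < K) {x : List Bool} {s s' : Phase σ} {e : Core K} {im mv : Move} {w : Cell K}
    (hi : Inv D x s e) (hr : Rule D s (NTM.inputAt x e.pos) (e.tape e.head) s' im w mv) :
    Inv D x s' ⟨min (x.length + 1) (im.apply e.pos), mv.apply e.head,
      Function.update e.tape e.head w⟩ := by
  generalize ha : NTM.inputAt x e.pos = a at hr
  generalize hg : e.tape e.head = g at hr
  cases hr with
  | start a g =>
    cases hi
    refine ⟨0, [], ⟨rfl, by simp⟩, by simp, ?_⟩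
    ext1
    · simp [Move.apply]
    · rfl
    · funext j
      cases j with
      | zero => rfl
      | succ j => simp [tapeOf, uniform]
  | count b g =>
    obtain ⟨c, l, hl, hc, rfl⟩ := hi
    obtain ⟨h, -⟩ | ⟨b, -, h⟩ := inputAt_succ ha
    · cases h
    refine ⟨c, 0, l, by simpa using hl, h, ?_⟩
    have h0 : tapeOf (uniform K l) 0 = .marker := rfl
    ext1
    · simp [Move.apply]; omega
    · rfl
    · simp [← h0]
  | done g =>
    obtain ⟨c, l, hl, hc, rfl⟩ := hi
    obtain ⟨-, h⟩ | ⟨b, h, -⟩ := inputAt_succ ha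
    swap
    · cases h
    -- The right end marker in cell `c + 1` shows that all bits have been counted.
    obtain rfl : c = x.length := le_antisymm hc h
    have h0 : tapeOf (uniform K l) 0 = .marker := rfl
    have : (⟨min (x.length + 1) (Move.stay.apply (x.length + 1)), Move.stay.apply 0,
        Function.update (tapeOf (uniform K l)) 0 .marker⟩ : Core K) =
        home (x.length + 1, uniform K l) := by
      ext1
      · simp [Move.apply, home]
      · rfl
      · simp [← h0, home]
    rw [this]
    exact ⟨l, [], hl, rfl, rfl, x.length + 1, 0, uniform K l, le_rfl, by omega,
      by simpa [uniform] using hl.length_eq, rfl⟩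
  | carry a =>
    obtain ⟨c, j, r, hl, hc, rfl⟩ := hi
    simp only at hg
    rcases r with _ | ⟨b, r⟩
    · rw [tapeOf_uniform_nil] at hg
      cases hg
    rw [tapeOf_uniform_cons] at hg
    obtain rfl := constCol_injective hK (Cell.col.inj hg)
    refine ⟨c, j + 1, r, by simpa [List.replicate_succ'] using hl, hc, ?_⟩
    ext1
    · simp [Move.apply]; omega
    · rfl
    · simp only [update_tapeOf_uniform_cons]
      simp [List.replicate_succ']
  | incr a =>
    obtain ⟨c, j, r, hl, hc, rfl⟩ := hi
    simp only at hg
    rcases r with _ | ⟨b, r⟩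
    · rw [tapeOf_uniform_nil] at hg
      cases hg
    rw [tapeOf_uniform_cons] at hg
    obtain rfl := constCol_injective hK (Cell.col.inj hg)
    refine ⟨c + 1, _, j, hl.incr, hc, by simp, ?_⟩
    ext1
    · simp [Move.apply]; omega
    · rfl
    · simp only [update_tapeOf_uniform_cons]
  | extend a =>
    obtain ⟨c, j, r, hl, hc, rfl⟩ := hi
    simp only at hg
    rcases r with _ | ⟨b, r⟩
    swap
    · rw [tapeOf_uniform_cons] at hg
      cases hg
    rw [List.append_nil] at hl
    refine ⟨c + 1, _, j, hl.extend, hc, by simp, ?_⟩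
    ext1
    · simp [Move.apply]; omega
    · rfl
    · simp only [update_tapeOf_uniform_nil]
  | back a c =>
    obtain ⟨c, l, h, hl, hc, hh, rfl⟩ := hi
    simp only at hg
    refine ⟨c, l, h - 1, hl, hc, by omega, ?_⟩
    ext1
    · simp [Move.apply]; omega
    · rfl
    · simp [← hg]
  | ready a =>
    obtain ⟨c, l, h, hl, hc, hh, rfl⟩ := hi
    simp only at hg
    obtain rfl := tapeOf_eq_marker.1 hg
    refine ⟨c, l, hl, hc, ?_⟩
    ext1
    · simp [Move.apply]; omega
    · rfl
    · simp [← hg]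
  | letter q a l hs =>
    obtain ⟨d, v, hd, rfl, hv, p, h, m, hp, hh, hm, rfl⟩ := hi
    have hl : l.Enabled x ⟨p, h, tapeOf m⟩ := ⟨ha ▸ hs, hg⟩
    refine ⟨d, v ++ [l], hd, by simp, exec_append.2 ⟨_, hv, hl, rfl⟩, ?_⟩
    obtain ⟨m', h1, h2, h3⟩ := l.perform_tapeOf hl (by omega)
    exact ⟨_, _, m', min_le_left _ _, hm ▸ h3, h1.trans hm, by
      ext1
      · rfl
      · rfl
      · exact h2⟩

variable [Finite σ]

theorem exists_of_reachable (hK : 0 < K) {x : List Bool} {d : (machine D).Config}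
    (h : (machine D).Reachable x d) : ∃ s e, d = config D s e ∧ Inv D x s e := by
  induction h with
  | refl => exact ⟨.start, ⟨0, 0, fun _ => .blank⟩, rfl, rfl⟩
  | tail _ h ih =>
    obtain ⟨s, e, rfl, hi⟩ := ih
    obtain ⟨s', im, w, mv, hr, rfl⟩ := (step_config D).1 h
    exact ⟨_, _, rfl, inv_rule D hK hi hr⟩

theorem machine_runsInLogSpace (hK : 0 < K) : (machine D).RunsInLogSpace := by
  -- The head stays within `size + 1 ≤ log + 2 ≤ 2 * (log + 1)`.
  refine ⟨2, fun x d hd i => ?_⟩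
  obtain ⟨s, e, rfl, hi⟩ := exists_of_reachable D hK hd
  change e.head ≤ _
  have h1 : Nat.size x.length ≤ Nat.log 2 x.length + 1 :=
    Nat.size_le.2 (Nat.lt_pow_succ_log_self (by norm_num) _)
  suffices e.head ≤ Nat.size x.length + 1 by omega
  cases s with
  | start => cases hi; simp
  | test => obtain ⟨c, l, -, -, rfl⟩ := hi; simp
  | carry =>
    obtain ⟨c, j, r, hl, hc, rfl⟩ := hi
    have := hl.length_le (n := x.length) (by omega)
    simp at this
    simp
    omega
  | back =>
    obtain ⟨c, l, h, hl, hc, hh, rfl⟩ := hi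
    have := hl.length_le hc
    simp
    omega
  | run q =>
    obtain ⟨l, w, -, -, -, p, h, m, -, hh, -, rfl⟩ := hi
    exact hh

theorem step_of_rule {x : List Bool} {s s' : Phase σ} {c c' : Core K} {im mv : Move} {w : Cell K}
    {a : InputSymbol} {g : Cell K} (ha : NTM.inputAt x c.pos = a) (hg : c.tape c.head = g)
    (hr : Rule D s a g s' im w mv)
    (hc : c' = ⟨min (x.length + 1) (im.apply c.pos), mv.apply c.head,
        Function.update c.tape c.head w⟩) :
    (machine D).Step x (config D s c) (config D s' c') :=
  (step_config D).2 ⟨s', im, w, mv, by rwa [ha, hg], by rw [hc]⟩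

theorem reaches_test_of_back {x : List Bool} {p h : ℕ} (hp : p ≤ x.length + 1) (l : List Bool)
    (hh : h ≤ l.length) :
    Relation.ReflTransGen ((machine D).Step x) (config D .back ⟨p, h, tapeOf (uniform K l)⟩)
      (config D .test ⟨p, 0, tapeOf (uniform K l)⟩) := by
  induction h with
  | zero =>
    refine .single (step_of_rule D rfl rfl (.ready _) ?_)
    have h0 : tapeOf (uniform K l) 0 = .marker := rfl
    ext1
    · simp [Move.apply, hp]
    · rfl
    · simp [← h0]
  | succ h ih =>
    refine .head ?_ (ih (by omega))
    have h1 : tapeOf (uniform K l) (h + 1) = .col (constCol K l[h]) := by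
      simp [tapeOf, uniform, List.getElem?_eq_getElem (show h < l.length by omega)]
    refine step_of_rule D (c := ⟨p, h + 1, tapeOf (uniform K l)⟩) rfl h1 (.back _ _) ?_
    ext1
    · simp [Move.apply, hp]
    · rfl
    · simp [h1]

theorem reaches_test_of_carry {x : List Bool} {p c j : ℕ} (hp : p ≤ x.length + 1)
    (r : List Bool) (hl : IsDigits c (List.replicate j true ++ r)) :
    ∃ l, IsDigits (c + 1) l ∧ Relation.ReflTransGen ((machine D).Step x)
      (config D .carry ⟨p, j + 1, tapeOf (uniform K (List.replicate j false ++ r))⟩)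
      (config D .test ⟨p, 0, tapeOf (uniform K l)⟩) := by
  induction r generalizing j with
  | nil =>
    rw [List.append_nil] at hl
    refine ⟨_, hl.extend, .head (step_of_rule D (c' := ⟨p, j, _⟩) rfl
      (tapeOf_uniform_nil j) (.extend _) ?_) (reaches_test_of_back D hp _ (by simp))⟩
    ext1
    · simp [Move.apply, hp]
    · rfl
    · simp only [update_tapeOf_uniform_nil]
  | cons b r ih =>
    cases b with
    | false =>
      refine ⟨_, hl.incr, .head (step_of_rule D (c' := ⟨p, j, _⟩) rfl
        (tapeOf_uniform_cons j _ _) (.incr _) ?_) (reaches_test_of_back D hp _ (by simp))⟩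
      ext1
      · simp [Move.apply, hp]
      · rfl
      · simp only [update_tapeOf_uniform_cons]
    | true =>
      obtain ⟨l, h1, h2⟩ := ih (j := j + 1) (by simpa [List.replicate_succ'] using hl)
      refine ⟨l, h1, .head (step_of_rule D rfl (tapeOf_uniform_cons j _ _) (.carry _) ?_) h2⟩
      ext1
      · simp [Move.apply, hp]
      · rfl
      · simp only [update_tapeOf_uniform_cons]
        simp [List.replicate_succ']

theorem reaches_test {x : List Bool} (c : ℕ) (hc : c ≤ x.length) :
    ∃ l, IsDigits c l ∧
      (machine D).Reachable x (config D .test ⟨c + 1, 0, tapeOf (uniform K l)⟩) := by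
  induction c with
  | zero =>
    refine ⟨[], ⟨rfl, by simp⟩, .single ?_⟩
    refine step_of_rule D (s := .start) (c := ⟨0, 0, fun _ => .blank⟩) rfl rfl (.start _ _) ?_
    ext1
    · simp [Move.apply]
    · rfl
    · funext j
      cases j with
      | zero => rfl
      | succ j => simp [tapeOf, uniform]
  | succ c ih =>
    obtain ⟨l, hl, hr⟩ := ih (by omega)
    obtain ⟨l', hl', hr'⟩ := reaches_test_of_carry D (x := x) (p := c + 2) (j := 0) (by omega) l
      (by simpa using hl)
    refine ⟨l', hl', (hr.tail ?_).trans hr'⟩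
    have hx : NTM.inputAt x (c + 1) = .bit (x[c]'(by omega)) := by
      simp [NTM.inputAt, List.getElem?_eq_getElem (show c < x.length by omega)]
    refine step_of_rule D (c := ⟨c + 1, 0, tapeOf (uniform K l)⟩) hx rfl (.count _ _) ?_
    have h0 : tapeOf (uniform K l) 0 = .marker := rfl
    ext1
    · simp [Move.apply]; omega
    · rfl
    · simp [← h0]

theorem reaches_run {x : List Bool} : ∃ l, IsDigits x.length l ∧
    (machine D).Reachable x (config D (.run D.start) (home (x.length + 1, uniform K l))) := by
  obtain ⟨l, hl, hr⟩ := reaches_test D x.length le_rfl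
  refine ⟨l, hl, hr.tail ?_⟩
  have hx : NTM.inputAt x (x.length + 1) = .rightEnd := by simp [NTM.inputAt]
  refine step_of_rule D (c := ⟨x.length + 1, 0, tapeOf (uniform K l)⟩) hx rfl (.done _) ?_
  have h0 : tapeOf (uniform K l) 0 = .marker := rfl
  ext1
  · simp [Move.apply, home]
  · rfl
  · simp [← h0, home]

theorem reaches_of_exec {x : List Bool} {w : List (Letter K)} {q : σ} {c d : Core K}
    (h : Exec x w c d) : Relation.ReflTransGen ((machine D).Step x) (config D (.run q) c)
      (config D (.run (D.evalFrom q w)) d) := by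
  induction w generalizing q c with
  | nil => cases h; exact .refl
  | cons l w ih =>
    exact .head (step_of_rule D rfl h.1.2 (.letter _ _ _ h.1.1) rfl) (ih h.2)

theorem machine_accepts (hK : 0 < K) (x : List Bool) : (machine D).Accepts x ↔
    ∃ l, IsDigits x.length l ∧
      ∃ d, Runs D.accepts x (home (x.length + 1, uniform K l)) d := by
  constructor
  · rintro ⟨d, hd, q, hq, h⟩
    obtain ⟨s, e, rfl, hi⟩ := exists_of_reachable D hK hd
    obtain rfl : s = .run q := h
    obtain ⟨l, w, hl, rfl, hw, -⟩ := hi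
    exact ⟨l, hl, e, w, hq, hw⟩
  · rintro ⟨l, hl, d, w, hw, h⟩
    obtain ⟨l', hl', hr⟩ := reaches_run D (x := x)
    -- Uniqueness of binary expansions of a given length: the tape `l` of the hypothesis is the tape
    -- `l'` that the counting phase really produces.
    have : ∀ l l' : List Bool, l.length = l'.length → digitsValue l = digitsValue l' → l = l' := by
      intro l
      induction l with
      | nil => intro l' h _; exact (List.length_eq_zero_iff.1 h.symm).symm
      | cons b l ih =>
        intro l' h1 h2
        cases l' with
        | nil => simp at h1
        | cons b' l' =>
          simp only [digitsValue] at h2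
          simp only [List.length_cons, add_left_inj] at h1
          have : b = b' := by cases b <;> cases b' <;> simp at h2 ⊢ <;> omega
          subst this
          rw [ih l' h1 (by omega)]
    obtain rfl := this l l' (hl.length_eq.trans hl'.length_eq.symm) (hl.1.trans hl'.1.symm)
    exact ⟨_, hr.trans (reaches_of_exec D h), _, hw, rfl⟩

end Invariant

/-- A property of strings that is tested by an implementable relation is in NL. -/
theorem mem_NL_of_impl {R : List Bool → Prop}
    (h : Impl fun x (s s' : Store 0) => s.1 = 0 ∧ s' = s ∧ R x) : {x | R x} ∈ NL := by
  -- Counting leaves the input head on the right end marker, whereas tests start on cell `0`; so the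
  -- head is moved left any number of times, and the test itself rejects the other positions.
  have hleft : Impl fun x (s s' : Store 0) => ∃ r : Store 0, r.Ok x ∧
      Relation.ReflTransGen (fun s s' : Store 0 => s'.Ok x ∧
        s' = (min (x.length + 1) (Move.left.apply s.1), s.2)) s r ∧
      (r.1 = 0 ∧ s' = r ∧ R x) := (Impl.head .left).star.comp h
  obtain ⟨K₀, H⟩ := hleft
  -- One more track than required, so that there is at least one to count on.
  obtain ⟨L, ⟨σ, hσ, D, rfl⟩, HL⟩ := H (K₀ + 1) (by omega) (Nat.zero_le _)
  refine ⟨machine D, machine_runsInLogSpace D (Nat.succ_pos _), fun x => ?_⟩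
  have hok : ∀ l, IsDigits x.length l → MemOk x (x.length + 1, uniform (K₀ + 1) l) := by
    intro l hl
    exact ⟨le_rfl, by simpa [uniform] using hl.length_eq⟩
  rw [machine_accepts D (Nat.succ_pos _)]
  constructor
  · intro hx
    obtain ⟨l, hl, -⟩ := reaches_run D (x := x)
    refine ⟨l, hl, ?_⟩
    have h0 : ∀ p ≤ x.length + 1, ∀ v : Fin 0 → ℕ,
        Relation.ReflTransGen (fun s s' : Store 0 => s'.Ok x ∧
          s' = (min (x.length + 1) (Move.left.apply s.1), s.2)) (p, v) (0, v) := by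
      intro p hp v
      induction p with
      | zero => exact .refl
      | succ p ih =>
        refine .head ⟨⟨?_, fun i => i.elim0⟩, ?_⟩ (ih (by omega))
        · simp; omega
        · simp [Move.apply]; omega
    obtain ⟨m, -, -, hr⟩ := (HL x _ (hok l hl)).2 (0, Fin.elim0) ⟨by simp, fun i => i.elim0⟩
      ⟨(0, _), ⟨by simp, fun i => i.elim0⟩, h0 _ le_rfl _, rfl, Prod.ext rfl (funext fun i => i.elim0),
        hx⟩
    exact ⟨_, hr⟩
  · rintro ⟨l, hl, d, hd⟩
    obtain ⟨m, -, -, -, -, -, -, -, hR⟩ := (HL x _ (hok l hl)).1 d hd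
    exact hR

end Cayley

namespace Cayley

open Language Relation

variable {k : ℕ}

/-! ### Assignments to registers -/

theorem Store.ok_init {x : List Bool} {s : Store (k + 1)} (hs : s.Ok x) : s.init.Ok x :=
  ⟨hs.1, fun _ => hs.2 _⟩

theorem Store.snoc_inj {s s' : Store k} {a b : ℕ} : s.snoc a = s'.snoc b ↔ s = s' ∧ a = b := by
  constructor
  · intro h
    refine ⟨?_, ?_⟩
    · simpa [Store.init_snoc] using congrArg Store.init h
    · simpa [Store.snoc] using congrArg (fun s : Store (k + 1) => s.2 (Fin.last k)) h
  · rintro ⟨rfl, rfl⟩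
    rfl

/-- The new value is guessed into a scratch register and verified there; then register `i` is
guessed and compared with it. The detour is needed because `f` may depend on the old content of
register `i`. -/
theorem Impl.assign (i : Fin k) {f : List Bool → Store k → ℕ}
    (h : Impl fun x (s s' : Store (k + 1)) => s' = s ∧ s.2 (Fin.last k) = f x s.init) :
    Impl fun x (s s' : Store k) => s' = (s.1, Function.update s.2 i (f x s)) := by
  refine ((h.comp ((Impl.guess i.castSucc).comp
    (Impl.add false (Fin.last k) none i.castSucc))).local).congr ?_
  intro x s s' hs hs'
  constructor
  · rintro ⟨a, ha, b, hb, _, -, ⟨rfl, h1⟩, r, hr, ⟨h2, h3⟩, h4, h5⟩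
    subst h4
    refine Prod.ext h2 (funext fun j => ?_)
    simp only [Store.snoc, Fin.snoc_last, Fin.snoc_castSucc, Option.elim_none, add_zero,
      Bool.toNat_false] at h1 h2 h3 h5
    have h6 := h3 (Fin.last k) (Fin.castSucc_lt_last i).ne'
    simp only [Fin.snoc_last] at h6
    by_cases hj : j = i
    · subst hj
      change s'.2 j = Function.update s.2 j (f x s) j
      rw [Function.update_self, h5, h6, h1]
      exact congrArg (f x) (Store.init_snoc s a)
    · have h7 := h3 j.castSucc (by simpa using hj)
      simp only [Fin.snoc_castSucc] at h7
      change s'.2 j = Function.update s.2 i (f x s) j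
      rw [Function.update_of_ne hj, h7]
  · rintro rfl
    have hf : f x s < bound x := by simpa using hs'.2 i
    refine ⟨f x s, hf, f x s, hf, _, Store.ok_snoc hs hf, ⟨rfl, ?_⟩, _, Store.ok_snoc hs' hf,
      ⟨rfl, ?_⟩, rfl, ?_⟩
    · rw [Store.init_snoc]
      simp [Store.snoc]
    · intro j
      refine Fin.lastCases ?_ (fun j => ?_) j
      · simp [Store.snoc, (Fin.castSucc_lt_last i).ne']
      · intro hj
        have : j ≠ i := by simpa using hj
        simp [Store.snoc, this]
    · simp [Store.snoc, (Fin.castSucc_lt_last i).ne']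

theorem Impl.incr (i : Fin k) :
    Impl fun _ (s s' : Store k) => s' = (s.1, Function.update s.2 i (s.2 i + 1)) :=
  Impl.assign i (f := fun _ s => s.2 i + 1) (Impl.add true i.castSucc none (Fin.last k))

theorem Impl.copy (i j : Fin k) :
    Impl fun _ (s s' : Store k) => s' = (s.1, Function.update s.2 i (s.2 j)) :=
  Impl.assign i (f := fun _ s => s.2 j) (Impl.add false j.castSucc none (Fin.last k))

theorem Impl.reset (i : Fin k) :
    Impl fun _ (s s' : Store k) => s' = (s.1, Function.update s.2 i 0) := by
  refine Impl.assign i (f := fun _ _ => 0)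
    -- The equation `a = a + a` characterises `0`.
    ((Impl.add false (Fin.last k) (some (Fin.last k)) (Fin.last k)).congr ?_)
  intro x s s' _ _
  simp

theorem inputAt_eq_leftEnd {x : List Bool} {p : ℕ} : NTM.inputAt x p = .leftEnd ↔ p = 0 := by
  cases p with
  | zero => simp [NTM.inputAt]
  | succ p =>
    simp only [NTM.inputAt]
    split <;> simp

/-! ### Definable properties -/

/-- A property of `k` numbers that is tested by an implementable relation. -/
def Def (R : List Bool → (Fin k → ℕ) → Prop) : Prop :=
  Impl fun x (s s' : Store k) => s.1 = 0 ∧ s' = s ∧ R x s.2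

/-- One of the variables. -/
def Var (f : (Fin k → ℕ) → ℕ) : Prop := ∃ i, f = fun v => v i

theorem Var.last : Var fun v : Fin (k + 1) → ℕ => v (Fin.last k) := ⟨_, rfl⟩

/-- Variables are handled like de Bruijn indices: `Var.last` is the innermost bound variable, and
each `init` steps past one binder. -/
theorem Var.init {f : (Fin k → ℕ) → ℕ} (hf : Var f) :
    Var fun v : Fin (k + 1) → ℕ => f (Fin.init v) := by
  obtain ⟨i, rfl⟩ := hf
  exact ⟨i.castSucc, rfl⟩

theorem Var.lt {f : (Fin k → ℕ) → ℕ} (hf : Var f) {v : Fin k → ℕ} {n : ℕ} (hv : ∀ i, v i < n) :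
    f v < n := by
  obtain ⟨i, rfl⟩ := hf
  exact hv i

variable {R R' : List Bool → (Fin k → ℕ) → Prop} {f g h : (Fin k → ℕ) → ℕ}

theorem Def.congr (hR : Def R) (H : ∀ x v, (∀ i, v i < bound x) → (R x v ↔ R' x v)) : Def R' :=
  Impl.congr hR fun x s _ hs _ => by rw [H x s.2 hs.2]

theorem Def.and (hR : Def R) (hR' : Def R') : Def fun x v => R x v ∧ R' x v := by
  refine (Impl.comp hR hR').congr fun x s s' hs _ => ?_
  constructor
  · rintro ⟨_, -, ⟨h1, rfl, h2⟩, -, rfl, h3⟩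
    exact ⟨h1, rfl, h2, h3⟩
  · rintro ⟨h1, rfl, h2, h3⟩
    exact ⟨_, hs, ⟨h1, rfl, h2⟩, h1, rfl, h3⟩

theorem Def.or (hR : Def R) (hR' : Def R') : Def fun x v => R x v ∨ R' x v := by
  refine (Impl.or hR hR').congr fun x s s' hs _ => ?_
  tauto

/-- The witness is guessed in a local register, which is why it is bounded by the capacity of a
track. -/
theorem Def.ex {Q : List Bool → (Fin k → ℕ) → ℕ → Prop}
    (hQ : Def fun x (v : Fin (k + 1) → ℕ) => Q x (Fin.init v) (v (Fin.last k))) :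
    Def fun x v => ∃ a < bound x, Q x v a := by
  refine (Impl.local hQ).congr fun x s s' hs _ => ?_
  constructor
  · rintro ⟨a, ha, b, hb, h1, h2, h3⟩
    obtain ⟨rfl, rfl⟩ := Store.snoc_inj.1 h2
    refine ⟨h1, rfl, b, ha, ?_⟩
    simpa [Store.snoc] using h3
  · rintro ⟨h1, rfl, a, ha, h3⟩
    refine ⟨a, ha, a, ha, h1, rfl, ?_⟩
    simpa [Store.snoc] using h3

theorem Def.of_test (hR : Impl fun x (s s' : Store k) => s' = s ∧ R x s.2) : Def R := by
  refine ((Impl.see .leftEnd).comp hR).congr fun x s s' hs _ => ?_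
  constructor
  · rintro ⟨_, -, ⟨rfl, h1⟩, rfl, h2⟩
    exact ⟨inputAt_eq_leftEnd.1 h1, rfl, h2⟩
  · rintro ⟨h1, rfl, h2⟩
    exact ⟨_, hs, ⟨rfl, inputAt_eq_leftEnd.2 h1⟩, rfl, h2⟩

theorem Def.add (hf : Var f) (hg : Var g) (hh : Var h) : Def fun _ v => h v = f v + g v := by
  obtain ⟨i, rfl⟩ := hf
  obtain ⟨j, rfl⟩ := hg
  obtain ⟨l, rfl⟩ := hh
  exact Def.of_test (Impl.add false i (some j) l)

theorem Def.eq (hf : Var f) (hh : Var h) : Def fun _ v => h v = f v := by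
  obtain ⟨i, rfl⟩ := hf
  obtain ⟨l, rfl⟩ := hh
  exact Def.of_test (Impl.add false i none l)

theorem Def.succ (hf : Var f) (hh : Var h) : Def fun _ v => h v = f v + 1 := by
  obtain ⟨i, rfl⟩ := hf
  obtain ⟨l, rfl⟩ := hh
  exact Def.of_test (Impl.add true i none l)

theorem Def.zero (hf : Var f) : Def fun _ v => f v = 0 :=
  (Def.add hf hf hf).congr fun x v _ => by omega

theorem Def.lt (hf : Var f) (hg : Var g) : Def fun _ v => f v < g v := by
  have : Def fun x v => ∃ a < bound x, ∃ b < bound x, b = f v + a ∧ g v = b + 1 :=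
    .ex <| .ex <| .and (.add hf.init.init Var.last.init .last) (.succ .last hg.init.init)
  refine this.congr fun x v hv => ⟨?_, fun h => ?_⟩
  · rintro ⟨a, -, b, -, rfl, h⟩
    omega
  · have := hg.lt hv
    exact ⟨g v - f v - 1, by omega, g v - 1, by omega, by omega, by omega⟩

/-- Definable properties are not known to be closed under negation, so inequality is expressed
positively. -/
theorem Def.ne (hf : Var f) (hg : Var g) : Def fun _ v => f v ≠ g v :=
  ((Def.lt hf hg).or (Def.lt hg hf)).congr fun x v _ => by omega

/-- The bits of the input are definable. -/
theorem Def.bit (hf : Var f) (o : Option Bool) : Def fun x v => x[f v]? = o := by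
  obtain ⟨i, rfl⟩ := hf
  -- A position beyond the end of `x` corresponds to the right end marker, where the head gets
  -- stuck.
  let sym : InputSymbol := o.elim .rightEnd .bit
  have hsym : ∀ (x : List Bool) n, NTM.inputAt x (min (x.length + 1) (n + 1)) = sym ↔
      x[n]? = o := by
    intro x n
    rw [Nat.add_min_add_right]
    simp only [NTM.inputAt, sym]
    rcases lt_or_ge n x.length with h | h
    · rw [min_eq_right h.le, List.getElem?_eq_getElem h]
      cases o <;> simp
    · rw [min_eq_left h, List.getElem?_eq_none h, List.getElem?_eq_none le_rfl]
      cases o <;> simp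
  -- A local counter and the input head advance together until the counter equals the index. One
  -- extra move to the right skips the left end marker; after the symbol has been read, the head
  -- returns to cell `0`.
  refine Impl.congr (((Impl.see .leftEnd).comp <| (Impl.reset (Fin.last k)).comp <|
    ((Impl.incr (Fin.last k)).comp (Impl.head .right)).star.comp <|
    (Impl.add false (Fin.last k) none i.castSucc).comp <| (Impl.head .right).comp <|
    (Impl.see sym).comp <| (Impl.head .left).star.comp (Impl.see .leftEnd)).local) ?_
  intro x s s' hs hs'
  have hleft : ∀ r r' : Store (k + 1), ReflTransGen (fun s s' : Store (k + 1) => s'.Ok x ∧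
      s' = (min (x.length + 1) (Move.left.apply s.1), s.2)) r r' → r'.2 = r.2 := by
    intro r r' h
    induction h with
    | refl => rfl
    | tail _ h ih => rw [h.2, ih]
  have hleft' : ∀ p (v : Fin (k + 1) → ℕ), p ≤ x.length + 1 → (∀ i, v i < bound x) →
      ReflTransGen (fun s s' : Store (k + 1) => s'.Ok x ∧
      s' = (min (x.length + 1) (Move.left.apply s.1), s.2)) (p, v) (0, v) := by
    intro p v hp hv
    induction p with
    | zero => exact .refl
    | succ p ih =>
      refine .head ⟨⟨?_, hv⟩, ?_⟩ (ih (by omega))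
      · simp; omega
      · simp [Move.apply]; omega
  constructor
  · rintro ⟨a, ha, b, hb, _, -, ⟨rfl, h1⟩, _, -, rfl, _, hr, hloop, r, -, ⟨rfl, h2⟩, _, -, rfl,
      _, -, ⟨rfl, h3⟩, q, -, h4, h5, h6⟩
    subst h5
    -- Loop invariant: the head position is the counter, cut off at the right end marker, and the
    -- other registers are unchanged.
    have hloop' : r.1 = min (x.length + 1) (r.2 (Fin.last k)) ∧ r.init.2 = s.2 := by
      clear h2 h3 h4 hr
      induction hloop with
      | refl =>
        refine ⟨?_, ?_⟩
        · simpa [Store.snoc] using inputAt_eq_leftEnd.1 h1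
        · simp [Store.snoc, Store.init]
      | tail _ h ih =>
        obtain ⟨-, _, -, rfl, rfl⟩ := h
        obtain ⟨h7, h8⟩ := ih
        refine ⟨?_, ?_⟩
        · simp only [Move.apply, Function.update_self, h7]
          omega
        · rw [← h8]
          simp [Store.init]
    have h7 := hleft _ _ h4
    have h8 : s' = (0, s.2) := by
      refine Prod.ext (inputAt_eq_leftEnd.1 h6) ?_
      rw [← hloop'.2]
      have := congrArg Fin.init h7
      simpa [Store.snoc, Store.init] using this
    have h9 : s.1 = 0 := inputAt_eq_leftEnd.1 h1
    refine ⟨h9, h8.trans (Prod.ext h9.symm rfl), ?_⟩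
    change x[s.2 i]? = o
    rw [← hsym]
    have h10 : r.2 i.castSucc = s.2 i := congrFun hloop'.2 i
    simp only [Option.elim_none, add_zero, Bool.toNat_false] at h2
    rw [h10] at h2
    rw [h2]
    convert h3 using 2
    simp [Move.apply, hloop'.1]
    omega
  · rintro ⟨h0, rfl, h⟩
    have hb : ∀ n ≤ s'.2 i, n < bound x := fun n hn => lt_of_le_of_lt hn (hs.2 i)
    have hok : ∀ n ≤ s'.2 i, ∀ p, p ≤ x.length + 1 →
        Store.Ok x (p, Fin.snoc (α := fun _ => ℕ) s'.2 n) := fun n hn p hp =>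
      Store.ok_snoc (s := (p, s'.2)) ⟨hp, hs.2⟩ (hb n hn)
    have hloop : ∀ n ≤ s'.2 i, ReflTransGen (fun s s' : Store (k + 1) => s'.Ok x ∧
        ∃ r : Store (k + 1), r.Ok x ∧ r = (s.1, Function.update s.2 (Fin.last k)
          (s.2 (Fin.last k) + 1)) ∧ s' = (min (x.length + 1) (Move.right.apply r.1), r.2))
        (s'.snoc 0) (min (x.length + 1) n, Fin.snoc (α := fun _ => ℕ) s'.2 n) := by
      intro n hn
      induction n with
      | zero =>
        have : s'.snoc 0 = (min (x.length + 1) 0, Fin.snoc (α := fun _ => ℕ) s'.2 0) := by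
          simp [Store.snoc, h0]
        rw [this]
      | succ n ih =>
        refine .tail (ih (by omega)) ⟨hok _ hn _ (min_le_left _ _), _, hok _ hn _
          (min_le_left _ n), ?_, ?_⟩
        · simp [Fin.update_snoc_last]
        · simp [Move.apply]
          omega
    refine ⟨0, hb 0 (by omega), s'.2 i, hb _ le_rfl, _, Store.ok_snoc hs (hb 0 (by omega)),
      ⟨rfl, inputAt_eq_leftEnd.2 h0⟩, _, Store.ok_snoc hs (hb 0 (by omega)), ?_, _,
      hok _ le_rfl _ (min_le_left _ _), hloop _ le_rfl, _, hok _ le_rfl _ (min_le_left _ _),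
      ⟨rfl, ?_⟩, _, hok _ le_rfl _ (min_le_left _ _), rfl, _, hok _ le_rfl _ (min_le_left _ _),
      ⟨rfl, ?_⟩, _, hok _ le_rfl 0 (by omega), hleft' _ _ (min_le_left _ _) ?_, ?_,
      inputAt_eq_leftEnd.2 rfl⟩
    · simp [Store.snoc]
    · simp
    · change x[s'.2 i]? = o at h
      rw [← hsym] at h
      rw [← h]
      congr 1
      simp [Move.apply]
      omega
    · exact (hok _ le_rfl 0 (by omega)).2
    · simp [Store.snoc, h0]

/-! ### Registers added at the end of a store, and reachability -/

theorem Store.update_snoc (s : Store k) (a : ℕ) (i : Fin k) (y : ℕ) :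
    ((s.snoc a).1, Function.update (s.snoc a).2 i.castSucc y) =
      Store.snoc (s.1, Function.update s.2 i y) a := by
  simp [Store.snoc, Fin.snoc_update]

theorem Store.update_snoc_last (s : Store k) (a : ℕ) (y : ℕ) :
    ((s.snoc a).1, Function.update (s.snoc a).2 (Fin.last k) y) = s.snoc y := by
  simp [Store.snoc, Fin.update_snoc_last]

theorem Store.exists_snoc (s : Store (k + 1)) : ∃ r a, s = Store.snoc r a :=
  ⟨s.init, _, s.snoc_init.symm⟩

theorem Store.snoc_last (s : Store k) (a : ℕ) : (s.snoc a).2 (Fin.last k) = a := by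
  simp [Store.snoc]

theorem Store.snoc_castSucc (s : Store k) (a : ℕ) (i : Fin k) :
    (s.snoc a).2 i.castSucc = s.2 i := by
  simp [Store.snoc]

theorem Store.finInit_snoc (s : Store k) (a : ℕ) : Fin.init (s.snoc a).2 = s.2 := by
  simp [Store.snoc]

theorem Store.ok_snoc_iff {x : List Bool} {s : Store k} {a : ℕ} :
    (s.snoc a).Ok x ↔ s.Ok x ∧ a < bound x := by
  refine ⟨fun h => ⟨?_, ?_⟩, fun h => Store.ok_snoc h.1 h.2⟩
  · simpa [Store.init_snoc] using Store.ok_init h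
  · simpa [Store.snoc_last] using h.2 (Fin.last k)

/-- Reachability in a definable graph on pairs of numbers is definable. -/
theorem Def.reach {f' g' : (Fin k → ℕ) → ℕ} (hf : Var f) (hg : Var g) (hf' : Var f')
    (hg' : Var g') {E : List Bool → (Fin k → ℕ) → ℕ → ℕ → ℕ → ℕ → Prop}
    (hE : Def fun x (v : Fin (k + 1 + 1 + 1 + 1) → ℕ) =>
      E x (Fin.init (Fin.init (Fin.init (Fin.init v))))
        (Fin.init (Fin.init (Fin.init v)) (Fin.last k)) (Fin.init (Fin.init v) (Fin.last (k + 1)))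
        (Fin.init v (Fin.last (k + 2))) (v (Fin.last (k + 3)))) :
    Def fun x v => ReflTransGen
      (fun a b : ℕ × ℕ => (b.1 < bound x ∧ b.2 < bound x) ∧ E x v a.1 a.2 b.1 b.2)
      (f v, g v) (f' v, g' v) := by
  have hbody : Impl fun x (s s' : Store (k + 1 + 1)) => s.1 = 0 ∧ ∃ a < bound x, ∃ b < bound x,
      E x s.init.init.2 (s.init.2 (Fin.last k)) (s.2 (Fin.last (k + 1))) a b ∧
      s' = (s.init.init.snoc a).snoc b := by
    -- One round of the loop: guess a successor pair in two local registers, check the edge, and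
    -- copy the pair over the current one.
    refine ((hE.comp ((Impl.copy (Fin.last k).castSucc.castSucc.castSucc
      (Fin.last (k + 2)).castSucc).comp (Impl.copy (Fin.last (k + 1)).castSucc.castSucc
      (Fin.last (k + 3))))).local.local).congr ?_
    intro x s s' hs hs'
    obtain ⟨s, a, rfl⟩ := s.exists_snoc
    obtain ⟨s, b, rfl⟩ := s.exists_snoc
    have hsb := (Store.ok_snoc_iff.1 hs).2
    have hsa := (Store.ok_snoc_iff.1 (Store.ok_snoc_iff.1 hs).1).2
    have hs0 := (Store.ok_snoc_iff.1 (Store.ok_snoc_iff.1 hs).1).1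
    simp only [Store.init_snoc, Store.snoc_last]
    have hcopy₁ : ∀ a b a' b', ((((((s.snoc a).snoc b).snoc a').snoc b').1, Function.update
        ((((s.snoc a).snoc b).snoc a').snoc b').2 (Fin.last k).castSucc.castSucc.castSucc
        (((((s.snoc a).snoc b).snoc a').snoc b').2 (Fin.last (k + 2)).castSucc)) :
          Store (k + 1 + 1 + 1 + 1)) = (((s.snoc a').snoc b).snoc a').snoc b' := by
      intro a b a' b'
      rw [Store.update_snoc, Store.update_snoc, Store.update_snoc, Store.update_snoc_last,
        Store.snoc_castSucc]
      erw [Store.snoc_last]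
    have hcopy₂ : ∀ a b a' b', ((((((s.snoc a).snoc b).snoc a').snoc b').1, Function.update
        ((((s.snoc a).snoc b).snoc a').snoc b').2 (Fin.last (k + 1)).castSucc.castSucc
        (((((s.snoc a).snoc b).snoc a').snoc b').2 (Fin.last (k + 3)))) :
          Store (k + 1 + 1 + 1 + 1)) = (((s.snoc a).snoc b').snoc a').snoc b' := by
      intro a b a' b'
      rw [Store.update_snoc, Store.update_snoc]
      erw [Store.update_snoc_last, Store.snoc_last]
    constructor
    · rintro ⟨a', ha', a₂, ha₂, b', hb', b₂, hb₂, _, -, ⟨h0, rfl, hE'⟩, r, -, hr, h⟩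
      rw [hcopy₁] at hr
      subst hr
      rw [hcopy₂] at h
      obtain ⟨h, rfl⟩ := Store.snoc_inj.1 h
      obtain ⟨rfl, rfl⟩ := Store.snoc_inj.1 h
      refine ⟨h0, _, ha', _, hb', ?_, rfl⟩
      simpa [Store.snoc] using hE'
    · rintro ⟨h0, a', ha', b', hb', hE', rfl⟩
      refine ⟨a', ha', a', ha', b', hb', b', hb', _, ?_, ⟨h0, rfl, ?_⟩, _, ?_, (hcopy₁ _ _ _ _).symm,
        (hcopy₂ _ _ _ _).symm⟩
      · exact Store.ok_snoc (Store.ok_snoc hs ha') hb'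
      · simpa [Store.snoc] using hE'
      · exact Store.ok_snoc (Store.ok_snoc (Store.ok_snoc (Store.ok_snoc hs0 ha') hsb) ha') hb'
  have htest : ∀ {f g : (Fin k → ℕ) → ℕ}, Var f → Var g → Def fun _ (v : Fin (k + 1 + 1) → ℕ) =>
      Fin.init v (Fin.last k) = f (Fin.init (Fin.init v)) ∧
        v (Fin.last (k + 1)) = g (Fin.init (Fin.init v)) := fun hf hg =>
    (Def.eq hf.init.init Var.last.init).and (Def.eq hg.init.init Var.last)
  -- The current vertex lives in two local registers, which are guessed, compared with the source,
  -- moved along edges, and finally compared with the goal.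
  refine ((Impl.comp (htest hf hg) (hbody.star.comp (htest hf' hg'))).local.local).congr ?_
  intro x s s' hs hs'
  constructor
  · rintro ⟨a, ha, a₂, ha₂, b, hb, b₂, hb₂, _, -, ⟨h0, rfl, h1, h2⟩, r, -, hr, -, rfl, h3, h4⟩
    simp only [Store.finInit_snoc, Store.snoc_last] at h1 h2 h3 h4
    have h0 : s.1 = 0 := h0
    have key : ∀ t, ReflTransGen (fun s s' : Store (k + 1 + 1) => s'.Ok x ∧
        (s.1 = 0 ∧ ∃ a < bound x, ∃ b < bound x,
        E x s.init.init.2 (s.init.2 (Fin.last k)) (s.2 (Fin.last (k + 1))) a b ∧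
        s' = (s.init.init.snoc a).snoc b)) ((s.snoc a).snoc b) t →
        ∃ a' b', t = (s.snoc a').snoc b' ∧ ReflTransGen (fun a b : ℕ × ℕ =>
          (b.1 < bound x ∧ b.2 < bound x) ∧ E x s.2 a.1 a.2 b.1 b.2) (a, b) (a', b') := by
      intro t ht
      induction ht with
      | refl => exact ⟨a, b, rfl, .refl⟩
      | tail _ h ih =>
        obtain ⟨a', b', rfl, ih⟩ := ih
        obtain ⟨-, -, a'', ha'', b'', hb'', hE', rfl⟩ := h
        simp only [Store.init_snoc, Store.snoc_last] at hE' ⊢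
        exact ⟨a'', b'', rfl, ih.tail ⟨⟨ha'', hb''⟩, hE'⟩⟩
    obtain ⟨a', b', h, hr⟩ := key _ hr
    obtain ⟨h', rfl⟩ := Store.snoc_inj.1 h
    obtain ⟨rfl, rfl⟩ := Store.snoc_inj.1 h'
    refine ⟨h0, rfl, ?_⟩
    beta_reduce
    rwa [← h1, ← h2, ← h3, ← h4]
  · rintro ⟨h0, rfl, hr⟩
    have key : ∀ c, ReflTransGen (fun a b : ℕ × ℕ =>
          (b.1 < bound x ∧ b.2 < bound x) ∧ E x s'.2 a.1 a.2 b.1 b.2) (f s'.2, g s'.2) c →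
        ReflTransGen (fun s s' : Store (k + 1 + 1) => s'.Ok x ∧
        (s.1 = 0 ∧ ∃ a < bound x, ∃ b < bound x,
        E x s.init.init.2 (s.init.2 (Fin.last k)) (s.2 (Fin.last (k + 1))) a b ∧
        s' = (s.init.init.snoc a).snoc b)) ((s'.snoc (f s'.2)).snoc (g s'.2))
          ((s'.snoc c.1).snoc c.2) := by
      intro c hc
      induction hc with
      | refl => exact .refl
      | tail _ h ih =>
        refine ih.tail ⟨Store.ok_snoc (Store.ok_snoc hs h.1.1) h.1.2, h0, _, h.1.1, _, h.1.2, ?_, ?_⟩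
        · simpa only [Store.init_snoc, Store.snoc_last] using h.2
        · simp only [Store.init_snoc]
    have hok : ∀ {f g : (Fin k → ℕ) → ℕ}, Var f → Var g →
        Store.Ok x ((s'.snoc (f s'.2)).snoc (g s'.2)) := fun hf hg =>
      Store.ok_snoc (Store.ok_snoc hs (hf.lt hs.2)) (hg.lt hs.2)
    refine ⟨_, hf.lt hs.2, _, hf'.lt hs.2, _, hg.lt hs.2, _, hg'.lt hs.2, _, hok hf hg,
      ⟨h0, rfl, ?_⟩, _, hok hf' hg', key _ hr, h0, rfl, ?_⟩
    · simp only [Store.finInit_snoc, Store.snoc_last, and_self]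
    · simp only [Store.finInit_snoc, Store.snoc_last, and_self]

end Cayley

namespace Cayley

open Language Relation

variable {k : ℕ}

/-! ### Arithmetic -/

variable {R R' : List Bool → (Fin k → ℕ) → Prop} {f g h : (Fin k → ℕ) → ℕ}

/-- Bounded universal quantification preserves definability. -/
theorem Def.forall_lt (hg : Var g) {P : List Bool → (Fin k → ℕ) → ℕ → Prop}
    (hP : Def fun x (v : Fin (k + 1) → ℕ) => P x (Fin.init v) (v (Fin.last k))) :
    Def fun x v => ∀ a < g v, P x v a := by
  have heq : Def fun _ (v : Fin (k + 1) → ℕ) => v (Fin.last k) = g (Fin.init v) :=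
    Def.eq hg.init Var.last
  -- A loop that tests `P` at the counter and then increments; it can be left successfully only when
  -- the counter equals `g v`, after all smaller values have passed.
  refine Impl.congr (((Impl.reset (Fin.last k)).comp <|
    (hP.comp (Impl.incr (Fin.last k))).star.comp heq).local) fun x s s' hs hs' => ?_
  constructor
  · rintro ⟨a, ha, b, hb, r, -, hr, t, ht, hloop, h0, rfl, h1⟩
    rw [Store.update_snoc_last] at hr
    subst hr
    have key : ∀ t : Store (k + 1), ReflTransGen (fun s s' : Store (k + 1) => s'.Ok x ∧
        ∃ r : Store (k + 1), r.Ok x ∧ (s.1 = 0 ∧ r = s ∧ P x (Fin.init s.2) (s.2 (Fin.last k))) ∧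
          s' = (r.1, Function.update r.2 (Fin.last k) (r.2 (Fin.last k) + 1))) (s.snoc 0) t →
        ∃ n, t = s.snoc n ∧ ∀ a < n, P x s.2 a := by
      intro t ht
      induction ht with
      | refl => exact ⟨0, rfl, by simp⟩
      | tail _ h ih =>
        obtain ⟨n, rfl, ih⟩ := ih
        obtain ⟨-, _, -, ⟨-, rfl, h1⟩, rfl⟩ := h
        rw [Store.update_snoc_last, Store.snoc_last]
        rw [Store.finInit_snoc, Store.snoc_last] at h1
        exact ⟨n + 1, rfl, Nat.forall_lt_succ_right.2 ⟨ih, h1⟩⟩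
    obtain ⟨n, h, hn⟩ := key _ hloop
    obtain ⟨rfl, rfl⟩ := Store.snoc_inj.1 h
    rw [Store.snoc_last, Store.finInit_snoc] at h1
    refine ⟨h0, rfl, ?_⟩
    beta_reduce
    rwa [← h1]
  · rintro ⟨h0, rfl, hall⟩
    -- The counter also takes the value `g` itself, which fits because `g` is the content of a
    -- register.
    have hlt : ∀ n ≤ g s'.2, n < bound x := fun n hn => lt_of_le_of_lt hn (hg.lt hs.2)
    have key : ∀ n ≤ g s'.2, ReflTransGen (fun s s' : Store (k + 1) => s'.Ok x ∧
        ∃ r : Store (k + 1), r.Ok x ∧ (s.1 = 0 ∧ r = s ∧ P x (Fin.init s.2) (s.2 (Fin.last k))) ∧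
          s' = (r.1, Function.update r.2 (Fin.last k) (r.2 (Fin.last k) + 1)))
          (s'.snoc 0) (s'.snoc n) := by
      intro n hn
      induction n with
      | zero => exact .refl
      | succ n ih =>
        refine (ih (by omega)).tail ⟨Store.ok_snoc hs (hlt _ hn), _,
          Store.ok_snoc hs (hlt _ (by omega)), ⟨h0, rfl, ?_⟩, ?_⟩
        · rw [Store.finInit_snoc, Store.snoc_last]
          exact hall n hn
        · rw [Store.update_snoc_last, Store.snoc_last]
    have h1 := hlt _ le_rfl
    refine ⟨0, hlt 0 (by omega), _, h1, _, Store.ok_snoc hs (hlt 0 (by omega)),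
      (Store.update_snoc_last _ _ _).symm, _, Store.ok_snoc hs h1, key _ le_rfl, h0, rfl, ?_⟩
    beta_reduce
    rw [Store.snoc_last, Store.finInit_snoc]

/-- Repeated addition is reachability along `(i, s) → (i + 1, s + g)`. The partial sums do not
exceed the product, so they stay in range. -/
theorem Def.mul (hf : Var f) (hg : Var g) (hh : Var h) : Def fun _ v => h v = f v * g v := by
  have H : Def fun x v => ∃ z < bound x, z = 0 ∧ ReflTransGen (fun a b : ℕ × ℕ =>
      (b.1 < bound x ∧ b.2 < bound x) ∧ (b.1 = a.1 + 1 ∧ b.2 = a.2 + g v)) (z, z) (f v, h v) :=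
    .ex <| .and (.zero .last) <| Def.reach (E := fun _ v a b a' b' => a' = a + 1 ∧
      b' = b + g (Fin.init v)) .last .last hf.init hh.init <|
      .and (.succ Var.last.init.init.init Var.last.init)
        (.add Var.last.init.init hg.init.init.init.init.init .last)
  refine H.congr fun x v hv => ⟨?_, fun hm => ?_⟩
  · rintro ⟨_, -, rfl, H⟩
    have : ∀ c : ℕ × ℕ, ReflTransGen (fun a b : ℕ × ℕ => (b.1 < bound x ∧ b.2 < bound x) ∧
        (b.1 = a.1 + 1 ∧ b.2 = a.2 + g v)) (0, 0) c → c.2 = c.1 * g v := by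
      intro c hc
      induction hc with
      | refl => simp
      | tail _ h ih => rw [h.2.1, h.2.2, ih]; ring
    exact this _ H
  · refine ⟨0, Nat.two_pow_pos _, rfl, ?_⟩
    have h1 := hf.lt hv
    have h2 := hh.lt hv
    have : ∀ n ≤ f v, ReflTransGen (fun a b : ℕ × ℕ => (b.1 < bound x ∧ b.2 < bound x) ∧
        (b.1 = a.1 + 1 ∧ b.2 = a.2 + g v)) (0, 0) (n, n * g v) := by
      intro n hn
      induction n with
      | zero => simpa using .refl
      | succ n ih =>
        refine (ih (by omega)).tail ⟨⟨by simp only; omega, lt_of_le_of_lt ?_ h2⟩, rfl, by ring⟩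
        rw [hm]
        exact Nat.mul_le_mul_right _ hn
    rw [hm]
    exact this _ le_rfl

/-- Repeated halving is reachability along `(a, j) → (a / 2, j + 1)`, where `a' = a / 2` is
expressed by `a = 2 a'` or `a = 2 a' + 1`. -/
theorem Def.div_two_pow (hf : Var f) (hg : Var g) (hh : Var h) :
    Def fun _ v => h v = f v / 2 ^ g v := by
  have H : Def fun x v => ∃ z < bound x, z = 0 ∧ ReflTransGen (fun a b : ℕ × ℕ =>
      (b.1 < bound x ∧ b.2 < bound x) ∧ (b.2 = a.2 + 1 ∧ (a.1 = b.1 + b.1 ∨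
        ∃ t < bound x, t = b.1 + b.1 ∧ a.1 = t + 1))) (f v, z) (h v, g v) :=
    .ex <| .and (.zero .last) <| Def.reach (E := fun x _ a b a' b' => b' = b + 1 ∧
      (a = a' + a' ∨ ∃ t < bound x, t = a' + a' ∧ a = t + 1)) hf.init .last hh.init hg.init <|
      .and (.succ Var.last.init.init .last) <|
        .or (.add Var.last.init Var.last.init Var.last.init.init.init) <|
        .ex <| .and (.add Var.last.init.init Var.last.init.init .last)
          (.succ .last Var.last.init.init.init.init)
  refine H.congr fun x v hv => ⟨?_, fun hm => ?_⟩
  · rintro ⟨_, -, rfl, H⟩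
    have : ∀ c : ℕ × ℕ, ReflTransGen (fun a b : ℕ × ℕ =>
      (b.1 < bound x ∧ b.2 < bound x) ∧ (b.2 = a.2 + 1 ∧ (a.1 = b.1 + b.1 ∨
        ∃ t < bound x, t = b.1 + b.1 ∧ a.1 = t + 1))) (f v, 0) c → c.1 = f v / 2 ^ c.2 := by
      intro c hc
      induction hc with
      | refl => simp
      | tail _ h ih =>
        obtain ⟨-, h1, h2⟩ := h
        rw [h1, pow_succ, ← Nat.div_div_eq_div_mul, ← ih]
        rcases h2 with h2 | ⟨t, -, rfl, h2⟩ <;> omega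
    exact this _ H
  · refine ⟨0, Nat.two_pow_pos _, rfl, ?_⟩
    have h1 := hf.lt hv
    have h2 := hg.lt hv
    have h3 : ∀ n, f v / 2 ^ n < bound x := fun n => lt_of_le_of_lt (Nat.div_le_self _ _) h1
    have : ∀ n ≤ g v, ReflTransGen (fun a b : ℕ × ℕ =>
      (b.1 < bound x ∧ b.2 < bound x) ∧ (b.2 = a.2 + 1 ∧ (a.1 = b.1 + b.1 ∨
        ∃ t < bound x, t = b.1 + b.1 ∧ a.1 = t + 1))) (f v, 0) (f v / 2 ^ n, n) := by
      intro n hn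
      induction n with
      | zero => simpa using .refl
      | succ n ih =>
        refine (ih (by omega)).tail ⟨⟨h3 _, by simp only; omega⟩, rfl, ?_⟩
        have h4 := h3 n
        simp only [pow_succ, ← Nat.div_div_eq_div_mul]
        rcases Nat.mod_two_eq_zero_or_one (f v / 2 ^ n) with h | h
        · left
          omega
        · right
          exact ⟨_, by omega, rfl, by omega⟩
    rw [hm]
    exact this _ le_rfl

/-- The digit is the parity of `d = f v / 2 ^ g v`, and the parity is found by guessing the half `e`
of `d`. -/
theorem Def.testBit (hf : Var f) (hg : Var g) (hh : Var h) :
    Def fun x v => x[h v]? = some ((f v).testBit (g v)) := by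
  have H : Def fun x v => ∃ d < bound x, d = f v / 2 ^ g v ∧ ∃ e < bound x, ∃ t < bound x,
      t = e + e ∧ (d = t ∧ x[h v]? = some false ∨ d = t + 1 ∧ x[h v]? = some true) :=
    .ex <| .and (.div_two_pow hf.init hg.init .last) <| .ex <| .ex <|
      .and (.add Var.last.init Var.last.init .last) <|
      .or (.and (.eq .last Var.last.init.init) (.bit hh.init.init.init _))
        (.and (.succ .last Var.last.init.init) (.bit hh.init.init.init _))
  refine H.congr fun x v hv => ?_
  rw [Nat.testBit_eq_decide_div_mod_eq]
  constructor
  · rintro ⟨d, hd, rfl, e, he, t, ht, rfl, ⟨h1, h2⟩ | ⟨h1, h2⟩⟩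
    · rw [h2, decide_eq_false (by omega)]
    · rw [h2, decide_eq_true (by omega)]
  · intro H
    have h1 : f v / 2 ^ g v < bound x := lt_of_le_of_lt (Nat.div_le_self _ _) (hf.lt hv)
    refine ⟨_, h1, rfl, f v / 2 ^ g v / 2, by omega, f v / 2 ^ g v / 2 + f v / 2 ^ g v / 2, by omega,
      rfl, ?_⟩
    rcases Nat.mod_two_eq_zero_or_one (f v / 2 ^ g v) with h | h
    · left
      exact ⟨by omega, by rw [H, decide_eq_false (by omega)]⟩
    · right
      exact ⟨by omega, by rw [H, decide_eq_true (by omega)]⟩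

theorem Def.pos (hf : Var f) : Def fun _ v => 0 < f v := by
  have H : Def fun x v => ∃ z < bound x, z = 0 ∧ z < f v := .ex <| .and (.zero .last)
    (.lt .last hf.init)
  refine H.congr fun x v _ => ⟨?_, fun h => ⟨0, Nat.two_pow_pos _, rfl, h⟩⟩
  rintro ⟨_, -, rfl, h⟩
  exact h

theorem div_two_pow_eq_one_iff {n j : ℕ} : n / 2 ^ j = 1 ↔ 0 < n ∧ Nat.size n = j + 1 := by
  constructor
  · intro h
    rw [Nat.div_eq_iff (Nat.two_pow_pos j)] at h
    have := Nat.two_pow_pos j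
    refine ⟨by omega, le_antisymm (Nat.size_le.2 ?_) (Nat.lt_size.2 (by omega))⟩
    rw [pow_succ]
    omega
  · rintro ⟨-, h⟩
    have h1 := Nat.size_le.1 h.le
    have h2 := Nat.lt_size.1 (show j < Nat.size n by omega)
    have := Nat.two_pow_pos j
    rw [pow_succ] at h1
    rw [Nat.div_eq_iff this]
    omega

theorem size_le_self (n : ℕ) : Nat.size n ≤ n := Nat.size_le.2 Nat.lt_two_pow_self

/-- For a positive number the most significant digit has index `j = size - 1`, and this is the only
`j` for which division by `2 ^ j` gives `1`. -/
theorem Def.size (hf : Var f) (hg : Var g) : Def fun _ v => 0 < f v ∧ g v = Nat.size (f v) := by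
  have H : Def fun x v => ∃ j < bound x, g v = j + 1 ∧ ∃ z < bound x, z = 0 ∧ ∃ d < bound x,
      d = f v / 2 ^ j ∧ d = z + 1 :=
    .ex <| .and (.succ .last hg.init) <| .ex <| .and (.zero .last) <| .ex <|
      .and (.div_two_pow hf.init.init.init Var.last.init.init .last) (.succ Var.last.init .last)
  refine H.congr fun x v hv => ⟨?_, fun h => ?_⟩
  · rintro ⟨j, hj, h1, _, -, rfl, d, hd, h2, h3⟩
    rw [h3, zero_add, eq_comm, div_two_pow_eq_one_iff] at h2
    exact ⟨h2.1, h1.trans h2.2.symm⟩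
  · have h1 := hg.lt hv
    have h2 : 0 < Nat.size (f v) := Nat.size_pos.2 h.1
    have h3 := hf.lt hv
    have h4 := (div_two_pow_eq_one_iff (n := f v) (j := g v - 1)).2 ⟨h.1, by omega⟩
    exact ⟨g v - 1, by omega, by omega, 0, by omega, rfl, 1, by omega, h4.symm, rfl⟩

end Cayley

namespace Cayley

open Language Relation

variable {k : ℕ}

/-! ### Definability of the membership problem -/

/-- The bits of `x` from position `o` on are the `l` lowest binary digits of `c`. -/
def Word (x : List Bool) (o l c : ℕ) : Prop := ∀ j < l, x[o + j]? = some (c.testBit j)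

/-- The string `x`, read as the encoding of an instance of order `n`, says that the product of `a`
and `b` is `c`. -/
def Entry (x : List Bool) (n l a b c : ℕ) : Prop :=
  0 < l ∧ c < n ∧ Word x ((a * n + b) * l + n + 1) l c

/-- The bits of `x` from position `o` on form the characteristic vector of a set that contains
`a`. -/
def Marked (x : List Bool) (o a : ℕ) : Prop := x[o + a]? = some true

theorem lt_bound_of_getElem? {x : List Bool} {n : ℕ} {b : Bool} (h : x[n]? = some b) :
    n < bound x :=
  (List.getElem?_eq_some_iff.1 h).1.trans (length_lt_bound x)

variable {o l n a b c y t : (Fin k → ℕ) → ℕ}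

theorem Def.word (ho : Var o) (hl : Var l) (hc : Var c) :
    Def fun x v => Word x (o v) (l v) (c v) := by
  have H : Def fun x v => ∀ j < l v, ∃ q < bound x, q = o v + j ∧
      x[q]? = some ((c v).testBit j) :=
    .forall_lt hl <| .ex <| .and (.add ho.init.init Var.last.init .last)
      (.testBit hc.init.init Var.last.init .last)
  refine H.congr fun x v _ => forall₂_congr fun j _ => ⟨?_, fun h => ?_⟩
  · rintro ⟨q, -, rfl, h⟩
    exact h
  · exact ⟨_, lt_bound_of_getElem? h, rfl, h⟩

theorem Def.entry (hn : Var n) (hl : Var l) (ha : Var a) (hb : Var b) (hc : Var c) :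
    Def fun x v => Entry x (n v) (l v) (a v) (b v) (c v) := by
  have H : Def fun x v => 0 < l v ∧ c v < n v ∧
      ∃ p < bound x, p = a v * n v ∧ ∃ r < bound x, r = p + b v ∧
      ∃ q < bound x, q = r * l v ∧ ∃ q' < bound x, q' = q + n v ∧
      ∃ o < bound x, o = q' + 1 ∧ Word x o (l v) (c v) :=
    .and (.pos hl) <| .and (.lt hc hn) <|
    .ex <| .and (.mul ha.init hn.init .last) <|
    .ex <| .and (.add Var.last.init hb.init.init .last) <|
    .ex <| .and (.mul Var.last.init hl.init.init.init .last) <|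
    .ex <| .and (.add Var.last.init hn.init.init.init.init .last) <|
    .ex <| .and (.succ Var.last.init .last) <|
    .word .last hl.init.init.init.init.init hc.init.init.init.init.init
  refine H.congr fun x v _ => and_congr_right fun h0 => and_congr_right fun _ => ⟨?_, fun h => ?_⟩
  · rintro ⟨_, -, rfl, _, -, rfl, _, -, rfl, _, -, rfl, _, -, rfl, h⟩
    exact h
  -- The first bit of the entry lies inside `x`, so its position is below the bound; all
  -- intermediate values are at most that position. This uses `0 < l`.
  · have h1 := lt_bound_of_getElem? (h 0 h0)
    have h2 := Nat.le_mul_of_pos_right (a v * n v + b v) h0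
    exact ⟨_, by omega, rfl, _, by omega, rfl, _, by omega, rfl, _, by omega, rfl, _, by omega,
      rfl, h⟩

theorem Def.marked (hy : Var y) (ha : Var a) : Def fun x v => Marked x (y v) (a v) := by
  have H : Def fun x v => ∃ q < bound x, q = y v + a v ∧ x[q]? = some true :=
    .ex <| .and (.add hy.init ha.init .last) (.bit .last _)
  refine H.congr fun x v _ => ⟨?_, fun h => ⟨_, lt_bound_of_getElem? h, rfl, h⟩⟩
  rintro ⟨_, -, rfl, h⟩
  exact h

/-- The multiplication is defined everywhere. -/
def Total (x : List Bool) (n l : ℕ) : Prop :=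
  ∀ a < n, ∀ b < n, ∃ c < bound x, Entry x n l a b c

theorem Def.total (hn : Var n) (hl : Var l) : Def fun x v => Total x (n v) (l v) :=
  .forall_lt hn <| .forall_lt hn.init <| .ex <|
    .entry hn.init.init.init hl.init.init.init Var.last.init.init Var.last.init .last

/-- The multiplication is associative. -/
def Associative (x : List Bool) (n l : ℕ) : Prop :=
  ∀ a < n, ∀ b < n, ∀ c < n, ∃ d < bound x, Entry x n l a b d ∧ ∃ e < bound x, Entry x n l b c e ∧
    ∃ f < bound x, Entry x n l d c f ∧ Entry x n l a e f

theorem Def.associative (hn : Var n) (hl : Var l) : Def fun x v => Associative x (n v) (l v) :=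
  .forall_lt hn <| .forall_lt hn.init <| .forall_lt hn.init.init <|
    .ex <| .and (.entry hn.init.init.init.init hl.init.init.init.init Var.last.init.init.init
      Var.last.init.init .last) <|
    .ex <| .and (.entry hn.init.init.init.init.init hl.init.init.init.init.init
      Var.last.init.init.init Var.last.init.init .last) <|
    .ex <| .and (.entry hn.init.init.init.init.init.init hl.init.init.init.init.init.init
      Var.last.init.init Var.last.init.init.init .last)
      (.entry hn.init.init.init.init.init.init hl.init.init.init.init.init.init
        Var.last.init.init.init.init.init Var.last.init .last)

/-- There is a zero element, and it is the only idempotent. -/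
def Nilpotent (x : List Bool) (n l : ℕ) : Prop :=
  ∃ z < bound x, z < n ∧ (∀ a < n, Entry x n l z a z ∧ Entry x n l a z z) ∧
    ∀ e < n, ∃ f < bound x, Entry x n l e e f ∧ (f ≠ e ∨ e = z)

/-- The clause `f ≠ e ∨ e = z` is the implication "idempotent, hence zero" written without negating
a definable property. -/
theorem Def.nilpotent (hn : Var n) (hl : Var l) : Def fun x v => Nilpotent x (n v) (l v) :=
  .ex <| .and (.lt .last hn.init) <| .and
    (.forall_lt hn.init <| .and
      (.entry hn.init.init hl.init.init Var.last.init .last Var.last.init)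
      (.entry hn.init.init hl.init.init .last Var.last.init Var.last.init))
    (.forall_lt hn.init <| .ex <| .and
      (.entry hn.init.init.init hl.init.init.init Var.last.init Var.last.init .last)
      (.or (.ne .last Var.last.init) (.eq Var.last.init.init Var.last.init)))

/-- The element `t` is a product of marked elements. -/
def Generated (x : List Bool) (n l y t : ℕ) : Prop :=
  ∃ s < bound x, s < n ∧ Marked x y s ∧ ReflTransGen (fun a b : ℕ × ℕ =>
    (b.1 < bound x ∧ b.2 < bound x) ∧ (∃ u < bound x, u < n ∧ Marked x y u ∧
      Entry x n l a.1 u b.1) ∧ b.2 = a.2) (s, s) (t, s)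

/-- The walk multiplies by generators from the right. Its second coordinate is a dummy that keeps
the value `s`, because `Def.reach` deals with pairs. -/
theorem Def.generated (hn : Var n) (hl : Var l) (hy : Var y) (ht : Var t) :
    Def fun x v => Generated x (n v) (l v) (y v) (t v) :=
  .ex <| .and (.lt .last hn.init) <| .and (.marked hy.init .last) <|
    Def.reach (E := fun x v a b a' b' => (∃ u < bound x, u < n (Fin.init v) ∧
      Marked x (y (Fin.init v)) u ∧ Entry x (n (Fin.init v)) (l (Fin.init v)) a u a') ∧ b' = b)
      .last .last ht.init .last <|
    .and (.ex <| .and (.lt .last hn.init.init.init.init.init.init) <|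
      .and (.marked hy.init.init.init.init.init.init .last)
      (.entry hn.init.init.init.init.init.init hl.init.init.init.init.init.init
        Var.last.init.init.init.init .last Var.last.init.init))
      (.eq Var.last.init.init .last)

/-- The string `x` is the encoding of a yes-instance. -/
def EncodesYes (x : List Bool) : Prop :=
  ∃ n < bound x, ∃ l < bound x, (0 < n ∧ l = Nat.size n) ∧
    (∀ i < n, x[i]? = some true) ∧ x[n]? = some false ∧
    ∃ m < bound x, m = n * n ∧ ∃ q < bound x, q = m * l ∧ ∃ q' < bound x, q' = q + n ∧
    ∃ y < bound x, y = q' + 1 ∧ ∃ o < bound x, o = y + n ∧ ∃ e < bound x, e = o + l ∧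
    x[e]? = none ∧ (∃ e' < bound x, e = e' + 1 ∧ (x[e']? = some true ∨ x[e']? = some false)) ∧
    Total x n l ∧ Associative x n l ∧ Nilpotent x n l ∧
    ∃ t < bound x, t < n ∧ Word x o l t ∧ Generated x n l y t

theorem def_encodesYes : Def fun x (_ : Fin 0 → ℕ) => EncodesYes x :=
  .ex <| .ex <| .and (.size Var.last.init .last) <|
    .and (.forall_lt Var.last.init (.bit .last _)) <| .and (.bit Var.last.init _) <|
    .ex <| .and (.mul Var.last.init.init Var.last.init.init .last) <|
    .ex <| .and (.mul Var.last.init Var.last.init.init .last) <|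
    .ex <| .and (.add Var.last.init Var.last.init.init.init.init .last) <|
    .ex <| .and (.succ Var.last.init .last) <|
    .ex <| .and (.add Var.last.init Var.last.init.init.init.init.init.init .last) <|
    .ex <| .and (.add Var.last.init Var.last.init.init.init.init.init.init .last) <|
    .and (.bit .last _) <|
    .and (.ex <| .and (.succ .last Var.last.init) (.or (.bit .last _) (.bit .last _))) <|
    .and (.total Var.last.init.init.init.init.init.init.init Var.last.init.init.init.init.init.init) <|
    .and (.associative Var.last.init.init.init.init.init.init.init
      Var.last.init.init.init.init.init.init) <|
    .and (.nilpotent Var.last.init.init.init.init.init.init.init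
      Var.last.init.init.init.init.init.init) <|
    .ex <| .and (.lt .last Var.last.init.init.init.init.init.init.init.init) <|
    .and (.word Var.last.init.init Var.last.init.init.init.init.init.init.init .last)
      (.generated Var.last.init.init.init.init.init.init.init.init
        Var.last.init.init.init.init.init.init.init Var.last.init.init.init .last)

theorem encodesYes_mem_NL : {x | EncodesYes x} ∈ NL := mem_NL_of_impl def_encodesYes

end Cayley

namespace Cayley

open Relation

/-! ### The encoding of instances -/

theorem length_flatMap_finRange {α : Type*} {n L : ℕ} {f : Fin n → List α}
    (hf : ∀ a, (f a).length = L) : ((List.finRange n).flatMap f).length = n * L := by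
  simp [List.length_flatMap, hf]

theorem getElem?_flatMap_finRange {α : Type*} {n L : ℕ} {f : Fin n → List α}
    (hf : ∀ a, (f a).length = L) (a : Fin n) {j : ℕ} (hj : j < L) :
    ((List.finRange n).flatMap f)[a * L + j]? = (f a)[j]? := by
  induction n with
  | zero => exact a.elim0
  | succ n ih =>
    rw [List.finRange_succ, List.flatMap_cons, List.flatMap_map]
    refine Fin.cases ?_ (fun a => ?_) a
    · rw [Fin.val_zero, zero_mul, zero_add, List.getElem?_append_left (by rw [hf]; exact hj)]
    · rw [Fin.val_succ, List.getElem?_append_right (by rw [hf]; nlinarith), hf,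
        show ((a : ℕ) + 1) * L + j - L = a * L + j by rw [add_mul, one_mul]; omega]
      exact ih (fun a => hf a.succ) a

namespace CSMInstance

variable (I : CSMInstance)

theorem length_encodeElem (n : ℕ) (a : Fin n) : (encodeElem n a).length = Nat.size n := by
  simp [encodeElem]

theorem length_encode : I.encode.length =
    I.n * I.n * Nat.size I.n + I.n + 1 + I.n + Nat.size I.n := by
  simp only [encode, List.length_append, List.length_replicate, List.length_singleton,
    List.length_ofFn, length_encodeElem,
    length_flatMap_finRange fun a => length_flatMap_finRange fun b => length_encodeElem I.n (I.table a b)]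
  ring

theorem encode_unary {i : ℕ} (hi : i < I.n) : I.encode[i]? = some true := by
  simp only [encode, List.append_assoc]
  rw [List.getElem?_append_left (by simpa using hi), List.getElem?_replicate, if_pos hi]

theorem encode_separator : I.encode[I.n]? = some false := by
  simp only [encode, List.append_assoc]
  rw [List.getElem?_append_right (by simp)]
  simp

theorem encodeElem_getElem? {n : ℕ} (a : Fin n) {j : ℕ} (hj : j < Nat.size n) :
    (encodeElem n a)[j]? = some ((a : ℕ).testBit j) := by
  simp [encodeElem, hj]

/-- The part of the encoding that consists of the multiplication table. -/
theorem encode_table (a b : Fin I.n) :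
    Word I.encode ((a * I.n + b) * Nat.size I.n + I.n + 1) (Nat.size I.n) (I.table a b) := by
  intro j hj
  have h1 : ∀ a, ((List.finRange I.n).flatMap fun b => encodeElem I.n (I.table a b)).length =
      I.n * Nat.size I.n := fun a =>
    length_flatMap_finRange fun b => length_encodeElem I.n (I.table a b)
  have h2 : b * Nat.size I.n + j < I.n * Nat.size I.n := by
    have := Nat.mul_le_mul_right (Nat.size I.n) b.2
    rw [Nat.succ_mul] at this
    omega
  have h3 : a * (I.n * Nat.size I.n) + (b * Nat.size I.n + j) <
      I.n * (I.n * Nat.size I.n) := by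
    have := Nat.mul_le_mul_right (I.n * Nat.size I.n) a.2
    rw [Nat.succ_mul] at this
    omega
  have h4 : (a * I.n + b) * Nat.size I.n + I.n + 1 + j =
      I.n + (1 + (a * (I.n * Nat.size I.n) + (b * Nat.size I.n + j))) := by ring
  simp only [encode, List.append_assoc]
  rw [h4, List.getElem?_append_right (by simp), List.length_replicate, Nat.add_sub_cancel_left,
    List.getElem?_append_right (by simp), List.length_singleton, Nat.add_sub_cancel_left,
    List.getElem?_append_left (by rw [length_flatMap_finRange h1]; exact h3),
    getElem?_flatMap_finRange h1 a h2,
    getElem?_flatMap_finRange (fun b => length_encodeElem I.n (I.table a b)) b hj,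
    encodeElem_getElem? _ hj]

theorem encode_set (a : Fin I.n) :
    I.encode[I.n * I.n * Nat.size I.n + I.n + 1 + a]? = some (decide (a ∈ I.X)) := by
  have h1 : ∀ a, ((List.finRange I.n).flatMap fun b => encodeElem I.n (I.table a b)).length =
      I.n * Nat.size I.n := fun a =>
    length_flatMap_finRange fun b => length_encodeElem I.n (I.table a b)
  have h4 : I.n * I.n * Nat.size I.n + I.n + 1 + a =
      I.n + (1 + (I.n * (I.n * Nat.size I.n) + a)) := by ring
  simp only [encode, List.append_assoc]
  rw [h4, List.getElem?_append_right (by simp), List.length_replicate, Nat.add_sub_cancel_left,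
    List.getElem?_append_right (by simp), List.length_singleton, Nat.add_sub_cancel_left,
    List.getElem?_append_right (by rw [length_flatMap_finRange h1]; exact Nat.le_add_right _ _),
    length_flatMap_finRange h1, Nat.add_sub_cancel_left,
    List.getElem?_append_left (by simp)]
  simp

theorem encode_target :
    Word I.encode (I.n * I.n * Nat.size I.n + I.n + 1 + I.n) (Nat.size I.n) I.t := by
  intro j hj
  have h1 : ∀ a, ((List.finRange I.n).flatMap fun b => encodeElem I.n (I.table a b)).length =
      I.n * Nat.size I.n := fun a =>
    length_flatMap_finRange fun b => length_encodeElem I.n (I.table a b)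
  have h4 : I.n * I.n * Nat.size I.n + I.n + 1 + I.n + j =
      I.n + (1 + (I.n * (I.n * Nat.size I.n) + (I.n + j))) := by ring
  simp only [encode, List.append_assoc]
  rw [h4, List.getElem?_append_right (by simp), List.length_replicate, Nat.add_sub_cancel_left,
    List.getElem?_append_right (by simp), List.length_singleton, Nat.add_sub_cancel_left,
    List.getElem?_append_right (by rw [length_flatMap_finRange h1]; exact Nat.le_add_right _ _),
    length_flatMap_finRange h1, Nat.add_sub_cancel_left,
    List.getElem?_append_right (by simp), List.length_ofFn, Nat.add_sub_cancel_left,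
    encodeElem_getElem? _ hj]

theorem eq_encode {x : List Bool}
    (hlen : x.length = I.n * I.n * Nat.size I.n + I.n + 1 + I.n + Nat.size I.n)
    (hunary : ∀ i < I.n, x[i]? = some true) (hsep : x[I.n]? = some false)
    (htable : ∀ a b : Fin I.n,
      Word x ((a * I.n + b) * Nat.size I.n + I.n + 1) (Nat.size I.n) (I.table a b))
    (hset : ∀ a : Fin I.n,
      x[I.n * I.n * Nat.size I.n + I.n + 1 + a]? = some (decide (a ∈ I.X)))
    (ht : Word x (I.n * I.n * Nat.size I.n + I.n + 1 + I.n) (Nat.size I.n) I.t) :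
    x = I.encode := by
  apply List.ext_getElem?
  intro i
  rcases lt_trichotomy i I.n with h | rfl | h
  · rw [hunary i h, I.encode_unary h]
  · rw [hsep, I.encode_separator]
  have hl : 0 < Nat.size I.n := Nat.size_pos.2 I.t.pos
  by_cases h1 : i < I.n * I.n * Nat.size I.n + I.n + 1
  · obtain ⟨r, rfl⟩ : ∃ r, i = r + I.n + 1 := ⟨i - I.n - 1, by omega⟩
    have h2 : r / Nat.size I.n < I.n * I.n := by
      rw [Nat.div_lt_iff_lt_mul hl]
      omega
    -- Two divisions with remainder turn the offset `r` into row, column and bit of a table entry.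
    have h3 := htable ⟨r / Nat.size I.n / I.n, (Nat.div_lt_iff_lt_mul I.t.pos).2 h2⟩
      ⟨r / Nat.size I.n % I.n, Nat.mod_lt _ I.t.pos⟩ (r % Nat.size I.n) (Nat.mod_lt _ hl)
    have h4 := I.encode_table ⟨r / Nat.size I.n / I.n, (Nat.div_lt_iff_lt_mul I.t.pos).2 h2⟩
      ⟨r / Nat.size I.n % I.n, Nat.mod_lt _ I.t.pos⟩ (r % Nat.size I.n) (Nat.mod_lt _ hl)
    have h5 : (r / Nat.size I.n / I.n * I.n + r / Nat.size I.n % I.n) * Nat.size I.n + I.n + 1 +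
        r % Nat.size I.n = r + I.n + 1 := by
      rw [Nat.div_add_mod']
      have := Nat.div_add_mod' r (Nat.size I.n)
      omega
    simp only [h5] at h3 h4
    rw [h3, h4]
  by_cases h2 : i < I.n * I.n * Nat.size I.n + I.n + 1 + I.n
  · obtain ⟨r, rfl⟩ : ∃ r, i = I.n * I.n * Nat.size I.n + I.n + 1 + r := ⟨_, (by omega :
      i = I.n * I.n * Nat.size I.n + I.n + 1 + (i - (I.n * I.n * Nat.size I.n + I.n + 1)))⟩
    have h3 : r < I.n := by omega
    exact (hset ⟨r, h3⟩).trans (I.encode_set ⟨r, h3⟩).symm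
  by_cases h3 : i < I.n * I.n * Nat.size I.n + I.n + 1 + I.n + Nat.size I.n
  · obtain ⟨r, rfl⟩ : ∃ r, i = I.n * I.n * Nat.size I.n + I.n + 1 + I.n + r := ⟨_, (by omega :
      i = I.n * I.n * Nat.size I.n + I.n + 1 + I.n +
        (i - (I.n * I.n * Nat.size I.n + I.n + 1 + I.n)))⟩
    have h4 : r < Nat.size I.n := by omega
    rw [ht r h4, I.encode_target r h4]
  · rw [List.getElem?_eq_none (by omega),
      List.getElem?_eq_none (by rw [I.length_encode]; omega)]

end CSMInstance

/-! ### Reading an instance back from its encoding -/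

theorem Word.unique {x : List Bool} {o l c d : ℕ} (hc : c < 2 ^ l) (hd : d < 2 ^ l)
    (h : Word x o l c) (h' : Word x o l d) : c = d := by
  refine Nat.eq_of_testBit_eq fun j => ?_
  by_cases hj : j < l
  · exact Option.some.inj ((h j hj).symm.trans (h' j hj))
  · have : 2 ^ l ≤ 2 ^ j := Nat.pow_le_pow_right (by norm_num) (by omega)
    rw [Nat.testBit_lt_two_pow (by omega), Nat.testBit_lt_two_pow (by omega)]

theorem Entry.unique {x : List Bool} {n a b c d : ℕ} (h : Entry x n (Nat.size n) a b c)
    (h' : Entry x n (Nat.size n) a b d) : c = d :=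
  Word.unique (h.2.1.trans (Nat.lt_size_self n)) (h'.2.1.trans (Nat.lt_size_self n)) h.2.2 h'.2.2

namespace CSMInstance

variable (I : CSMInstance)

theorem entry_encode (a b : Fin I.n) (c : ℕ) :
    Entry I.encode I.n (Nat.size I.n) a b c ↔ c = I.table a b := by
  have h : Entry I.encode I.n (Nat.size I.n) a b (I.table a b) :=
    ⟨Nat.size_pos.2 I.t.pos, (I.table a b).2, I.encode_table a b⟩
  refine ⟨fun h' => h'.unique h, ?_⟩
  rintro rfl
  exact h

theorem n_lt_bound : I.n < bound I.encode := lt_bound_of_getElem? I.encode_separator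

theorem lt_bound (a : Fin I.n) : (a : ℕ) < bound I.encode := a.2.trans I.n_lt_bound

theorem total_encode : Total I.encode I.n (Nat.size I.n) := fun a ha b hb =>
  ⟨_, I.lt_bound (I.table ⟨a, ha⟩ ⟨b, hb⟩), (I.entry_encode ⟨a, ha⟩ ⟨b, hb⟩ _).2 rfl⟩

theorem associative_encode : Associative I.encode I.n (Nat.size I.n) := by
  intro a ha b hb c hc
  refine ⟨_, I.lt_bound _, (I.entry_encode ⟨a, ha⟩ ⟨b, hb⟩ _).2 rfl, _, I.lt_bound _,
    (I.entry_encode ⟨b, hb⟩ ⟨c, hc⟩ _).2 rfl, _, I.lt_bound _,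
    (I.entry_encode _ ⟨c, hc⟩ _).2 rfl, (I.entry_encode ⟨a, ha⟩ _ _).2 ?_⟩
  rw [I.assoc]

theorem nilpotent_encode :
    Nilpotent I.encode I.n (Nat.size I.n) ↔ IsNilpotentSemigroup I.Carrier := by
  constructor
  · rintro ⟨z, -, hz, h1, h2⟩
    refine ⟨(⟨z, hz⟩ : Fin I.n), fun a => ?_, fun e he => ?_⟩
    · obtain ⟨h3, h4⟩ := h1 (a : Fin I.n).1 (a : Fin I.n).2
      exact ⟨Fin.ext ((I.entry_encode ⟨z, hz⟩ a z).1 h3).symm,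
        Fin.ext ((I.entry_encode a ⟨z, hz⟩ z).1 h4).symm⟩
    · obtain ⟨f, -, h3, h4⟩ := h2 (e : Fin I.n).1 (e : Fin I.n).2
      have h5 := (I.entry_encode e e f).1 h3
      have h6 : I.table e e = e := he
      rw [h6] at h5
      exact Fin.ext (h4.resolve_left (not_not.2 h5))
  · rintro ⟨(z : Fin I.n), h1, h2⟩
    refine ⟨z, I.lt_bound z, z.2, fun a ha => ?_, fun e he => ?_⟩
    · exact ⟨(I.entry_encode z ⟨a, ha⟩ _).2 (congrArg Fin.val (h1 (⟨a, ha⟩ : Fin I.n)).1.symm),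
        (I.entry_encode ⟨a, ha⟩ z _).2 (congrArg Fin.val (h1 (⟨a, ha⟩ : Fin I.n)).2.symm)⟩
    · refine ⟨_, I.lt_bound _, (I.entry_encode ⟨e, he⟩ ⟨e, he⟩ _).2 rfl, ?_⟩
      by_cases h : I.table ⟨e, he⟩ ⟨e, he⟩ = ⟨e, he⟩
      · exact Or.inr (congrArg Fin.val (h2 (⟨e, he⟩ : Fin I.n) h))
      · exact Or.inl fun h' => h (Fin.ext h')

theorem marked_encode (a : Fin I.n) :
    Marked I.encode (I.n * I.n * Nat.size I.n + I.n + 1) a ↔ a ∈ I.X := by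
  rw [Marked, I.encode_set]
  simp

end CSMInstance

/-- The elements of a generated subsemigroup are obtained from generators by multiplications by
generators from the right. -/
theorem mem_closure_iff_reflTransGen {S : Type*} [Semigroup S] {X : Set S} {t : S} :
    t ∈ Subsemigroup.closure X ↔
      ∃ s ∈ X, ReflTransGen (fun a b => ∃ u ∈ X, b = a * u) s t := by
  constructor
  · intro h
    induction h using Subsemigroup.closure_induction with
    | mem s hs => exact ⟨s, hs, .refl⟩
    | mul a b _ _ iha ihb =>
      obtain ⟨s, hs, ha⟩ := iha
      obtain ⟨r, hr, hb⟩ := ihb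
      -- From `s` to `a`, one step to `a * r`, and then the path from `r` to `b` multiplied by `a`
      -- from the left; associativity turns its steps into steps again.
      refine ⟨s, hs, (ha.tail ⟨r, hr, rfl⟩).trans (hb.lift (a * ·) ?_)⟩
      rintro c _ ⟨u, hu, rfl⟩
      exact ⟨u, hu, (mul_assoc _ _ _).symm⟩
  · rintro ⟨s, hs, h⟩
    induction h with
    | refl => exact Subsemigroup.subset_closure hs
    | tail _ h ih =>
      obtain ⟨u, hu, rfl⟩ := h
      exact mul_mem ih (Subsemigroup.subset_closure hu)

namespace CSMInstance

variable (I : CSMInstance)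

theorem isYes_iff : I.IsYes ↔ ∃ s ∈ I.X,
    ReflTransGen (fun a b => ∃ u ∈ I.X, b = I.table a u) s I.t :=
  mem_closure_iff_reflTransGen

theorem generated_encode : Generated I.encode I.n (Nat.size I.n)
    (I.n * I.n * Nat.size I.n + I.n + 1) I.t ↔ I.IsYes := by
  rw [isYes_iff]
  constructor
  · rintro ⟨s, -, hs, h1, h2⟩
    refine ⟨⟨s, hs⟩, (I.marked_encode ⟨s, hs⟩).1 h1, ?_⟩
    have key : ∀ c : ℕ × ℕ, ReflTransGen (fun a b : ℕ × ℕ =>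
        (b.1 < bound I.encode ∧ b.2 < bound I.encode) ∧ (∃ u < bound I.encode, u < I.n ∧
        Marked I.encode (I.n * I.n * Nat.size I.n + I.n + 1) u ∧
        Entry I.encode I.n (Nat.size I.n) a.1 u b.1) ∧ b.2 = a.2) (s, s) c →
        ∃ d : Fin I.n, c.1 = d ∧
          ReflTransGen (fun a b => ∃ u ∈ I.X, b = I.table a u) ⟨s, hs⟩ d := by
      intro c hc
      induction hc with
      | refl => exact ⟨⟨s, hs⟩, rfl, .refl⟩
      | tail _ h ih =>
        obtain ⟨d, hd, ih⟩ := ih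
        obtain ⟨-, ⟨u, -, hu, h3, h4⟩, -⟩ := h
        rw [hd] at h4
        exact ⟨_, (I.entry_encode d ⟨u, hu⟩ _).1 h4,
          ih.tail ⟨⟨u, hu⟩, (I.marked_encode ⟨u, hu⟩).1 h3, rfl⟩⟩
    obtain ⟨d, hd, h⟩ := key _ h2
    obtain rfl : I.t = d := Fin.ext hd
    exact h
  · rintro ⟨s, h1, h2⟩
    refine ⟨s, I.lt_bound s, s.2, (I.marked_encode s).2 h1, ?_⟩
    refine h2.lift (fun a : Fin I.n => ((a : ℕ), (s : ℕ))) ?_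
    rintro a _ ⟨u, hu, rfl⟩
    exact ⟨⟨I.lt_bound _, I.lt_bound s⟩, ⟨u, I.lt_bound u, u.2, (I.marked_encode u).2 hu,
      (I.entry_encode a u _).2 rfl⟩, rfl⟩

end CSMInstance

/-- The table is chosen from `Total`; an entry of the string determines its value, so the
associativity check on the string is associativity of the chosen table. -/
theorem exists_eq_encode {x : List Bool} {n t : ℕ}
    (hlen : x.length = n * n * Nat.size n + n + 1 + n + Nat.size n)
    (hunary : ∀ i < n, x[i]? = some true) (hsep : x[n]? = some false)
    (htotal : Total x n (Nat.size n)) (hassoc : Associative x n (Nat.size n)) (ht : t < n)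
    (htarget : Word x (n * n * Nat.size n + n + 1 + n) (Nat.size n) t) :
    ∃ I : CSMInstance, I.n = n ∧ (I.t : ℕ) = t ∧ x = I.encode := by
  classical
  have h : ∀ a b : Fin n, ∃ c : Fin n, Entry x n (Nat.size n) a b c := fun a b => by
    obtain ⟨c, -, hc⟩ := htotal a a.2 b b.2
    exact ⟨⟨c, hc.2.1⟩, hc⟩
  choose table htable using h
  have huniq : ∀ (a b : Fin n) (c : ℕ), Entry x n (Nat.size n) a b c → c = table a b :=
    fun a b c hc => hc.unique (htable a b)
  let I : CSMInstance :=
    { n := n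
      table := table
      assoc := by
        intro a b c
        obtain ⟨d, -, hd, e, -, he, f, -, hf, hf'⟩ := hassoc a a.2 b b.2 c c.2
        obtain rfl := huniq _ _ _ hd
        obtain rfl := huniq _ _ _ he
        exact Fin.ext ((huniq _ _ _ hf).symm.trans (huniq _ _ _ hf'))
      X := Finset.univ.filter fun a => Marked x (n * n * Nat.size n + n + 1) a
      t := ⟨t, ht⟩ }
  refine ⟨I, rfl, rfl, I.eq_encode hlen hunary hsep (fun a b => (htable a b).2.2) ?_ htarget⟩
  intro a
  have h1 : n * n * Nat.size n + n + 1 + a < x.length := by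
    rw [hlen]
    have : (a : ℕ) < n := a.2
    omega
  have h2 : a ∈ I.X ↔ Marked x (n * n * Nat.size n + n + 1) a := Finset.mem_filter_univ a
  change x[n * n * Nat.size n + n + 1 + a]? = _
  rw [Marked] at h2
  rw [List.getElem?_eq_getElem h1] at h2 ⊢
  simp [h2]

theorem encodesYes_iff {x : List Bool} : EncodesYes x ↔
    ∃ I : CSMInstance, IsNilpotentSemigroup I.Carrier ∧ I.IsYes ∧ x = I.encode := by
  constructor
  · rintro ⟨n, -, _, -, ⟨hn, rfl⟩, hunary, hsep, _, -, rfl, _, -, rfl, _, -, rfl, _, -, rfl, _, -,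
      rfl, _, -, rfl, hlen, hlen', htotal, hassoc, hnil, t, -, ht, htarget, hgen⟩
    -- There is no bit at this position, but there is one just before it.
    have hlen : x.length = n * n * Nat.size n + n + 1 + n + Nat.size n := by
      rw [List.getElem?_eq_none_iff] at hlen
      refine le_antisymm hlen ?_
      obtain ⟨e, -, he, h | h⟩ := hlen' <;>
      · have := (List.getElem?_eq_some_iff.1 h).1
        omega
    obtain ⟨I, rfl, rfl, rfl⟩ := exists_eq_encode hlen hunary hsep htotal hassoc ht htarget
    exact ⟨I, I.nilpotent_encode.1 hnil, I.generated_encode.1 hgen, rfl⟩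
  · rintro ⟨I, hnil, hyes, rfl⟩
    have hN := length_lt_bound I.encode
    have hl := I.length_encode
    have hpos : 0 < Nat.size I.n := Nat.size_pos.2 I.t.pos
    have hm := Nat.le_mul_of_pos_right (I.n * I.n) hpos
    refine ⟨I.n, I.n_lt_bound, Nat.size I.n, by omega, ⟨I.t.pos, rfl⟩, fun i => I.encode_unary,
      I.encode_separator, _, by omega, rfl, _, by omega, rfl, _, by omega, rfl, _, by omega, rfl, _,
      by omega, rfl, _, by omega, rfl, List.getElem?_eq_none hl.le, ⟨I.encode.length - 1, by omega,
      by omega, ?_⟩, I.total_encode, I.associative_encode, I.nilpotent_encode.2 hnil, I.t,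
      I.lt_bound _, I.t.2, I.encode_target, I.generated_encode.2 hyes⟩
    rw [List.getElem?_eq_getElem (by omega)]
    cases I.encode[I.encode.length - 1]'(by omega) <;> simp

theorem csm_nilpotent_mem_NL :
    (CSM fun S [Semigroup S] => IsNilpotentSemigroup S).yes ∈ NL := by
  have h : (CSM fun S [Semigroup S] => IsNilpotentSemigroup S).yes =
      ({x | EncodesYes x} : Set (List Bool)) := Set.ext fun _ => encodesYes_iff.symm
  rw [h]
  exact encodesYes_mem_NL

end Cayley

namespace Cayley

open Relation

/-! ### Walks in finite graphs -/

section Walk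

variable {V : Type*} {E : V → V → Prop}

/-- There is a walk of the given length. -/
def Walk (E : V → V → Prop) : ℕ → V → V → Prop
  | 0, a, b => b = a
  | m + 1, a, b => ∃ c, Walk E m a c ∧ E c b

theorem exists_walk {a b : V} (h : ReflTransGen E a b) : ∃ m, Walk E m a b := by
  induction h with
  | refl => exact ⟨0, rfl⟩
  | tail _ h ih =>
    obtain ⟨m, hm⟩ := ih
    exact ⟨m + 1, _, hm, h⟩

theorem exists_short_walk [Finite V] {a b : V} (h : ReflTransGen E a b) :
    ∃ m < Nat.card V, Walk E m a b := by
  classical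
  have h := exists_walk h
  refine ⟨Nat.find h, ?_, Nat.find_spec h⟩
  -- Going back along a shortest walk from `b`: each predecessor is again at minimal distance, as a
  -- shorter walk to it could be prolonged. Vertices at different distances from `a` differ, which
  -- bounds the length.
  have key : ∀ d ≤ Nat.find h, ∃ v, Walk E (Nat.find h - d) a v ∧
      ∀ j < Nat.find h - d, ¬ Walk E j a v := by
    intro d hd
    induction d with
    | zero => exact ⟨b, Nat.find_spec h, fun j hj => Nat.find_min h hj⟩
    | succ d ih =>
      obtain ⟨v, h1, h2⟩ := ih (by omega)
      obtain ⟨m, hm⟩ : ∃ m, Nat.find h - d = m + 1 := ⟨Nat.find h - d - 1, by omega⟩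
      rw [hm] at h1 h2
      obtain ⟨c, hc, he⟩ := h1
      rw [show Nat.find h - (d + 1) = m by omega]
      exact ⟨c, hc, fun j hj hw => h2 (j + 1) (by omega) ⟨c, hw, he⟩⟩
  have key' : ∀ i : Fin (Nat.find h + 1), ∃ v, Walk E i a v ∧ ∀ j < (i : ℕ), ¬ Walk E j a v := by
    intro i
    have := key (Nat.find h - i) (by omega)
    rwa [show Nat.find h - (Nat.find h - i) = i by omega] at this
  choose v hv hv' using key'
  have hinj : Function.Injective v := by
    intro i j hij
    rcases lt_trichotomy i j with hlt | rfl | hlt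
    · exact absurd (hij ▸ hv i) (hv' j i hlt)
    · rfl
    · exact absurd (hij ▸ hv j) (hv' i j hlt)
  have := Nat.card_le_card_of_injective v hinj
  rw [Nat.card_fin] at this
  omega

end Walk

/-! ### A nilpotent semigroup that encodes reachability -/

/-- A pair of vertices of a graph whose vertices are arranged in `T + 1` layers, or zero. -/
abbrev Span (T : ℕ) (V : Type) := Option ((Fin (T + 1) × V) × (Fin (T + 1) × V))

namespace Span

variable {T : ℕ} {V : Type}

-- The edges of the graph play no role in the multiplication, so the table does not depend on the
-- input. Pairs that do not ascend have product zero with everything and are harmless.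
open Classical in
noncomputable instance : Mul (Span T V) where
  mul
    | some (a, b), some (c, d) => if b = c ∧ a.1 < b.1 ∧ b.1 < d.1 then some (a, d) else none
    | _, _ => none

theorem none_mul (s : Span T V) : (none : Span T V) * s = none := rfl

theorem mul_none (s : Span T V) : s * (none : Span T V) = none := by
  cases s <;> rfl

theorem mul_eq_some {r s : Span T V} {a d : Fin (T + 1) × V} :
    r * s = some (a, d) ↔ ∃ b, r = some (a, b) ∧ s = some (b, d) ∧ a.1 < b.1 ∧ b.1 < d.1 := by
  classical
  rcases r with _ | ⟨a', b⟩
  · simp [none_mul]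
  rcases s with _ | ⟨c, d'⟩
  · simp [mul_none]
  change (if b = c ∧ a'.1 < b.1 ∧ b.1 < d'.1 then some (a', d') else none) = some (a, d) ↔ _
  split
  · rename_i h
    obtain ⟨rfl, h⟩ := h
    constructor
    · intro h'
      simp only [Option.some.injEq, Prod.mk.injEq] at h'
      obtain ⟨rfl, rfl⟩ := h'
      exact ⟨_, rfl, rfl, h⟩
    · rintro ⟨b', h1, h2, -⟩
      simp only [Option.some.injEq, Prod.mk.injEq] at h1 h2
      rw [h1.1, h2.2]
  · rename_i h
    simp only [reduceCtorEq, false_iff]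
    rintro ⟨b', h1, h2, h3⟩
    simp only [Option.some.injEq, Prod.mk.injEq] at h1 h2
    obtain ⟨rfl, rfl⟩ := h1
    obtain ⟨rfl, rfl⟩ := h2
    exact h ⟨rfl, h3⟩

/-- Both bracketings are nonzero exactly if the three pairs form a chain through four strictly
increasing layers, and then both give its end points. -/
noncomputable instance : Semigroup (Span T V) where
  mul_assoc r s t := by
    have : ∀ a d, r * s * t = some (a, d) ↔ r * (s * t) = some (a, d) := by
      intro a d
      constructor
      · intro h
        obtain ⟨c, h1, rfl, h2, h3⟩ := mul_eq_some.1 h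
        obtain ⟨b, rfl, rfl, h4, h5⟩ := mul_eq_some.1 h1
        exact mul_eq_some.2 ⟨b, rfl, mul_eq_some.2 ⟨c, rfl, rfl, h5, h3⟩, h4, h5.trans h3⟩
      · intro h
        obtain ⟨b, rfl, h1, h2, h3⟩ := mul_eq_some.1 h
        obtain ⟨c, rfl, rfl, h4, h5⟩ := mul_eq_some.1 h1
        exact mul_eq_some.2 ⟨c, mul_eq_some.2 ⟨b, rfl, rfl, h2, h4⟩, rfl, h2.trans h4, h5⟩
    exact Option.ext fun ⟨a, d⟩ => this a d

/-- If a nonzero pair were idempotent, its end points would both be the middle vertex, contradicting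
the strict increase of layers. -/
theorem isNilpotentSemigroup : IsNilpotentSemigroup (Span T V) := by
  refine ⟨none, fun s => ⟨none_mul s, mul_none s⟩, fun e he => ?_⟩
  rcases e with _ | ⟨a, d⟩
  · rfl
  · obtain ⟨b, h1, h2, h3, -⟩ := mul_eq_some.1 he
    simp only [Option.some.injEq, Prod.mk.injEq, true_and] at h1 h2
    rw [h2.1.trans h1.symm, ← h1] at h3
    exact absurd h3 (lt_irrefl _)

/-- The generators: edges from one layer to the next one. An additional vertex `none` can be
reached from the accepting vertices and from itself. -/
def generators (T : ℕ) (E : V → V → Prop) (F : Set V) : Set (Span T (Option V))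
  | none => False
  | some ((i, u), (j, v)) => (j : ℕ) = i + 1 ∧ match u, v with
    | some c, some d => E c d
    | some c, none => c ∈ F
    | none, none => True
    | none, some _ => False

theorem mem_generators {E : V → V → Prop} {F : Set V} {i j : Fin (T + 1)} {u v : Option V} :
    (some ((i, u), (j, v)) : Span T (Option V)) ∈ generators T E F ↔
      (j : ℕ) = i + 1 ∧ match u, v with
        | some c, some d => E c d
        | some c, none => c ∈ F
        | none, none => True
        | none, some _ => False := Iff.rfl

/-- The element that stands for walks from the vertex `a` in the first layer to the additional
vertex in the last layer. -/
def target (T : ℕ) (a : V) : Span T (Option V) := some ((0, some a), (Fin.last T, none))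

/-- Each multiplication by a generator appends one edge. The extra vertex is entered only from `F`
and never left, so reaching it certifies an earlier visit to `F`. -/
theorem reachable_of_mem_closure {E : V → V → Prop} {F : Set V} {s : Span T (Option V)}
    (hs : s ∈ Subsemigroup.closure (generators T E F)) {i j : Fin (T + 1)} {a : V} {v : Option V}
    (h : s = some ((i, some a), (j, v))) :
    match v with
      | some c => ReflTransGen E a c
      | none => ∃ c ∈ F, ReflTransGen E a c := by
  rw [mem_closure_iff_reflTransGen] at hs
  obtain ⟨r, hr, hs⟩ := hs
  induction hs generalizing j v with
  | refl =>
    subst h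
    obtain ⟨-, h⟩ := mem_generators.1 hr
    cases v with
    | none => exact ⟨a, h, .refl⟩
    | some c => exact .single h
  | tail _ h' ih =>
    obtain ⟨u, hu, rfl⟩ := h'
    obtain ⟨⟨m, w⟩, h1, rfl, -⟩ := mul_eq_some.1 h
    have h2 := ih h1
    obtain ⟨-, h3⟩ := mem_generators.1 hu
    cases w with
    | none =>
      cases v with
      | none => exact h2
      | some c => exact h3.elim
    | some d =>
      cases v with
      | none => exact ⟨d, h3, h2⟩
      | some c => exact h2.tail h3

theorem target_mem_closure [Finite V] {E : V → V → Prop} {F : Set V} {a : V} :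
    target (Nat.card V) a ∈ Subsemigroup.closure (generators (Nat.card V) E F) ↔
      ∃ c ∈ F, ReflTransGen E a c := by
  constructor
  · exact fun h => reachable_of_mem_closure h rfl
  rintro ⟨c, hc, h⟩
  obtain ⟨m, hm, hw⟩ := exists_short_walk h
  set T := Nat.card V
  -- Layer `0` is treated apart because a semigroup has no empty product.
  let G (i : Fin (T + 1)) (v : Option V) : Prop := (i = 0 ∧ v = some a) ∨ 0 < i ∧
    (some ((0, some a), (i, v)) : Span T (Option V)) ∈ Subsemigroup.closure (generators T E F)
  have hstep : ∀ (i j : Fin (T + 1)) (v w : Option V), (j : ℕ) = i + 1 → G i v →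
      (some ((i, v), (j, w)) : Span T (Option V)) ∈ generators T E F → G j w := by
    intro i j v w hj hG hg
    have h0 : 0 < j := by rw [Fin.lt_def, hj]; exact Nat.succ_pos _
    rcases hG with ⟨rfl, rfl⟩ | ⟨hi, hmem⟩
    · exact Or.inr ⟨h0, Subsemigroup.subset_closure hg⟩
    · refine Or.inr ⟨h0, ?_⟩
      have h1 : (some ((0, some a), (j, w)) : Span T (Option V)) =
          some ((0, some a), (i, v)) * some ((i, v), (j, w)) :=
        (mul_eq_some.2 ⟨_, rfl, rfl, hi, by simp [Fin.lt_def, hj]⟩).symm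
      rw [h1]
      exact mul_mem hmem (Subsemigroup.subset_closure hg)
  have hwalk : ∀ (i : ℕ) (hi : i < T + 1) (d : V), Walk E i a d → G ⟨i, hi⟩ (some d) := by
    intro i
    induction i with
    | zero =>
      rintro hi d rfl
      exact Or.inl ⟨rfl, rfl⟩
    | succ i ih =>
      rintro hi d ⟨e, he, hed⟩
      exact hstep ⟨i, by omega⟩ _ _ _ rfl (ih (by omega) e he) (mem_generators.2 ⟨rfl, hed⟩)
  have hnone : ∀ (i : ℕ) (hi : m + 1 + i < T + 1), G ⟨m + 1 + i, hi⟩ none := by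
    intro i
    induction i with
    | zero =>
      intro hi
      exact hstep ⟨m, by omega⟩ _ _ _ rfl (hwalk m (by omega) c hw) (mem_generators.2 ⟨rfl, hc⟩)
    | succ i ih =>
      intro hi
      exact hstep ⟨m + 1 + i, by omega⟩ _ _ _ rfl (ih (by omega))
        (mem_generators.2 ⟨rfl, trivial⟩)
  -- A short walk has `m < T` edges, so the extra vertex is entered in layer `m + 1 ≤ T`; its loop
  -- fills the remaining layers.
  have := hnone (T - (m + 1)) (by omega)
  have hT : (⟨m + 1 + (T - (m + 1)), by omega⟩ : Fin (T + 1)) = Fin.last T :=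
    Fin.ext (by simp; omega)
  rw [hT] at this
  rcases this with ⟨-, h⟩ | ⟨-, h⟩
  · cases h
  · exact h

end Span

/-! ### Instances from finite semigroups -/

namespace CSMInstance

variable {S : Type} [Semigroup S] {n : ℕ}

open Classical in
/-- The instance that is given by a finite semigroup with a numbering of its elements. -/
noncomputable def ofEquiv (e : S ≃ Fin n) (X : Set S) (t : S) : CSMInstance where
  n := n
  table a b := e (e.symm a * e.symm b)
  assoc a b c := by simp [mul_assoc]
  X := Finset.univ.filter fun a => e.symm a ∈ X
  t := e t

theorem mem_ofEquiv {e : S ≃ Fin n} {X : Set S} {t : S} {a : Fin n} :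
    a ∈ (ofEquiv e X t).X ↔ e.symm a ∈ X := by
  classical
  exact Finset.mem_filter_univ a

theorem ofEquiv_isNilpotent {e : S ≃ Fin n} {X : Set S} {t : S} (hS : IsNilpotentSemigroup S) :
    IsNilpotentSemigroup (ofEquiv e X t).Carrier := by
  obtain ⟨z, h1, h2⟩ := hS
  refine ⟨e z, fun (a : Fin n) => ⟨?_, ?_⟩, fun (a : Fin n) ha => ?_⟩
  · change e (e.symm (e z) * e.symm a) = e z
    rw [e.symm_apply_apply, (h1 _).1]
  · change e (e.symm a * e.symm (e z)) = e z
    rw [e.symm_apply_apply, (h1 _).2]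
  · have ha : e (e.symm a * e.symm a) = a := ha
    have := h2 (e.symm a) (e.injective (by rw [ha, e.apply_symm_apply]))
    exact e.symm_apply_eq.1 this

theorem ofEquiv_isYes {e : S ≃ Fin n} {X : Set S} {t : S} :
    (ofEquiv e X t).IsYes ↔ t ∈ Subsemigroup.closure X := by
  rw [isYes_iff, mem_closure_iff_reflTransGen]
  constructor
  · rintro ⟨s, hs, h⟩
    refine ⟨e.symm s, mem_ofEquiv.1 hs, ?_⟩
    have := h.lift (p := fun a b => ∃ u ∈ X, b = a * u) e.symm ?_
    · change ReflTransGen _ (e.symm s) (e.symm (e t)) at this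
      rwa [e.symm_apply_apply] at this
    · rintro a _ ⟨u, hu, rfl⟩
      exact ⟨_, mem_ofEquiv.1 hu, e.symm_apply_apply _⟩
  · rintro ⟨s, hs, h⟩
    refine ⟨e s, mem_ofEquiv.2 (by rwa [e.symm_apply_apply]), h.lift e ?_⟩
    rintro a _ ⟨u, hu, rfl⟩
    refine ⟨e u, mem_ofEquiv.2 (by rwa [e.symm_apply_apply]), ?_⟩
    change _ = e (e.symm (e a) * e.symm (e u))
    rw [e.symm_apply_apply, e.symm_apply_apply]

end CSMInstance

end Cayley

namespace Cayley

open Relation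

/-! ### Functions whose output bits are constants or literals -/

/-- A constant, an input bit, or a negated input bit. -/
inductive Literal (n : ℕ) where
  | const (b : Bool)
  | pos (i : Fin n)
  | neg (i : Fin n)

namespace Literal

variable {n : ℕ}

/-- The value of a literal. -/
def eval (x : Fin n → Bool) : Literal n → Bool
  | const b => b
  | pos i => x i
  | neg i => !x i

instance : Finite (Literal n) := by
  refine Finite.of_surjective (fun o : Bool ⊕ (Fin n ⊕ Fin n) => match o with
    | .inl b => const b
    | .inr (.inl i) => pos i
    | .inr (.inr i) => neg i) ?_
  rintro (b | i | i)
  exacts [⟨.inl b, rfl⟩, ⟨.inr (.inl i), rfl⟩, ⟨.inr (.inr i), rfl⟩]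

/-- The gate that computes a literal. -/
def gate : Literal n → Gate n (Literal n)
  | const true => .and ∅
  | const false => .or ∅
  | pos i => .input i
  | neg i => .not (pos i)

theorem acyclic : WellFounded fun g h : Literal n => g ∈ (gate h).preds := by
  refine Subrelation.wf (r := InvImage (· < ·) fun l : Literal n => match l with
    | neg _ => 1
    | _ => 0) ?_ (InvImage.wf _ Nat.lt_wfRel.wf)
  intro g h hg
  rcases h with (_ | _) | i | i
  · exact hg.elim
  · exact hg.elim
  · exact hg.elim
  · obtain rfl : g = pos i := hg
    exact Nat.zero_lt_one

/-- The circuit with the given literals as outputs. -/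
abbrev circuit {m : ℕ} (out : Fin m → Literal n) : Circuit n m where
  G := Literal n
  finite := inferInstance
  gate := gate
  acyclic := acyclic
  out := out

variable {m : ℕ} (out : Fin m → Literal n)

theorem value_circuit (x : Fin n → Bool) (l : Literal n) :
    (circuit out).value x l ↔ l.eval x = true := by
  have hpos (i : Fin n) : (circuit out).value x (pos i) ↔ x i = true :=
    (Circuit.value_eq (circuit out) x (pos i)).to_iff
  refine (Circuit.value_eq (circuit out) x l).to_iff.trans ?_
  rcases l with (_ | _) | i | i
  · simp [gate, Gate.value, eval]
  · simp [gate, Gate.value, eval]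
  · simp [gate, Gate.value, eval]
  · change ¬ (circuit out).value x (pos i) ↔ _
    rw [hpos]
    simp [eval]

theorem output_circuit (x : Fin n → Bool) :
    (circuit out).output x = List.ofFn fun j => (out j).eval x := by
  classical
  rw [Circuit.output]
  congr 1
  funext j
  rw [Bool.eq_iff_iff, decide_eq_true_iff]
  exact value_circuit out x _

/-- Only the two constants, realised as the empty AND and the empty OR, are counted gates. -/
theorem size_circuit : (circuit out).size ≤ 2 := by
  have : {g : (circuit out).G | ((circuit out).gate g).Counted} ⊆
      ({const true, const false} : Set (Literal n)) := by
    rintro ((_ | _) | i | i) h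
    · exact Or.inr rfl
    · exact Or.inl rfl
    · exact h.elim
    · exact h.elim
  exact (Set.ncard_le_ncard this
    (Set.toFinite ({const true, const false} : Set (Literal n)))).trans
    ((Set.ncard_insert_le _ _).trans (by rw [Set.ncard_singleton]))

theorem depthLE_circuit (l : (circuit out).G) : (circuit out).DepthLE 1 l := by
  have hfree (d : ℕ) (g : Literal n) := Circuit.DepthLE.free (C := circuit out) d g
  have hcounted (d : ℕ) (g : Literal n) := Circuit.DepthLE.counted (C := circuit out) d g
  have hpos (i : Fin n) : (circuit out).DepthLE 1 (pos i) :=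
    hfree 1 (pos i) id fun h hh => False.elim hh
  rcases l with (_ | _) | i | i
  · exact hcounted 0 (const false) trivial fun h hh => False.elim hh
  · exact hcounted 0 (const true) trivial fun h hh => False.elim hh
  · exact hpos i
  · refine hfree 1 (neg i) id fun h hh => ?_
    obtain rfl : h = pos i := hh
    exact hpos i

end Literal

/-- The property of strings of length `n` is given by a literal. -/
def IsLiteral {n : ℕ} (Q : (Fin n → Bool) → Prop) : Prop :=
  ∃ l : Literal n, ∀ x, Q x ↔ l.eval x = true

theorem isLiteral_const {n : ℕ} (P : Prop) : IsLiteral fun _ : Fin n → Bool => P := by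
  classical
  exact ⟨.const (decide P), fun x => by simp [Literal.eval]⟩

theorem IsLiteral.and_left {n : ℕ} (P : Prop) {Q : (Fin n → Bool) → Prop} (hQ : IsLiteral Q) :
    IsLiteral fun x => P ∧ Q x := by
  by_cases hP : P
  · simpa [hP] using hQ
  · simpa [hP] using isLiteral_const False

theorem isLiteral_of_forall {n : ℕ} {Q : (Fin n → Bool) → Prop} (h : ∀ x y, Q x ↔ Q y) :
    IsLiteral Q := by
  obtain ⟨l, hl⟩ := isLiteral_const (n := n) (Q fun _ => true)
  exact ⟨l, fun x => (h x _).trans (hl x)⟩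

/-- There are four Boolean functions of one bit: two constants, the bit and its negation. -/
theorem isLiteral_of_dependsOn {n : ℕ} {Q : (Fin n → Bool) → Prop} (i : Fin n)
    (h : ∀ x y, x i = y i → (Q x ↔ Q y)) : IsLiteral Q := by
  have h1 : ∀ x, Q x ↔ Q fun _ => x i := fun x => h _ _ rfl
  by_cases ht : Q fun _ => true <;> by_cases hf : Q fun _ => false
  · exact ⟨.const true, fun x => by rw [h1]; cases x i <;> simp [ht, hf, Literal.eval]⟩
  · refine ⟨.pos i, fun x => ?_⟩
    rw [h1, Literal.eval]
    cases x i <;> simp [ht, hf]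
  · refine ⟨.neg i, fun x => ?_⟩
    rw [h1, Literal.eval]
    cases x i <;> simp [ht, hf]
  · exact ⟨.const false, fun x => by rw [h1]; cases x i <;> simp [ht, hf, Literal.eval]⟩

/-! ### Polynomial bounds -/

/-- The function is bounded by a polynomial. -/
def PolyBounded (g : ℕ → ℕ) : Prop := ∃ p : Polynomial ℕ, ∀ n, g n ≤ p.eval n

namespace PolyBounded

variable {g h : ℕ → ℕ}

theorem mono (hh : PolyBounded h) (H : ∀ n, g n ≤ h n) : PolyBounded g := by
  obtain ⟨p, hp⟩ := hh
  exact ⟨p, fun n => (H n).trans (hp n)⟩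

theorem const (c : ℕ) : PolyBounded fun _ => c := ⟨.C c, fun n => by simp⟩

theorem id : PolyBounded fun n => n := ⟨.X, fun n => by simp⟩

theorem add (hg : PolyBounded g) (hh : PolyBounded h) : PolyBounded fun n => g n + h n := by
  obtain ⟨p, hp⟩ := hg
  obtain ⟨q, hq⟩ := hh
  exact ⟨p + q, fun n => by rw [Polynomial.eval_add]; exact Nat.add_le_add (hp n) (hq n)⟩

theorem mul (hg : PolyBounded g) (hh : PolyBounded h) : PolyBounded fun n => g n * h n := by
  obtain ⟨p, hp⟩ := hg
  obtain ⟨q, hq⟩ := hh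
  exact ⟨p * q, fun n => by rw [Polynomial.eval_mul]; exact Nat.mul_le_mul (hp n) (hq n)⟩

theorem pow (hg : PolyBounded g) (c : ℕ) : PolyBounded fun n => g n ^ c := by
  obtain ⟨p, hp⟩ := hg
  exact ⟨p ^ c, fun n => by rw [Polynomial.eval_pow]; exact Nat.pow_le_pow_left (hp n) c⟩

theorem log : PolyBounded fun n => Nat.log 2 n := id.mono fun n => Nat.log_le_self 2 n

theorem pow_log (s : ℕ) : PolyBounded fun n => s ^ Nat.log 2 n := by
  refine ((id.add (const 1)).pow s).mono fun n => ?_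
  have h1 : 2 ^ Nat.log 2 n ≤ n + 1 := by
    rcases Nat.eq_zero_or_pos n with rfl | hn
    · simp
    · exact (Nat.pow_log_le_self 2 hn.ne').trans (Nat.le_succ n)
  calc s ^ Nat.log 2 n ≤ (2 ^ s) ^ Nat.log 2 n := Nat.pow_le_pow_left Nat.lt_two_pow_self.le _
    _ = (2 ^ Nat.log 2 n) ^ s := by rw [← pow_mul, ← pow_mul, mul_comm]
    _ ≤ (n + 1) ^ s := Nat.pow_le_pow_left h1 s

end PolyBounded

theorem ac0Computable_of_literals {f : List Bool → List Bool} (len : ℕ → ℕ) (hlen : PolyBounded len)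
    (h : ∀ n, ∃ ls : List (Literal n), ls.length ≤ len n ∧
      ∀ x : Fin n → Bool, f (List.ofFn x) = ls.map (Literal.eval x)) : AC0Computable f := by
  obtain ⟨p, hp⟩ := hlen
  -- Depth one suffices, and the summand `2` pays for the constant gates.
  refine ⟨1, p + 2, fun n => ?_⟩
  obtain ⟨ls, h1, h2⟩ := h n
  have h3 := hp n
  have h4 : (p + 2).eval n = p.eval n + 2 := by simp
  refine ⟨ls.length, Literal.circuit ls.get, by omega, ?_, Literal.depthLE_circuit _, fun x => ?_⟩
  · have := Literal.size_circuit ls.get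
    omega
  · rw [h2, Literal.output_circuit]
    apply List.ext_getElem <;> simp

/-! ### Configurations of bounded size -/

namespace NTM

variable (M : NTM)

/-- The configurations with input heads on the cells `0, …, n + 1` and work tapes with cells
`0, …, b`. -/
abbrev SmallConfig (n b : ℕ) : Type :=
  M.State × Fin (n + 2) × (Fin M.tapes → Fin (b + 1)) × (Fin M.tapes → Fin (b + 1) → M.Symbol)

variable {M} {n b : ℕ}

/-- A configuration of bounded size as a configuration of the machine. -/
def SmallConfig.toConfig (c : M.SmallConfig n b) : M.Config where
  state := c.1
  inputHead := c.2.1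
  workHead i := c.2.2.1 i
  work i p := if h : p < b + 1 then c.2.2.2 i ⟨p, h⟩ else M.blank

/-- The initial configuration. -/
def SmallConfig.init : M.SmallConfig n b := (M.start, 0, fun _ => 0, fun _ _ => M.blank)

theorem SmallConfig.toConfig_init : (init : M.SmallConfig n b).toConfig = M.init := by
  simp [toConfig, init, NTM.init]

theorem exists_smallConfig {c : M.Config} (h1 : c.inputHead ≤ n + 1) (h2 : ∀ i, c.workHead i ≤ b)
    (h3 : ∀ i p, b < p → c.work i p = M.blank) : ∃ s : M.SmallConfig n b, s.toConfig = c := by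
  refine ⟨(c.state, ⟨c.inputHead, by omega⟩, fun i => ⟨c.workHead i, by have := h2 i; omega⟩,
    fun i p => c.work i p), ?_⟩
  obtain ⟨q, p, hd, w⟩ := c
  simp only [SmallConfig.toConfig, Config.mk.injEq, true_and]
  funext i p
  split
  · rfl
  · exact (h3 i p (by omega)).symm

theorem Reachable.bounds {x : List Bool} {c : M.Config} (hx : x.length = n)
    (hb : ∀ c, M.Reachable x c → ∀ i, c.workHead i ≤ b) (hc : M.Reachable x c) :
    c.inputHead ≤ n + 1 ∧ ∀ i p, b < p → c.work i p = M.blank := by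
  induction hc with
  | refl => exact ⟨Nat.zero_le _, fun _ _ _ => rfl⟩
  | tail hc h ih =>
    obtain ⟨a, -, rfl⟩ := h
    refine ⟨by rw [← hx]; exact min_le_left _ _, fun i p hp => ?_⟩
    have := hb _ hc i
    change Function.update _ _ _ _ = _
    rw [Function.update_of_ne (by omega)]
    exact ih.2 i p hp

theorem accepts_iff_small {x : List Bool} (hx : x.length = n)
    (hb : ∀ c, M.Reachable x c → ∀ i, c.workHead i ≤ b) :
    M.Accepts x ↔ ∃ c ∈ {c : M.SmallConfig n b | c.1 ∈ M.accepting},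
      ReflTransGen (fun c d : M.SmallConfig n b => M.Step x c.toConfig d.toConfig)
        SmallConfig.init c := by
  have hsmall : ∀ c, M.Reachable x c → ∃ s : M.SmallConfig n b, s.toConfig = c := fun c hc =>
    exists_smallConfig (Reachable.bounds hx hb hc).1 (hb c hc) (Reachable.bounds hx hb hc).2
  constructor
  · rintro ⟨c, hc, hacc⟩
    have : ∃ s : M.SmallConfig n b, s.toConfig = c ∧
        ReflTransGen (fun c d : M.SmallConfig n b => M.Step x c.toConfig d.toConfig)
          SmallConfig.init s := by
      clear hacc
      induction hc with
      | refl => exact ⟨_, SmallConfig.toConfig_init, .refl⟩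
      | tail hc h ih =>
        obtain ⟨s, rfl, hs⟩ := ih
        obtain ⟨s', rfl⟩ := hsmall _ (hc.tail h)
        exact ⟨s', rfl, hs.tail h⟩
    obtain ⟨s, rfl, hs⟩ := this
    exact ⟨s, hacc, hs⟩
  · rintro ⟨s, hacc, hs⟩
    refine ⟨s.toConfig, ?_, hacc⟩
    have := hs.lift (p := M.Step x) SmallConfig.toConfig fun _ _ h => h
    change ReflTransGen _ SmallConfig.init.toConfig s.toConfig at this
    rwa [SmallConfig.toConfig_init] at this

theorem step_congr {x y : List Bool} {c d : M.Config} (hl : x.length = y.length)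
    (h : inputAt x c.inputHead = inputAt y c.inputHead) : M.Step x c d ↔ M.Step y c d := by
  simp only [Step, perform, h, hl]

/-- The head position is part of `c`, so a step inspects one fixed input cell. For inputs of length
`n` this cell holds an end marker or one particular bit. -/
theorem isLiteral_step (c d : M.SmallConfig n b) :
    IsLiteral fun x : Fin n → Bool => M.Step (List.ofFn x) c.toConfig d.toConfig := by
  obtain ⟨⟨p, hp⟩, hc⟩ : ∃ p : Fin (n + 2), c.2.1 = p := ⟨_, rfl⟩
  have hh : c.toConfig.inputHead = p := congrArg Fin.val hc
  rcases p with _ | p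
  · exact isLiteral_of_forall fun x y => step_congr (by simp) (by rw [hh]; rfl)
  · by_cases hpn : p < n
    · refine isLiteral_of_dependsOn ⟨p, hpn⟩ fun x y hxy => step_congr (by simp) ?_
      rw [hh]
      simp [inputAt, hpn, hxy]
    · refine isLiteral_of_forall fun x y => step_congr (by simp) ?_
      rw [hh]
      simp [inputAt, hpn]

/-- The number of contents of logarithmically many cells over a fixed alphabet is polynomial, by
`PolyBounded.pow_log`. -/
theorem polyBounded_card (M : NTM) (k : ℕ) :
    PolyBounded fun n => Nat.card (M.SmallConfig n (k * (Nat.log 2 n + 1))) := by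
  have := M.finite_state
  have := M.finite_symbol
  have hb : PolyBounded fun n => k * (Nat.log 2 n + 1) + 1 :=
    ((PolyBounded.const k).mul (PolyBounded.log.add (.const 1))).add (.const 1)
  have hw : PolyBounded fun n => Nat.card M.Symbol ^ (k * (Nat.log 2 n + 1) + 1) := by
    refine (((PolyBounded.pow_log (Nat.card M.Symbol)).pow k).mul
      (.const (Nat.card M.Symbol ^ (k + 1)))).mono fun n => le_of_eq ?_
    rw [← pow_mul, ← pow_add]
    congr 1
    ring
  refine ((PolyBounded.const (Nat.card M.State)).mul ((PolyBounded.id.add (.const 2)).mul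
    ((hb.pow M.tapes).mul (hw.pow M.tapes)))).mono fun n => le_of_eq ?_
  simp [Nat.card_prod, Nat.card_fun]

end NTM

/-! ### Hardness -/

/-- Needed since `yes` only provides some instance with the given encoding. The first `0` determines
the order, the last block the target, and by `generated_encode` the answer is a property of the
string. -/
theorem CSMInstance.isYes_of_encode_eq {I J : CSMInstance} (h : I.encode = J.encode)
    (hJ : J.IsYes) : I.IsYes := by
  have hn : I.n = J.n := by
    rcases lt_trichotomy I.n J.n with hlt | heq | hlt
    · have := J.encode_unary hlt
      rw [← h, I.encode_separator] at this
      simp at this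
    · exact heq
    · have := I.encode_unary hlt
      rw [h, J.encode_separator] at this
      simp at this
  have ht : (I.t : ℕ) = J.t := by
    have h1 := I.encode_target
    have h2 := J.encode_target
    have hlt : (J.t : ℕ) < 2 ^ Nat.size I.n := by rw [hn]; exact J.t.2.trans (Nat.lt_size_self _)
    generalize (J.t : ℕ) = t at h2 hlt ⊢
    rw [← h, ← hn] at h2
    exact h1.unique (I.t.2.trans (Nat.lt_size_self _)) hlt h2
  have := J.generated_encode.2 hJ
  rw [← ht, ← h, ← hn] at this
  exact I.generated_encode.1 this

theorem encode_eq_map {n : ℕ} {α : Type*} (I : α → CSMInstance) (ev : α → Literal n → Bool)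
    (hev : ∀ x b, ev x (.const b) = b) {N : ℕ} (table : Fin N → Fin N → Fin N)
    (hassoc : ∀ a b c, table (table a b) c = table a (table b c)) (t : Fin N)
    (X : α → Finset (Fin N)) (hI : ∀ x, I x = ⟨N, table, hassoc, X x, t⟩)
    (hX : ∀ a, ∃ l : Literal n, ∀ x, a ∈ X x ↔ ev x l = true) :
    ∃ ls : List (Literal n), ∀ x, (I x).encode = ls.map (ev x) := by
  choose l hl using hX
  have hl' : ∀ a x, decide (a ∈ X x) = ev x (l a) := fun a x => by
    rw [Bool.eq_iff_iff, decide_eq_true_iff, hl]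
  have hconst : ∀ x (w : List Bool), w = (w.map Literal.const).map (ev x) := fun x w => by
    simp [hev, Function.comp_def]
  refine ⟨(List.replicate N true ++ [false] ++
    (List.finRange N).flatMap (fun a =>
      (List.finRange N).flatMap fun b => CSMInstance.encodeElem N (table a b))).map .const ++
    List.ofFn l ++ (CSMInstance.encodeElem N t).map .const, fun x => ?_⟩
  rw [hI, List.map_append, List.map_append, ← hconst, ← hconst, List.map_ofFn]
  simp only [CSMInstance.encode, hl']
  rfl

theorem polyBounded_length {N : ℕ → ℕ} (hN : PolyBounded N) :
    PolyBounded fun n => N n * N n * Nat.size (N n) + N n + 1 + N n + Nat.size (N n) := by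
  have hs : PolyBounded fun n => Nat.size (N n) := hN.mono fun n => size_le_self _
  exact (((((hN.mul hN).mul hs).add hN).add (.const 1)).add hN).add hs

theorem ac0Reducible_csm_nilpotent {L : Language Bool} (hL : L ∈ NL) :
    AC0Reducible L (CSM fun S [Semigroup S] => IsNilpotentSemigroup S) := by
  classical
  obtain ⟨M, ⟨k, hk⟩, hM⟩ := hL
  have := M.finite_state
  have := M.finite_symbol
  let V (n : ℕ) : Type := M.SmallConfig n (k * (Nat.log 2 n + 1))
  have hfin : ∀ n, Finite (V n) := fun n => inferInstance
  let T (n : ℕ) : ℕ := Nat.card (V n)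
  let S (n : ℕ) : Type := Span (T n) (Option (V n))
  have hfinS : ∀ n, Finite (S n) := fun n => inferInstance
  -- The numbering is fixed for each input length, before the input is known; it need not be uniform
  -- in `n`.
  let e (n : ℕ) : S n ≃ Fin (Nat.card (S n)) := Finite.equivFin (S n)
  let gens (n : ℕ) (x : List Bool) : Set (S n) := Span.generators (T n)
    (fun c d : V n => M.Step x c.toConfig d.toConfig) {c | c.1 ∈ M.accepting}
  let inst (n : ℕ) (x : List Bool) : CSMInstance :=
    CSMInstance.ofEquiv (e n) (gens n x) (Span.target (T n) NTM.SmallConfig.init)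
  have hnil : ∀ n x, IsNilpotentSemigroup (inst n x).Carrier := fun n x =>
    CSMInstance.ofEquiv_isNilpotent Span.isNilpotentSemigroup
  have hyes : ∀ x, x ∈ L ↔ (inst x.length x).IsYes := by
    intro x
    rw [hM, NTM.accepts_iff_small rfl (hk x), CSMInstance.ofEquiv_isYes]
    exact Span.target_mem_closure.symm
  have hcard : PolyBounded fun n => Nat.card (S n) := by
    have h := M.polyBounded_card k
    refine ((((h.add (.const 1)).mul (h.add (.const 1))).pow 2).add (.const 1)).mono fun n =>
      le_of_eq ?_
    have h1 : Nat.card (Option (V n)) = Nat.card (V n) + 1 := Finite.card_option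
    have h2 : Nat.card (S n) = Nat.card ((Fin (T n + 1) × Option (V n)) ×
      (Fin (T n + 1) × Option (V n))) + 1 := Finite.card_option
    rw [h2, Nat.card_prod, Nat.card_prod, Nat.card_fin, h1]
    ring
  refine ⟨fun x => (inst x.length x).encode, ?_, fun x => ⟨_, hnil _ _, rfl⟩, fun x => ?_⟩
  · refine ac0Computable_of_literals _ (polyBounded_length hcard) fun n => ?_
    have hlit : ∀ a : Fin (Nat.card (S n)), IsLiteral fun x : Fin n → Bool =>
        a ∈ (inst n (List.ofFn x)).X := by
      intro a
      simp only [inst, CSMInstance.mem_ofEquiv]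
      rcases (e n).symm a with _ | ⟨⟨i, u⟩, ⟨j, v⟩⟩
      · exact isLiteral_const False
      · simp only [gens]
        refine .and_left _ ?_
        rcases u with _ | c <;> rcases v with _ | d
        · exact isLiteral_const _
        · exact isLiteral_const _
        · exact isLiteral_const _
        · exact NTM.isLiteral_step c d
    -- The table is the same for all strings, so the associativity proof of the instance for `[]`
    -- serves for every input of length `n`.
    obtain ⟨ls, hls⟩ := encode_eq_map (fun x : Fin n → Bool => inst n (List.ofFn x)) Literal.eval
      (fun _ _ => rfl) (fun a b => (e n) ((e n).symm a * (e n).symm b))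
      (inst n []).assoc ((e n) (Span.target (T n) NTM.SmallConfig.init))
      (fun x => (inst n (List.ofFn x)).X) (fun x => rfl) hlit
    refine ⟨ls, ?_, fun x => ?_⟩
    · have h1 := congrArg List.length (hls fun _ => false)
      rw [CSMInstance.length_encode, List.length_map] at h1
      exact h1.ge
    · rw [← hls, List.length_ofFn]
  · rw [hyes]
    constructor
    · exact fun h => ⟨_, hnil _ _, h, rfl⟩
    · rintro ⟨J, -, hJ, h⟩
      exact CSMInstance.isYes_of_encode_eq h hJ

end Cayley

theorem mainTheorem6 :
    Cayley.NLComplete (Cayley.CSM fun S [Semigroup S] => Cayley.IsNilpotentSemigroup S) :=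
  ⟨Cayley.csm_nilpotent_mem_NL, fun _ => Cayley.ac0Reducible_csm_nilpotent⟩
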